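/- An instance $\mathcal I=(X,D,\mathrm{dom},N)$ of the Consistency problem for AtMost-NValue constraints consists of variables $X=\{x_1,\dots,x_n\}$, a finite totally ordered set $D$ of values, a non-empty domain $\mathrm{dom}(x)\subseteq D$ for every $x\in X$, and an integer $N$. It is consistent if there is an assignment $\alpha$ with $\alpha(x)\in\mathrm{dom}(x)$ for all $x\in X$ that uses at most $N$ different values. A hole in a set $D'\subseteq D$ is a pair $(u,w)\in D'\times D'$ such that some $v\in D\setminus D'$ satisfies $u<v<w$ but no $v'\in D'$ satisfies $u<v'<w$. Let $k$ be the sum over all $x\in X$ of the number of holes in $\mathrm{dom}(x)$. The instance is given succinctly: by $n$, $|D|$, $N$ and, for every variable, the number of intervals (inclusion-wise maximal hole-free subsets) of its domain together with their left and right endpoints, listed from left to right, values being identified with their positions in $D$. The size of the instance is $|\mathcal I|=n+|D|+k+1$. Theorem. There is an algorithm (a single program for a unit-cost random access machine with integer addition, subtraction and comparison) and a constant $C$ such that on every instance $\mathcal I$ the algorithm halts after at most $C\cdot(\rho^k k^2+|\mathcal I|)$ steps and correctly decides whether $\mathcal I$ is consistent, where $\rho=\frac{1+\sqrt5}{2}<1.6181$.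 That is, Consistency of AtMost-NValue constraints can be decided in time $O(\rho^k k^2+|\mathcal I|)$. -/

import Mathlib

/-! ### The machine model

Random access machines with unit cost, programmed by structured commands. A state consists of integer
registers and of integer arrays with random access; a program names only finitely many of them. The
arithmetic operations are addition and subtraction. Every operation of an expression, every test, every
assignment and every evaluation of a branching condition takes one step. -/

namespace RAM

/-- A state: register number `x` holds `reg x`, and cell `i` of array number `a` holds `arr a i`. -/
structure State where
  reg : ℕ → ℤ
  arr : ℕ → ℤ → ℤ

/-- Arithmetic expressions; `read a i` is the content of cell `i` of array `a`. -/
inductive Expr where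
  | const (c : ℤ) : Expr
  | reg (x : ℕ) : Expr
  | read (a : ℕ) (i : Expr) : Expr
  | add (e f : Expr) : Expr
  | sub (e f : Expr) : Expr

/-- The value of an expression. -/
def Expr.eval (s : State) : Expr → ℤ
  | .const c => c
  | .reg x => s.reg x
  | .read a i => s.arr a (i.eval s)
  | .add e f => e.eval s + f.eval s
  | .sub e f => e.eval s - f.eval s

/-- The number of steps needed to evaluate an expression. -/
def Expr.cost : Expr → ℕ
  | .const _ => 1
  | .reg _ => 1
  | .read _ i => i.cost + 1
  | .add e f => e.cost + f.cost + 1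
  | .sub e f => e.cost + f.cost + 1

/-- Tests. -/
inductive Test where
  | le (e f : Expr) : Test
  | eq (e f : Expr) : Test
  | not (b : Test) : Test
  | and (b c : Test) : Test

/-- A test holds in a state. -/
def Test.Holds (s : State) : Test → Prop
  | .le e f => e.eval s ≤ f.eval s
  | .eq e f => e.eval s = f.eval s
  | .not b => ¬ b.Holds s
  | .and b c => b.Holds s ∧ c.Holds s

/-- The number of steps needed to evaluate a test. -/
def Test.cost : Test → ℕ
  | .le e f => e.cost + f.cost + 1
  | .eq e f => e.cost + f.cost + 1
  | .not b => b.cost + 1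
  | .and b c => b.cost + c.cost + 1

/-- Commands (programs): `assign x e` is `x := e` and `store a i e` is `a[i] := e`. -/
inductive Cmd where
  | skip : Cmd
  | assign (x : ℕ) (e : Expr) : Cmd
  | store (a : ℕ) (i e : Expr) : Cmd
  | seq (c d : Cmd) : Cmd
  | ite (b : Test) (c d : Cmd) : Cmd
  | while (b : Test) (c : Cmd) : Cmd

/-- Overwrite register `x`. -/
def State.setReg (s : State) (x : ℕ) (v : ℤ) : State where
  reg := Function.update s.reg x v
  arr := s.arr

/-- Overwrite cell `i` of array `a`. -/
def State.setArr (s : State) (a : ℕ) (i v : ℤ) : State where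
  reg := s.reg
  arr := Function.update s.arr a (Function.update (s.arr a) i v)

/-- `Exec c s t s'`: started in state `s`, the command `c` terminates after exactly `t` steps, in
state `s'`. -/
inductive Exec : Cmd → State → ℕ → State → Prop
  | skip (s : State) : Exec .skip s 1 s
  | assign (x : ℕ) (e : Expr) (s : State) :
      Exec (.assign x e) s (e.cost + 1) (s.setReg x (e.eval s))
  | store (a : ℕ) (i e : Expr) (s : State) :
      Exec (.store a i e) s (i.cost + e.cost + 1) (s.setArr a (i.eval s) (e.eval s))
  | seq {c d : Cmd} {s s₁ s₂ : State} {t₁ t₂ : ℕ} :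
      Exec c s t₁ s₁ → Exec d s₁ t₂ s₂ → Exec (.seq c d) s (t₁ + t₂) s₂
  | ite_true {b : Test} {c d : Cmd} {s s' : State} {t : ℕ} :
      b.Holds s → Exec c s t s' → Exec (.ite b c d) s (b.cost + 1 + t) s'
  | ite_false {b : Test} {c d : Cmd} {s s' : State} {t : ℕ} :
      ¬ b.Holds s → Exec d s t s' → Exec (.ite b c d) s (b.cost + 1 + t) s'
  | while_false {b : Test} {c : Cmd} {s : State} :
      ¬ b.Holds s → Exec (.while b c) s (b.cost + 1) s
  | while_true {b : Test} {c : Cmd} {s s₁ s₂ : State} {t₁ t₂ : ℕ} :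
      b.Holds s → Exec c s t₁ s₁ → Exec (.while b c) s₁ t₂ s₂ →
      Exec (.while b c) s (b.cost + 1 + t₁ + t₂) s₂

/-- The machine is deterministic: running time and final state are determined by the initial state. -/
theorem Exec.deterministic {c : Cmd} {s s₁ : State} {t₁ : ℕ} (h₁ : Exec c s t₁ s₁) :
    ∀ {t₂ : ℕ} {s₂ : State}, Exec c s t₂ s₂ → t₁ = t₂ ∧ s₁ = s₂ := by
  induction h₁ with
  | skip => intro t₂ s₂ h; cases h; exact ⟨rfl, rfl⟩
  | assign => intro t₂ s₂ h; cases h; exact ⟨rfl, rfl⟩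
  | store => intro t₂ s₂ h; cases h; exact ⟨rfl, rfl⟩
  | seq _ _ ih₁ ih₂ =>
    intro t₂ s₂ h
    cases h with
    | seq g₁ g₂ =>
      obtain ⟨rfl, rfl⟩ := ih₁ g₁
      obtain ⟨rfl, rfl⟩ := ih₂ g₂
      exact ⟨rfl, rfl⟩
  | ite_true hb _ ih =>
    intro t₂ s₂ h
    cases h with
    | ite_true _ g => obtain ⟨rfl, rfl⟩ := ih g; exact ⟨rfl, rfl⟩
    | ite_false hb' _ => exact absurd hb hb'
  | ite_false hb _ ih =>
    intro t₂ s₂ h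
    cases h with
    | ite_true hb' _ => exact absurd hb' hb
    | ite_false _ g => obtain ⟨rfl, rfl⟩ := ih g; exact ⟨rfl, rfl⟩
  | while_false hb =>
    intro t₂ s₂ h
    cases h with
    | while_false _ => exact ⟨rfl, rfl⟩
    | while_true hb' _ _ => exact absurd hb' hb
  | while_true hb _ _ ih₁ ih₂ =>
    intro t₂ s₂ h
    cases h with
    | while_false hb' => exact absurd hb hb'
    | while_true _ g₁ g₂ =>
      obtain ⟨rfl, rfl⟩ := ih₁ g₁
      obtain ⟨rfl, rfl⟩ := ih₂ g₂
      exact ⟨rfl, rfl⟩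

/-- The initial state on input `w`: the input stands in array `0`, starting with cell `0`; all other
cells and all registers hold `0`. -/
def State.init (w : List ℤ) : State where
  reg := fun _ => 0
  arr := fun a i => if a = 0 ∧ 0 ≤ i then w.getD i.toNat 0 else 0

end RAM

/-! ### AtMost-NValue constraints -/

section Domains

variable {D : Type*} [LinearOrder D] [Fintype D]

/-- The holes of a subset `S` of `D`: the pairs `(u, w)` of elements of `S` such that some value
outside of `S`, but no value in `S`, lies strictly between `u` and `w`. -/
noncomputable def holes (S : Finset D) : Finset (D × D) :=
  {p | p.1 ∈ S ∧ p.2 ∈ S ∧ (∃ v, v ∉ S ∧ p.1 < v ∧ v < p.2) ∧ ¬ ∃ v ∈ S, p.1 < v ∧ v < p.2}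

/-- The intervals of a domain `S`: its inclusion-wise maximal hole-free subsets. -/
def IsIntervalOf (S T : Finset D) : Prop :=
  Maximal (fun U : Finset D => U ⊆ S ∧ holes U = ∅) T

open Classical in
/-- The pairs (left endpoint, right endpoint) of the intervals of a domain `S`, ordered
lexicographically, hence from left to right. -/
noncomputable def intervalEndpoints (S : Finset D) : Finset (D ×ₗ D) :=
  {p | ∃ T : Finset D, IsIntervalOf S T ∧
    IsLeast (T : Set D) (ofLex p).1 ∧ IsGreatest (T : Set D) (ofLex p).2}

/-- The position of a value in the totally ordered set `D`, starting with `0`. -/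
def valueRank (v : D) : ℕ := (Finset.univ.filter (fun u : D => u < v)).card

end Domains

/-- An instance of the consistency problem for AtMost-NValue constraints: variables `x_1, …, x_n`,
a totally ordered finite set `D` of values, non-empty domains, and an integer `N`. -/
structure AtMostNValue (n : ℕ) (D : Type*) where
  dom : Fin n → Finset D
  dom_nonempty : ∀ x, (dom x).Nonempty
  N : ℤ

namespace AtMostNValue

variable {n : ℕ} {D : Type*} [LinearOrder D] [Fintype D]

/-- The constraint is consistent: some instantiation uses at most `N` different values. -/
def Consistent (I : AtMostNValue n D) : Prop :=
  ∃ α : Fin n → D, (∀ x, α x ∈ I.dom x) ∧ ((Finset.univ.image α).card : ℤ) ≤ I.N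

/-- The parameter `k`: the total number of holes in the domains. -/
noncomputable def numHoles (I : AtMostNValue n D) : ℕ := ∑ x, (holes (I.dom x)).card

/-- The size of an instance, `n + |D| + k`, and one more for the number `N`. -/
noncomputable def size (I : AtMostNValue n D) : ℕ := n + Fintype.card D + I.numHoles + 1

/-- The succinct description of an instance: `n`, `|D|`, `N`, and then, for every variable, the number
of intervals of its domain, followed by the left and the right endpoint of each of these intervals,
from left to right. Values are given by their positions in `D`. -/
noncomputable def encode (I : AtMostNValue n D) : List ℤ :=
  (n : ℤ) :: (Fintype.card D : ℤ) :: I.N ::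
    (List.finRange n).flatMap fun x =>
      ((intervalEndpoints (I.dom x)).card : ℤ) ::
        ((intervalEndpoints (I.dom x)).sort (· ≤ ·)).flatMap fun p =>
          [(valueRank (ofLex p).1 : ℤ), (valueRank (ofLex p).2 : ℤ)]

end AtMostNValue

/-! Consistency is a stabbing problem. With values replaced by positions, a domain is a sorted list
of disjoint intervals, and an assignment with at most `N` values amounts to at most `N` positions
that meet some interval of every list (`consistent_iff`). A domain has at most one interval more
than holes (`card_intervalEndpoints_le`), so the excess, the number of intervals beyond one per
list, is at most k. Domains with one interval form the base. At most k lists have several intervals,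
and at most 2k intervals altogether.

For single intervals the greedy rule is optimal: select the least right end of an unstabbed
interval. A search node records the last point, the number of points, and the first interval left of
every list. If the least right end belongs to a base interval or to the only interval left of a
list, selecting it is forced (`Sel.feas_iff`). Otherwise it ends the first interval of a list x with
several left, and one either selects this end or drops the interval (`Sel.feas_iff_or`). Each
alternative lowers the excess, but this alone gives only 2^k nodes.

The golden ratio comes from `feas_iff_of_tight`. Suppose that the alternatives A (select) and B
(drop), after all forced selections, both lose exactly one unit of the excess m, and that A still
has a list with several intervals. Then x had two intervals and no other list with several intervals
was stabbed, so A and B would branch next at the same end of the same list f. Dropping the first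
interval of f in A or in B is subsumed by dropping it in the original node. Selecting its end in A
and in B gives nodes that differ only in the number of points and in whether x is stabbed. Stabbing
x costs at most one point, so the node with fewer points suffices, A in case of a tie. Two nodes
remain, of excess at most m - 1 and m - 2. In all other cases one alternative loses two units by
itself, or m = 1. Hence at most 2 F(m+2) - 1 nodes occur (`weight_add_lt`), with F the Fibonacci
numbers.

A node has to be processed in O(k²) steps, whatever n and |D| are. The left ends of list intervals
cut the positions into at most 2k + 1 segments. Once q is selected, the greedy rule inside the
segment of q concerns base intervals only, and its last point and its length are tabulated
(`Good.chain`). So a forced selection stabs a list or reaches a later segment (`Sel.measure_lt`):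
there are O(k) of them, each followed by a scan of at most k lists (`run_settle`). The tables are
filled in linear time (`run_program`). Correctness and step counts are proved together through
`Run`. -/

/-! ### Weakest preconditions for the machine -/

namespace RAM

infixr:67 " ;; " => RAM.Cmd.seq

/-- Started in `s`, the command `c` terminates after `t` steps in a state `s'` with `Q t s'`. -/
def Run (c : Cmd) (s : State) (Q : ℕ → State → Prop) : Prop :=
  ∃ t s', Exec c s t s' ∧ Q t s'

theorem Run.mono {c : Cmd} {s : State} {Q Q' : ℕ → State → Prop} (h : Run c s Q)
    (hQ : ∀ t s', Q t s' → Q' t s') : Run c s Q' := by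
  obtain ⟨t, s', he, hq⟩ := h
  exact ⟨t, s', he, hQ _ _ hq⟩

/-- This and the following equivalences serve as rewrite rules: simplification with them executes
straight-line code symbolically and leaves the postcondition at the final state and the exact cost.
-/
theorem run_skip {s : State} {Q : ℕ → State → Prop} : Run .skip s Q ↔ Q 1 s := by
  constructor
  · rintro ⟨t, s', he, hq⟩
    cases he
    exact hq
  · exact fun h => ⟨_, _, .skip s, h⟩

theorem run_assign {x : ℕ} {e : Expr} {s : State} {Q : ℕ → State → Prop} :
    Run (.assign x e) s Q ↔ Q (e.cost + 1) (s.setReg x (e.eval s)) := by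
  constructor
  · rintro ⟨t, s', he, hq⟩
    cases he
    exact hq
  · exact fun h => ⟨_, _, .assign x e s, h⟩

theorem run_store {a : ℕ} {i e : Expr} {s : State} {Q : ℕ → State → Prop} :
    Run (.store a i e) s Q ↔ Q (i.cost + e.cost + 1) (s.setArr a (i.eval s) (e.eval s)) := by
  constructor
  · rintro ⟨t, s', he, hq⟩
    cases he
    exact hq
  · exact fun h => ⟨_, _, .store a i e s, h⟩

theorem run_seq {c d : Cmd} {s : State} {Q : ℕ → State → Prop} :
    Run (c ;; d) s Q ↔ Run c s fun t s₁ => Run d s₁ fun t' s₂ => Q (t + t') s₂ := by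
  constructor
  · rintro ⟨t, s', he, hq⟩
    cases he with
    | seq h₁ h₂ => exact ⟨_, _, h₁, _, _, h₂, hq⟩
  · rintro ⟨t, s₁, h₁, t', s₂, h₂, hq⟩
    exact ⟨_, _, .seq h₁ h₂, hq⟩

theorem run_ite {b : Test} {c d : Cmd} {s : State} {Q : ℕ → State → Prop} :
    Run (.ite b c d) s Q ↔
      (b.Holds s → Run c s fun t s' => Q (b.cost + 1 + t) s') ∧
      (¬ b.Holds s → Run d s fun t s' => Q (b.cost + 1 + t) s') := by
  constructor
  · rintro ⟨t, s', he, hq⟩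
    cases he with
    | ite_true hb h => exact ⟨fun _ => ⟨_, _, h, hq⟩, fun hb' => absurd hb hb'⟩
    | ite_false hb h => exact ⟨fun hb' => absurd hb' hb, fun _ => ⟨_, _, h, hq⟩⟩
  · rintro ⟨h₁, h₂⟩
    by_cases hb : b.Holds s
    · obtain ⟨t, s', he, hq⟩ := h₁ hb
      exact ⟨_, _, .ite_true hb he, hq⟩
    · obtain ⟨t, s', he, hq⟩ := h₂ hb
      exact ⟨_, _, .ite_false hb he, hq⟩

/-- Loops with an invariant that is indexed by the time left. -/
theorem run_while_budget {b : Test} {c : Cmd} (Inv : ℕ → State → Prop)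
    (step : ∀ n s, Inv n s → b.Holds s →
      Run c s fun t s' => ∃ n', b.cost + 1 + t + n' ≤ n ∧ Inv n' s') :
    ∀ n s, Inv n s → Run (.while b c) s fun t s' =>
      t ≤ n + (b.cost + 1) ∧ (∃ n', Inv n' s') ∧ ¬ b.Holds s' := by
  intro n
  induction n using Nat.strong_induction_on with
  | _ n ih =>
    intro s hs
    by_cases hb : b.Holds s
    · obtain ⟨t₁, s₁, h₁, n', hn', hI⟩ := step n s hs hb
      obtain ⟨t₂, s₂, h₂, ht₂, hQ⟩ := ih n' (by omega) s₁ hI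
      exact ⟨_, _, .while_true hb h₁ h₂, by omega, hQ⟩
    · exact ⟨_, _, .while_false hb, by omega, ⟨n, hs⟩, hb⟩

/-- Loops with an invariant that is indexed by the number of iterations left. -/
theorem run_while {b : Test} {c : Cmd} (T : ℕ) (Inv : ℕ → State → Prop)
    (step : ∀ n s, Inv n s → b.Holds s → Run c s fun t s' => t ≤ T ∧ ∃ n' < n, Inv n' s')
    {n : ℕ} {s : State} (h : Inv n s) :
    Run (.while b c) s fun t s' =>
      t ≤ (b.cost + 1 + T) * n + (b.cost + 1) ∧ (∃ n', Inv n' s') ∧ ¬ b.Holds s' := by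
  refine (run_while_budget (fun m s => ∃ n, m = (b.cost + 1 + T) * n ∧ Inv n s) ?_ _ s
    ⟨n, rfl, h⟩).mono ?_
  · rintro m s ⟨n, rfl, hI⟩ hb
    refine (step n s hI hb).mono ?_
    rintro t s' ⟨ht, n', hn', hI'⟩
    refine ⟨_, ?_, n', rfl, hI'⟩
    -- The count of iterations drops by at least one, which releases the budget of one full
    -- iteration.
    obtain ⟨e, rfl⟩ := Nat.exists_eq_add_of_lt hn'
    nlinarith [Nat.zero_le ((b.cost + 1 + T) * e)]
  · rintro t s' ⟨ht, ⟨n', m, -, hm⟩, hb⟩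
    exact ⟨ht, ⟨m, hm⟩, hb⟩

/-! ### Frame rules -/

/-- The registers that a command writes. -/
def Cmd.regs : Cmd → List ℕ
  | .skip => []
  | .assign x _ => [x]
  | .store _ _ _ => []
  | .seq c d => c.regs ++ d.regs
  | .ite _ c d => c.regs ++ d.regs
  | .while _ c => c.regs

/-- The arrays that a command writes. -/
def Cmd.arrs : Cmd → List ℕ
  | .skip => []
  | .assign _ _ => []
  | .store a _ _ => [a]
  | .seq c d => c.arrs ++ d.arrs
  | .ite _ c d => c.arrs ++ d.arrs
  | .while _ c => c.arrs

/-- The written registers form an explicit list, so for a concrete program the side condition is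
settled by computation. -/
theorem Exec.reg_eq {c : Cmd} {s s' : State} {t : ℕ} (h : Exec c s t s') :
    ∀ x, x ∉ c.regs → s'.reg x = s.reg x := by
  induction h with
  | skip => intro x _; rfl
  | assign => intro x hx; simp only [Cmd.regs, List.mem_singleton] at hx; simp [State.setReg, hx]
  | store => intro x _; rfl
  | seq _ _ ih₁ ih₂ =>
    intro x hx; simp only [Cmd.regs, List.mem_append, not_or] at hx
    rw [ih₂ x hx.2, ih₁ x hx.1]
  | ite_true _ _ ih =>
    intro x hx; simp only [Cmd.regs, List.mem_append, not_or] at hx; exact ih x hx.1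
  | ite_false _ _ ih =>
    intro x hx; simp only [Cmd.regs, List.mem_append, not_or] at hx; exact ih x hx.2
  | while_false => intro x _; rfl
  | while_true _ _ _ ih₁ ih₂ => intro x hx; rw [ih₂ x hx, ih₁ x hx]

theorem Exec.arr_eq {c : Cmd} {s s' : State} {t : ℕ} (h : Exec c s t s') :
    ∀ a, a ∉ c.arrs → s'.arr a = s.arr a := by
  induction h with
  | skip => intro x _; rfl
  | assign => intro x _; rfl
  | store => intro x hx; simp only [Cmd.arrs, List.mem_singleton] at hx; simp [State.setArr, hx]
  | seq _ _ ih₁ ih₂ =>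
    intro x hx; simp only [Cmd.arrs, List.mem_append, not_or] at hx
    rw [ih₂ x hx.2, ih₁ x hx.1]
  | ite_true _ _ ih =>
    intro x hx; simp only [Cmd.arrs, List.mem_append, not_or] at hx; exact ih x hx.1
  | ite_false _ _ ih =>
    intro x hx; simp only [Cmd.arrs, List.mem_append, not_or] at hx; exact ih x hx.2
  | while_false => intro x _; rfl
  | while_true _ _ _ ih₁ ih₂ => intro x hx; rw [ih₂ x hx, ih₁ x hx]

/-- Registers and arrays that a command does not write keep their contents. -/
theorem Run.frame {c : Cmd} {s : State} {Q Q' : ℕ → State → Prop} (h : Run c s Q)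
    (hQ : ∀ t s', (∀ x, x ∉ c.regs → s'.reg x = s.reg x) → (∀ a, a ∉ c.arrs → s'.arr a = s.arr a) →
      Q t s' → Q' t s') : Run c s Q' := by
  obtain ⟨t, s', he, hq⟩ := h
  exact ⟨t, s', he, hQ _ _ he.reg_eq he.arr_eq hq⟩

theorem reg_setReg (s : State) (x : ℕ) (v : ℤ) (y : ℕ) :
    (s.setReg x v).reg y = if y = x then v else s.reg y := by
  simp [State.setReg, Function.update_apply]

theorem arr_setReg (s : State) (x : ℕ) (v : ℤ) : (s.setReg x v).arr = s.arr := rfl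

theorem reg_setArr (s : State) (a : ℕ) (i v : ℤ) : (s.setArr a i v).reg = s.reg := rfl

theorem arr_setArr (s : State) (a : ℕ) (i v : ℤ) (b : ℕ) :
    (s.setArr a i v).arr b = if b = a then Function.update (s.arr a) i v else s.arr b := by
  simp [State.setArr, Function.update_apply]

end RAM

namespace RAM

attribute [simp] run_skip run_assign run_store run_seq run_ite reg_setReg arr_setReg reg_setArr
  arr_setArr Expr.eval Expr.cost Test.Holds Test.cost

end RAM

/-! ### Stabbing unions of intervals: search nodes and their transformations -/

/-- A stabbing problem on the positions `0, …, d - 1`: the intervals in `base` have to be stabbed, and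
for every `v < h` one of the intervals `[L j, R j]` with `root v ≤ j < fin v`. The remaining fields
are auxiliary tables. -/
structure StabData where
  d : ℤ
  N : ℤ
  h : ℕ
  base : Set (ℤ × ℤ)
  L : ℤ → ℤ
  R : ℤ → ℤ
  root : ℤ → ℤ
  fin : ℤ → ℤ
  nx : ℤ → ℤ
  seg : ℤ → ℤ
  ent : ℤ → ℤ
  cnt : ℤ → ℤ

namespace StabData

/-- Well-formed problems with correct tables: `nx i` is the least right endpoint of a base interval
that starts at `i` or later; `seg` increases at the left ends of list intervals; `ent q` and
`cnt q` describe the greedy sequence of points from `q` on inside the segment of `q`. -/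
structure Good (Γ : StabData) : Prop where
  base_ok : ∀ I ∈ Γ.base, 0 ≤ I.1 ∧ I.1 ≤ I.2 ∧ I.2 < Γ.d
  nx_le_d : ∀ i, 0 ≤ i → i ≤ Γ.d → Γ.nx i ≤ Γ.d
  nx_le : ∀ I ∈ Γ.base, ∀ i, 0 ≤ i → i ≤ I.1 → Γ.nx i ≤ I.2
  nx_mem : ∀ i, 0 ≤ i → i ≤ Γ.d → Γ.nx i < Γ.d → ∃ I ∈ Γ.base, i ≤ I.1 ∧ I.2 = Γ.nx i
  iv_ok : ∀ v : ℕ, v < Γ.h → ∀ j, Γ.root v ≤ j → j < Γ.fin v → 0 ≤ Γ.L j ∧ Γ.L j ≤ Γ.R j ∧ Γ.R j < Γ.d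
  iv_lt : ∀ v : ℕ, v < Γ.h → ∀ j j', Γ.root v ≤ j → j < j' → j' < Γ.fin v → Γ.R j < Γ.L j'
  seg_mono : ∀ a b, -1 ≤ a → a ≤ b → b < Γ.d → Γ.seg a ≤ Γ.seg b
  seg_start : ∀ b, 0 ≤ b → b < Γ.d → Γ.seg (-1) < Γ.seg b
  seg_L : ∀ v : ℕ, v < Γ.h → ∀ j, Γ.root v ≤ j → j < Γ.fin v → ∀ a b, -1 ≤ a → a < Γ.L j → Γ.L j ≤ b →
    b < Γ.d → Γ.seg a < Γ.seg b
  ent_cnt : ∀ q, 0 ≤ q → q < Γ.d →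
    (Γ.nx (q + 1) < Γ.d ∧ Γ.seg (Γ.nx (q + 1)) = Γ.seg q ∧ Γ.ent q = Γ.ent (Γ.nx (q + 1)) ∧
      Γ.cnt q = Γ.cnt (Γ.nx (q + 1)) + 1) ∨
    (¬ (Γ.nx (q + 1) < Γ.d ∧ Γ.seg (Γ.nx (q + 1)) = Γ.seg q) ∧ Γ.ent q = q ∧ Γ.cnt q = 1)

variable {Γ : StabData}

/-- The greedy sequence from `q` on inside the segment of `q`. -/
theorem Good.chain (hΓ : Γ.Good) : ∀ (m : ℕ) (q : ℤ), 0 ≤ q → q < Γ.d → Γ.d - q ≤ m →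
    q ≤ Γ.ent q ∧ Γ.ent q < Γ.d ∧ Γ.seg (Γ.ent q) = Γ.seg q ∧
    (Γ.nx (Γ.ent q + 1) < Γ.d → Γ.seg (Γ.ent q) < Γ.seg (Γ.nx (Γ.ent q + 1))) ∧
    (∃ Z : Finset ℤ, (∀ z ∈ Z, q ≤ z ∧ z ≤ Γ.ent q) ∧ q ∈ Z ∧ (Z.card : ℤ) = Γ.cnt q ∧
      ∀ I ∈ Γ.base, q < I.1 → I.1 ≤ Γ.ent q → ∃ z ∈ Z, I.1 ≤ z ∧ z ≤ I.2) ∧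
    ∀ S : Finset ℤ, (∀ I ∈ Γ.base, q < I.1 → ∃ x ∈ S, I.1 ≤ x ∧ x ≤ I.2) →
      Γ.cnt q ≤ (S.filter fun x => q < x ∧ x ≤ Γ.ent q).card + 1 := by
  intro m
  -- The induction is on a bound for `d - q`. The point `q` is counted by `cnt q`, while `S` owes
  -- only the points after `q`; hence the `+ 1` in the last claim.
  induction m with
  | zero => intro q _ h1 h2; push_cast at h2; omega
  | succ m ih =>
    intro q h0 hd hm
    rcases hΓ.ent_cnt q h0 hd with ⟨hlt, hseg, he, hc⟩ | ⟨hn, he, hc⟩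
    · obtain ⟨I₀, hI₀, hI₀l, hI₀r⟩ := hΓ.nx_mem (q + 1) (by omega) (by omega) hlt
      have hok := hΓ.base_ok I₀ hI₀
      obtain ⟨h1, h2, h3, h4, ⟨Z, hZ, hqZ, hZc, hZb⟩, h6⟩ :=
        ih (Γ.nx (q + 1)) (by omega) hlt (by push_cast at hm; omega)
      rw [← he] at h1 h2 h3 h4 hZ hZb h6
      refine ⟨by omega, h2, by omega, h4, ⟨insert q Z, ?_, Finset.mem_insert_self _ _, ?_, ?_⟩, ?_⟩
      · intro z hz
        rcases Finset.mem_insert.1 hz with rfl | hz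
        · omega
        · have := hZ z hz; omega
      · rw [Finset.card_insert_of_notMem]
        · push_cast; omega
        · intro hq; have := hZ q hq; omega
      · intro I hI hqI hIe
        by_cases hle : I.1 ≤ Γ.nx (q + 1)
        · exact ⟨_, Finset.mem_insert_of_mem hqZ, hle, hΓ.nx_le I hI _ (by omega) (by omega)⟩
        · obtain ⟨z, hz, hz'⟩ := hZb I hI (by omega) hIe
          exact ⟨z, Finset.mem_insert_of_mem hz, hz'⟩
      · intro S hS
        have hb := h6 S fun I hI hl => hS I hI (by omega)
        obtain ⟨x, hxS, hx1, hx2⟩ := hS I₀ hI₀ (by omega)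
        -- The interval `I₀` ends at the next greedy point and starts after `q`, so its point `x` of
        -- `S` lies outside of the range covered by the induction hypothesis.
        have hss : (insert x (S.filter fun x => Γ.nx (q + 1) < x ∧ x ≤ Γ.ent q)) ⊆
            S.filter fun x => q < x ∧ x ≤ Γ.ent q := by
          intro y hy
          rcases Finset.mem_insert.1 hy with rfl | hy
          · simp only [Finset.mem_filter]; refine ⟨hxS, ?_, ?_⟩ <;> omega
          · simp only [Finset.mem_filter] at hy ⊢; refine ⟨hy.1, ?_, ?_⟩ <;> omega
        have hcard := Finset.card_le_card hss
        rw [Finset.card_insert_of_notMem (by simp only [Finset.mem_filter]; omega)] at hcard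
        omega
    · rw [he, hc]
      refine ⟨le_rfl, hd, rfl, ?_, ⟨{q}, ?_, ?_, ?_, ?_⟩, ?_⟩
      · intro hlt
        obtain ⟨I₀, hI₀, hI₀l, hI₀r⟩ := hΓ.nx_mem (q + 1) (by omega) (by omega) hlt
        have hok := hΓ.base_ok I₀ hI₀
        have := hΓ.seg_mono q (Γ.nx (q + 1)) (by omega) (by omega) hlt
        have : Γ.seg (Γ.nx (q + 1)) ≠ Γ.seg q := fun h => hn ⟨hlt, h⟩
        omega
      · intro z hz; rw [Finset.mem_singleton] at hz; omega
      · simp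
      · simp
      · intro I hI _ _; omega
      · intro S _; omega

variable (Γ)

/-- `S` is a set of points to add to the partial solution `ν`. In a node `ν`, `ν (-1)` is the last
point selected so far, `ν (-2)` the number of selected points, and `ν v` the first interval that is
left for `v`; `ν v = Γ.fin v` means that `v` is stabbed. -/
structure Sol (ν : ℤ → ℤ) (S : Finset ℤ) : Prop where
  gt : ∀ x ∈ S, ν (-1) < x
  card_le : ν (-2) + S.card ≤ Γ.N
  base : ∀ I ∈ Γ.base, ν (-1) < I.1 → ∃ x ∈ S, I.1 ≤ x ∧ x ≤ I.2
  list : ∀ v : ℕ, v < Γ.h → ν v < Γ.fin v →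
    ∃ j, ν v ≤ j ∧ j < Γ.fin v ∧ ∃ x ∈ S, Γ.L j ≤ x ∧ x ≤ Γ.R j

/-- The partial solution `ν` extends to a solution. -/
def Feas (ν : ℤ → ℤ) : Prop := ∃ S, Γ.Sol ν S

/-- Well-formed search nodes. -/
structure Val (ν : ℤ → ℤ) : Prop where
  ge : -1 ≤ ν (-1)
  lt : ν (-1) < Γ.d
  closed : Γ.nx (ν (-1) + 1) < Γ.d → Γ.seg (ν (-1)) < Γ.seg (Γ.nx (ν (-1) + 1))
  root_le : ∀ v : ℕ, v < Γ.h → Γ.root v ≤ ν v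
  le_fin : ∀ v : ℕ, v < Γ.h → ν v ≤ Γ.fin v
  lt_L : ∀ v : ℕ, v < Γ.h → ν v < Γ.fin v → ν (-1) < Γ.L (ν v)

/-- The nodes agree on the cells that matter. -/
def Agree (ν ν' : ℤ → ℤ) : Prop := ∀ i : ℤ, -2 ≤ i → i < Γ.h → ν' i = ν i

/-- `ν'` results from `ν` by selecting `q` and the greedy points in the segment of `q`. -/
structure Sel (ν : ℤ → ℤ) (q : ℤ) (ν' : ℤ → ℤ) : Prop where
  last : ν' (-1) = Γ.ent q
  count : ν' (-2) = ν (-2) + Γ.cnt q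
  hit : ∀ v : ℕ, v < Γ.h → ν v < Γ.fin v → Γ.L (ν v) ≤ q → ν' v = Γ.fin v
  keep : ∀ v : ℕ, v < Γ.h → ¬ (ν v < Γ.fin v ∧ Γ.L (ν v) ≤ q) → ν' v = ν v

/-- `ν'` results from `ν` by dropping the first interval of `x`. -/
structure Drop (ν : ℤ → ℤ) (x : ℕ) (ν' : ℤ → ℤ) : Prop where
  last : ν' (-1) = ν (-1)
  count : ν' (-2) = ν (-2)
  keep : ∀ v : ℕ, v < Γ.h → v ≠ x → ν' v = ν v
  drop : ν' x = ν x + 1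

/-- `q` is a position after the last point, but not after the end of any remaining interval. -/
structure Min (ν : ℤ → ℤ) (q : ℤ) : Prop where
  gt : ν (-1) < q
  lt : q < Γ.d
  base : ∀ I ∈ Γ.base, ν (-1) < I.1 → q ≤ I.2
  list : ∀ v : ℕ, v < Γ.h → ν v < Γ.fin v → q ≤ Γ.R (ν v)

/-- `ν'` results from `ν` by selecting points, all of them not after the end of any remaining
interval. -/
structure Evo (ν ν' : ℤ → ℤ) : Prop where
  le : ν (-1) ≤ ν' (-1)
  list : ∀ v : ℕ, v < Γ.h → ν' v = ν v ∨
    ν' v = Γ.fin v ∧ ν v < Γ.fin v ∧ Γ.L (ν v) ≤ ν' (-1)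
  points : ∃ Z : Finset ℤ, (∀ z ∈ Z, ν (-1) < z ∧ z ≤ ν' (-1)) ∧ ν' (-2) = ν (-2) + Z.card ∧
    (∀ I ∈ Γ.base, ν (-1) < I.1 → I.1 ≤ ν' (-1) → ∃ z ∈ Z, I.1 ≤ z ∧ z ≤ I.2) ∧
    ∀ v : ℕ, v < Γ.h → ν v < Γ.fin v → ν' v = Γ.fin v → ∃ z ∈ Z, Γ.L (ν v) ≤ z ∧ z ≤ Γ.R (ν v)

/-- The number of intervals that are left in excess of one per list. -/
def excess (ν : ℤ → ℤ) : ℕ := ∑ v ∈ Finset.range Γ.h, (Γ.fin v - ν v - 1).toNat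

/-- The number of lists that are not stabbed yet. -/
def unhit (ν : ℤ → ℤ) : ℕ := ((Finset.range Γ.h).filter fun v : ℕ => ν v < Γ.fin v).card

/-- What a scan of a node finds: the least end `q` of a base interval or of a list with only one
interval left, the list `xi` with several intervals left that has the least end of its first interval,
and this end `q₂`. -/
structure Scan (ν : ℤ → ℤ) (q₂ xi q : ℤ) : Prop where
  le_d : q ≤ Γ.d
  le_nx : q ≤ Γ.nx (ν (-1) + 1)
  single : ∀ v : ℕ, v < Γ.h → ν v + 1 = Γ.fin v → q ≤ Γ.R (ν v)
  multi : ∀ v : ℕ, v < Γ.h → ν v + 2 ≤ Γ.fin v → q₂ ≤ Γ.R (ν v)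
  forced : q < Γ.d → q = Γ.nx (ν (-1) + 1) ∨ ∃ v : ℕ, v < Γ.h ∧ ν v + 1 = Γ.fin v ∧ q = Γ.R (ν v)
  first : (xi = -1 ∧ q₂ = Γ.d ∧ ∀ v : ℕ, v < Γ.h → ¬ ν v + 2 ≤ Γ.fin v) ∨
    ∃ v : ℕ, v < Γ.h ∧ xi = v ∧ ν v + 2 ≤ Γ.fin v ∧ q₂ = Γ.R (ν v)

variable {Γ} {ν ν' ν'' : ℤ → ℤ} {q : ℤ}

/-! ### Nodes that agree on the relevant cells -/

theorem Agree.last (h : Γ.Agree ν ν') : ν' (-1) = ν (-1) := h _ (by omega) (by omega)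

theorem Agree.count (h : Γ.Agree ν ν') : ν' (-2) = ν (-2) := h _ (by omega) (by omega)

theorem Agree.list (h : Γ.Agree ν ν') (v : ℕ) (hv : v < Γ.h) : ν' v = ν v :=
  h _ (by omega) (by omega)

/-- Copying a node transfers only the cells from `-2` to `h - 1`; what is proved about a node has to
survive a change of all other cells. -/
theorem Agree.feas (h : Γ.Agree ν ν') (hf : Γ.Feas ν) : Γ.Feas ν' := by
  obtain ⟨S, hS⟩ := hf
  refine ⟨S, ?_, ?_, ?_, ?_⟩
  · rw [h.last]; exact hS.gt
  · rw [h.count]; exact hS.card_le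
  · rw [h.last]; exact hS.base
  · intro v hv; rw [h.list v hv]; exact hS.list v hv

theorem Agree.symm (h : Γ.Agree ν ν') : Γ.Agree ν' ν := fun i h1 h2 => (h i h1 h2).symm

theorem Agree.feas_iff (h : Γ.Agree ν ν') : Γ.Feas ν ↔ Γ.Feas ν' := ⟨h.feas, h.symm.feas⟩

theorem Agree.val (h : Γ.Agree ν ν') (hf : Γ.Val ν) : Γ.Val ν' := by
  refine ⟨?_, ?_, ?_, ?_, ?_, ?_⟩
  · rw [h.last]; exact hf.ge
  · rw [h.last]; exact hf.lt
  · rw [h.last]; exact hf.closed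
  · intro v hv; rw [h.list v hv]; exact hf.root_le v hv
  · intro v hv; rw [h.list v hv]; exact hf.le_fin v hv
  · intro v hv; rw [h.list v hv, h.last]; exact hf.lt_L v hv

theorem Agree.excess (h : Γ.Agree ν ν') : Γ.excess ν' = Γ.excess ν := by
  unfold StabData.excess
  refine Finset.sum_congr rfl fun v hv => ?_
  rw [h.list v (Finset.mem_range.1 hv)]

theorem Agree.sel (h : Γ.Agree ν ν') (hs : Γ.Sel ν' q ν'') : Γ.Sel ν q ν'' := by
  refine ⟨hs.last, ?_, ?_, ?_⟩
  · rw [← h.count]; exact hs.count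
  · intro v hv; rw [← h.list v hv]; exact hs.hit v hv
  · intro v hv; rw [← h.list v hv]; exact hs.keep v hv

theorem Agree.drop {x : ℕ} (hx : x < Γ.h) (h : Γ.Agree ν ν') (hs : Γ.Drop ν' x ν'') :
    Γ.Drop ν x ν'' := by
  refine ⟨?_, ?_, ?_, ?_⟩
  · rw [← h.last]; exact hs.last
  · rw [← h.count]; exact hs.count
  · intro v hv; rw [← h.list v hv]; exact hs.keep v hv
  · rw [← h.list x hx]; exact hs.drop

/-! ### Extensions of partial solutions, drops and selections -/

theorem Evo.refl (ν : ℤ → ℤ) : Γ.Evo ν ν :=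
  ⟨le_rfl, fun _ _ => .inl rfl, ∅, by simp, by simp, fun _ _ _ _ => by omega,
    fun _ _ _ _ => by omega⟩

/-- The second set of points lies beyond the last point of the intermediate node, the first one does
not. So the two are disjoint and the counts add up exactly. -/
theorem Evo.trans (h : Γ.Evo ν ν') (h' : Γ.Evo ν' ν'') : Γ.Evo ν ν'' := by
  obtain ⟨hle, hl, Z, hZ, hZc, hZb, hZl⟩ := h
  obtain ⟨hle', hl', Z', hZ', hZc', hZb', hZl'⟩ := h'
  refine ⟨by omega, ?_, Z ∪ Z', ?_, ?_, ?_, ?_⟩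
  · intro v hv
    rcases hl v hv with h1 | ⟨h1, h2, h3⟩ <;> rcases hl' v hv with h4 | ⟨h4, h5, h6⟩
    · left; omega
    · right; rw [h1] at h5 h6; exact ⟨h4, h5, h6⟩
    · right; exact ⟨by omega, h2, by omega⟩
    · omega
  · intro z hz
    rcases Finset.mem_union.1 hz with hz | hz
    · have := hZ z hz; omega
    · have := hZ' z hz; omega
  · rw [Finset.card_union_of_disjoint]
    · push_cast; omega
    · rw [Finset.disjoint_left]
      intro z hz hz'
      have := hZ z hz; have := hZ' z hz'; omega
  · intro I hI h1 h2
    by_cases h3 : I.1 ≤ ν' (-1)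
    · obtain ⟨z, hz, hz'⟩ := hZb I hI h1 h3
      exact ⟨z, Finset.mem_union_left _ hz, hz'⟩
    · obtain ⟨z, hz, hz'⟩ := hZb' I hI (by omega) h2
      exact ⟨z, Finset.mem_union_right _ hz, hz'⟩
  · intro v hv h1 h2
    by_cases h3 : ν' v = Γ.fin v
    · obtain ⟨z, hz, hz'⟩ := hZl v hv h1 h3
      exact ⟨z, Finset.mem_union_left _ hz, hz'⟩
    · have h4 : ν' v = ν v := by rcases hl v hv with h | h; exacts [h, absurd h.1 h3]
      obtain ⟨z, hz, hz'⟩ := hZl' v hv (by omega) h2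
      exact ⟨z, Finset.mem_union_right _ hz, by rwa [h4] at hz'⟩

/-- The selected points are put back into the solution. A base interval is met by them or by the old
solution, depending on whether it starts by the last point of `ν'`. -/
theorem Evo.feas (h : Γ.Evo ν ν') (hf : Γ.Feas ν') : Γ.Feas ν := by
  obtain ⟨hle, hl, Z, hZ, hZc, hZb, hZl⟩ := h
  obtain ⟨S, hS⟩ := hf
  refine ⟨Z ∪ S, ?_, ?_, ?_, ?_⟩
  · intro x hx
    rcases Finset.mem_union.1 hx with hx | hx
    · exact (hZ x hx).1
    · have := hS.gt x hx; omega
  · have := hS.card_le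
    have := Finset.card_union_le Z S
    omega
  · intro I hI h1
    by_cases h3 : I.1 ≤ ν' (-1)
    · obtain ⟨z, hz, hz'⟩ := hZb I hI h1 h3
      exact ⟨z, Finset.mem_union_left _ hz, hz'⟩
    · obtain ⟨z, hz, hz'⟩ := hS.base I hI (by omega)
      exact ⟨z, Finset.mem_union_right _ hz, hz'⟩
  · intro v hv h1
    by_cases h3 : ν' v = Γ.fin v
    · obtain ⟨z, hz, hz'⟩ := hZl v hv h1 h3
      exact ⟨_, le_rfl, h1, z, Finset.mem_union_left _ hz, hz'⟩
    · have h4 : ν' v = ν v := by rcases hl v hv with h | h; exacts [h, absurd h.1 h3]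
      obtain ⟨j, hj, hj', z, hz, hz'⟩ := hS.list v hv (by omega)
      exact ⟨j, by omega, hj', z, Finset.mem_union_right _ hz, hz'⟩

/-- Dropping an interval commutes with selections that do not concern it. -/
theorem Evo.feas_drop {f : ℕ} {μ μ' : ℤ → ℤ} (hf : f < Γ.h) (h : Γ.Evo ν ν') (hkeep : ν' f = ν f)
    (hd : Γ.Drop ν f μ) (hd' : Γ.Drop ν' f μ') (hμ : Γ.Feas μ') : Γ.Feas μ := by
  refine Evo.feas (ν' := μ') ⟨?_, ?_, ?_⟩ hμ
  · rw [hd.last, hd'.last]; exact h.le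
  · intro v hv
    by_cases hvf : v = f
    · subst hvf; left; rw [hd'.drop, hd.drop, hkeep]
    · rw [hd.keep v hv hvf, hd'.keep v hv hvf, hd'.last]; exact h.list v hv
  · obtain ⟨Z, hZ, hZc, hZb, hZl⟩ := h.points
    rw [hd.last, hd'.last, hd.count, hd'.count]
    refine ⟨Z, hZ, hZc, hZb, ?_⟩
    intro v hv
    by_cases hvf : v = f
    · subst hvf; rw [hd'.drop, hd.drop, hkeep]; intro h1 h2; omega
    · rw [hd.keep v hv hvf, hd'.keep v hv hvf]; exact hZl v hv

theorem Drop.feas {x : ℕ} (hx : x < Γ.h) (hd : Γ.Drop ν x ν') (hlt : ν x + 2 ≤ Γ.fin x)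
    (hf : Γ.Feas ν') : Γ.Feas ν := by
  obtain ⟨S, hS⟩ := hf
  refine ⟨S, ?_, ?_, ?_, ?_⟩
  · rw [← hd.last]; exact hS.gt
  · rw [← hd.count]; exact hS.card_le
  · rw [← hd.last]; exact hS.base
  · intro v hv h1
    by_cases hvf : v = x
    · subst hvf
      obtain ⟨j, hj, hj'⟩ := hS.list v hv (by rw [hd.drop]; omega)
      rw [hd.drop] at hj
      exact ⟨j, by omega, hj'⟩
    · have := hS.list v hv; rw [hd.keep v hv hvf] at this; exact this h1

/-- The next interval of the list starts after the end of the dropped one, hence still after the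
last point. -/
theorem Drop.val (hΓ : Γ.Good) {x : ℕ} (hx : x < Γ.h) (hd : Γ.Drop ν x ν')
    (hlt : ν x + 2 ≤ Γ.fin x) (hν : Γ.Val ν) : Γ.Val ν' := by
  refine ⟨?_, ?_, ?_, ?_, ?_, ?_⟩
  · rw [hd.last]; exact hν.ge
  · rw [hd.last]; exact hν.lt
  · rw [hd.last]; exact hν.closed
  · intro v hv
    by_cases hvf : v = x
    · subst hvf; rw [hd.drop]; have := hν.root_le v hv; omega
    · rw [hd.keep v hv hvf]; exact hν.root_le v hv
  · intro v hv
    by_cases hvf : v = x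
    · subst hvf; rw [hd.drop]; omega
    · rw [hd.keep v hv hvf]; exact hν.le_fin v hv
  · intro v hv
    by_cases hvf : v = x
    · subst hvf; rw [hd.drop, hd.last]; intro h
      have h1 := hν.lt_L v hv (by omega)
      have h2 := hν.root_le v hv
      have h3 := hΓ.iv_ok v hv (ν v) h2 (by omega)
      have h4 := hΓ.iv_lt v hv (ν v) (ν v + 1) h2 (by omega) h
      omega
    · rw [hd.keep v hv hvf, hd.last]; exact hν.lt_L v hv

/-- `seg` grows at every left end in a list but is the same at `q` and `ent q`. So the greedy points
after `q` never reach an interval of a list that starts beyond `q`. -/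
theorem Good.seg_L_contra (hΓ : Γ.Good) (hν : Γ.Val ν) (hq : ν (-1) < q) (hqd : q < Γ.d) {v : ℕ}
    (hv : v < Γ.h) (hu : ν v < Γ.fin v) (hL : q < Γ.L (ν v)) : Γ.ent q < Γ.L (ν v) := by
  have h0 := hν.ge
  obtain ⟨h1, h2, h3, -⟩ := hΓ.chain (Γ.d - q).toNat q (by omega) hqd (by omega)
  by_contra hcon
  have := hΓ.seg_L v hv (ν v) (hν.root_le v hv) hu q (Γ.ent q) (by omega) hL (by omega) h2
  omega

theorem Sel.val (hΓ : Γ.Good) (hν : Γ.Val ν) (hq : ν (-1) < q) (hqd : q < Γ.d)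
    (hs : Γ.Sel ν q ν') : Γ.Val ν' := by
  have h0 := hν.ge
  obtain ⟨h1, h2, h3, h4, -⟩ := hΓ.chain (Γ.d - q).toNat q (by omega) hqd (by omega)
  refine ⟨?_, ?_, ?_, ?_, ?_, ?_⟩
  · rw [hs.last]; omega
  · rw [hs.last]; omega
  · rw [hs.last]; exact h4
  · intro v hv
    have h5 := hν.root_le v hv
    by_cases h : ν v < Γ.fin v ∧ Γ.L (ν v) ≤ q
    · rw [hs.hit v hv h.1 h.2]; omega
    · rw [hs.keep v hv h]; exact h5
  · intro v hv
    by_cases h : ν v < Γ.fin v ∧ Γ.L (ν v) ≤ q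
    · rw [hs.hit v hv h.1 h.2]
    · rw [hs.keep v hv h]; exact hν.le_fin v hv
  · intro v hv
    by_cases h : ν v < Γ.fin v ∧ Γ.L (ν v) ≤ q
    · rw [hs.hit v hv h.1 h.2]; intro h; omega
    · rw [hs.keep v hv h, hs.last]; intro h'
      exact hΓ.seg_L_contra hν hq hqd hv h' (by by_contra hc; exact h ⟨h', by omega⟩)

/-- By `Min`, the point `q` lies in every remaining base interval and every first interval of an
unstabbed list that starts by `q`. Base intervals that start between `q` and `ent q` are met by the
later greedy points. -/
theorem Sel.evo (hΓ : Γ.Good) (hν : Γ.Val ν) (hm : Γ.Min ν q) (hs : Γ.Sel ν q ν') :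
    Γ.Evo ν ν' := by
  have h0 := hν.ge
  have hq := hm.gt
  obtain ⟨h1, h2, h3, h4, ⟨Z, hZ, hqZ, hZc, hZb⟩, -⟩ :=
    hΓ.chain (Γ.d - q).toNat q (by omega) hm.lt (by omega)
  refine ⟨?_, ?_, Z, ?_, ?_, ?_, ?_⟩
  · rw [hs.last]; omega
  · intro v hv
    by_cases h : ν v < Γ.fin v ∧ Γ.L (ν v) ≤ q
    · right; rw [hs.hit v hv h.1 h.2, hs.last]; exact ⟨rfl, h.1, by omega⟩
    · left; exact hs.keep v hv h
  · intro z hz; rw [hs.last]; have := hZ z hz; omega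
  · rw [hs.count, hZc]
  · intro I hI h5 h6
    rw [hs.last] at h6
    by_cases h7 : I.1 ≤ q
    · exact ⟨q, hqZ, h7, hm.base I hI h5⟩
    · exact hZb I hI (by omega) h6
  · intro v hv h5 h6
    by_cases h : ν v < Γ.fin v ∧ Γ.L (ν v) ≤ q
    · exact ⟨q, hqZ, h.2, hm.list v hv h5⟩
    · rw [hs.keep v hv h] at h6; omega

/-- An exchange argument: all points of `S` up to `ent q` are traded for the greedy ones. Among them
are `x ≤ q` and, by `Good.chain`, at least `cnt q - 1` points after `q`, so the total does not grow.
-/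
theorem Sel.feas (hΓ : Γ.Good) (hν : Γ.Val ν) (hq : ν (-1) < q) (hqd : q < Γ.d)
    (hs : Γ.Sel ν q ν') {S : Finset ℤ} (hS : Γ.Sol ν S) (hx : ∃ x ∈ S, x ≤ q) : Γ.Feas ν' := by
  have h0 := hν.ge
  obtain ⟨h1, h2, h3, h4, -, h5⟩ := hΓ.chain (Γ.d - q).toNat q (by omega) hqd (by omega)
  have h6 := h5 S fun I hI hI' => hS.base I hI (by omega)
  obtain ⟨x, hxS, hxq⟩ := hx
  refine ⟨S.filter fun x => Γ.ent q < x, ?_, ?_, ?_, ?_⟩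
  · intro y hy; rw [hs.last]; exact (Finset.mem_filter.1 hy).2
  · rw [hs.count]
    have hss : insert x ((S.filter fun x => q < x ∧ x ≤ Γ.ent q) ∪ S.filter fun x => Γ.ent q < x) ⊆ S := by
      intro y hy
      simp only [Finset.mem_insert, Finset.mem_union, Finset.mem_filter] at hy
      rcases hy with rfl | hy | hy
      exacts [hxS, hy.1, hy.1]
    have hcard := Finset.card_le_card hss
    rw [Finset.card_insert_of_notMem, Finset.card_union_of_disjoint] at hcard
    · have := hS.card_le
      omega
    · rw [Finset.disjoint_left]
      intro y hy hy'
      simp only [Finset.mem_filter] at hy hy'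
      omega
    · simp only [Finset.mem_union, Finset.mem_filter]
      omega
  · intro I hI hlt
    rw [hs.last] at hlt
    obtain ⟨y, hy, hy1, hy2⟩ := hS.base I hI (by omega)
    exact ⟨y, Finset.mem_filter.2 ⟨hy, by omega⟩, hy1, hy2⟩
  · intro v hv hu
    by_cases h : ν v < Γ.fin v ∧ Γ.L (ν v) ≤ q
    · rw [hs.hit v hv h.1 h.2] at hu; omega
    · rw [hs.keep v hv h] at hu ⊢
      have hL := hΓ.seg_L_contra hν hq hqd hv hu (by by_contra hc; exact h ⟨hu, by omega⟩)
      obtain ⟨j, hj, hj', y, hy, hy1, hy2⟩ := hS.list v hv hu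
      refine ⟨j, hj, hj', y, Finset.mem_filter.2 ⟨hy, ?_⟩, hy1, hy2⟩
      -- The first interval of an unhit list starts beyond `ent q`, and all later ones start further
      -- right; the point that stabs one of them is therefore kept.
      rcases eq_or_lt_of_le hj with rfl | hlt
      · omega
      · have h7 := hΓ.iv_lt v hv _ j (hν.root_le v hv) hlt hj'
        have h8 := hΓ.iv_ok v hv _ (hν.root_le v hv) hu
        omega

/-- A point that ends a base interval or the only interval left of a list may be selected. -/
theorem Sel.feas_iff (hΓ : Γ.Good) (hν : Γ.Val ν) (hm : Γ.Min ν q) (hs : Γ.Sel ν q ν')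
    (hf : (∃ I ∈ Γ.base, ν (-1) < I.1 ∧ I.2 = q) ∨
      ∃ v : ℕ, v < Γ.h ∧ ν v + 1 = Γ.fin v ∧ q = Γ.R (ν v)) : Γ.Feas ν ↔ Γ.Feas ν' := by
  refine ⟨?_, (hs.evo hΓ hν hm).feas⟩
  rintro ⟨S, hS⟩
  refine hs.feas hΓ hν hm.gt hm.lt hS ?_
  rcases hf with ⟨I, hI, h1, h2⟩ | ⟨v, hv, h1, h2⟩
  · obtain ⟨x, hx, -, h3⟩ := hS.base I hI h1
    exact ⟨x, hx, by omega⟩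
  · obtain ⟨j, hj, hj', x, hx, -, h3⟩ := hS.list v hv (by omega)
    have : j = ν v := by omega
    subst this
    exact ⟨x, hx, by omega⟩

/-- Either the end of the first interval of a list is selected, or this interval is dropped. -/
theorem Sel.feas_iff_or {μ : ℤ → ℤ} (hΓ : Γ.Good) (hν : Γ.Val ν) (hm : Γ.Min ν q)
    (hs : Γ.Sel ν q ν') {x : ℕ} (hx : x < Γ.h) (hx2 : ν x + 2 ≤ Γ.fin x) (hq : q = Γ.R (ν x))
    (hd : Γ.Drop ν x μ) : Γ.Feas ν ↔ Γ.Feas ν' ∨ Γ.Feas μ := by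
  constructor
  · rintro ⟨S, hS⟩
    by_cases h : ∃ x ∈ S, x ≤ q
    · exact .inl (hs.feas hΓ hν hm.gt hm.lt hS h)
    · right
      refine ⟨S, ?_, ?_, ?_, ?_⟩
      · rw [hd.last]; exact hS.gt
      · rw [hd.count]; exact hS.card_le
      · rw [hd.last]; exact hS.base
      · intro v hv hu
        by_cases hvx : v = x
        · subst hvx
          obtain ⟨j, hj, hj', y, hy, hy1, hy2⟩ := hS.list v hv (by omega)
          refine ⟨j, ?_, hj', y, hy, hy1, hy2⟩
          rw [hd.drop]
          rcases eq_or_lt_of_le hj with rfl | hlt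
          · exact absurd ⟨y, hy, by omega⟩ h
          · omega
        · rw [hd.keep v hv hvx] at hu ⊢; exact hS.list v hv hu
  · rintro (h | h)
    · exact (hs.evo hΓ hν hm).feas h
    · exact hd.feas hx hx2 h

/-! #### The measures -/

/-- A termwise comparison with marked losses at two lists. With `b = 0` it bounds the loss at one
list; with two losses it refutes tightness in `feas_iff_of_tight`. -/
theorem excess_add_le {x y : ℕ} {a b : ℕ} (hx : x < Γ.h) (hy : y < Γ.h)
    (h : ∀ v : ℕ, v < Γ.h → (Γ.fin v - ν' v - 1).toNat + ((if v = x then a else 0) +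
      if v = y then b else 0) ≤ (Γ.fin v - ν v - 1).toNat) :
    Γ.excess ν' + (a + b) ≤ Γ.excess ν := by
  unfold excess
  have := Finset.sum_le_sum (s := Finset.range Γ.h) fun v hv => h v (Finset.mem_range.1 hv)
  rw [Finset.sum_add_distrib, Finset.sum_add_distrib, Finset.sum_ite_eq', Finset.sum_ite_eq',
    if_pos (Finset.mem_range.2 hx), if_pos (Finset.mem_range.2 hy)] at this
  exact this

theorem Evo.excess_le (h : Γ.Evo ν ν') : Γ.excess ν' ≤ Γ.excess ν := by
  unfold excess
  refine Finset.sum_le_sum fun v hv => ?_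
  rcases h.list v (Finset.mem_range.1 hv) with h | h <;> omega

/-- A stabbed list contributes `-1`, truncated to `0`; before, `x` contributed at least `1`. -/
theorem Evo.excess_lt (h : Γ.Evo ν ν') {x : ℕ} (hx : x < Γ.h) (h2 : ν x + 2 ≤ Γ.fin x)
    (hh : ν' x = Γ.fin x) : Γ.excess ν' + 1 ≤ Γ.excess ν := by
  refine excess_add_le (a := 1) (b := 0) hx hx fun v hv => ?_
  by_cases hvx : v = x
  · subst hvx; simp only [if_true]; omega
  · simp only [if_neg hvx]; rcases h.list v hv with h | h <;> omega

theorem Drop.excess_lt {x : ℕ} (hx : x < Γ.h) (h : Γ.Drop ν x ν') (h2 : ν x + 2 ≤ Γ.fin x) :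
    Γ.excess ν' + 1 ≤ Γ.excess ν := by
  refine excess_add_le (a := 1) (b := 0) hx hx fun v hv => ?_
  by_cases hvx : v = x
  · subst hvx; simp only [if_true]; rw [h.drop]; omega
  · simp only [if_neg hvx]; rw [h.keep v hv hvx]; omega

theorem Evo.unhit_le (h : Γ.Evo ν ν') : Γ.unhit ν' ≤ Γ.unhit ν := by
  refine Finset.card_le_card fun v hv => ?_
  simp only [Finset.mem_filter, Finset.mem_range] at hv ⊢
  refine ⟨hv.1, ?_⟩
  rcases h.list v hv.1 with h | h <;> omega

theorem Evo.unhit_lt (h : Γ.Evo ν ν') {x : ℕ} (hx : x < Γ.h) (h2 : ν x < Γ.fin x)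
    (hh : ν' x = Γ.fin x) : Γ.unhit ν' < Γ.unhit ν := by
  refine Finset.card_lt_card ⟨fun v hv => ?_, fun hs => ?_⟩
  · simp only [Finset.mem_filter, Finset.mem_range] at hv ⊢
    refine ⟨hv.1, ?_⟩
    rcases h.list v hv.1 with h | h <;> omega
  · have := hs (Finset.mem_filter.2 ⟨Finset.mem_range.2 hx, h2⟩)
    simp only [Finset.mem_filter, Finset.mem_range] at this
    omega

/-- If `q` ends the only interval left of a list, then `unhit` drops. If `q` ends a base interval,
then `Val.closed` places it in a later segment than the last point, and the second term drops.
Neither term ever grows. -/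
theorem Sel.measure_lt (hΓ : Γ.Good) (hν : Γ.Val ν) (hm : Γ.Min ν q) (hs : Γ.Sel ν q ν') {K : ℤ}
    (hK : ∀ b, -1 ≤ b → b < Γ.d → Γ.seg b ≤ K)
    (hf : q = Γ.nx (ν (-1) + 1) ∨ ∃ v : ℕ, v < Γ.h ∧ ν v + 1 = Γ.fin v ∧ q = Γ.R (ν v)) :
    Γ.unhit ν' + (K - Γ.seg (ν' (-1))).toNat < Γ.unhit ν + (K - Γ.seg (ν (-1))).toNat := by
  have hev := hs.evo hΓ hν hm
  have hle := hev.unhit_le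
  have hge := hν.ge
  have hgt := hm.gt
  have hval := hs.val hΓ hν hm.gt hm.lt
  have h1 := hK _ hval.ge hval.lt
  have h2 := hK _ hν.ge hν.lt
  have h3 := hΓ.seg_mono _ _ hν.ge hev.le hval.lt
  rcases hf with hq | ⟨v, hv, hv1, hv2⟩
  · obtain ⟨-, -, h4, -⟩ := hΓ.chain (Γ.d - q).toNat q (by omega) hm.lt (by omega)
    have h5 := hν.closed (hq ▸ hm.lt)
    rw [← hq] at h5
    rw [hs.last] at h1 h3 ⊢
    omega
  · have h4 := hΓ.iv_ok v hv _ (hν.root_le v hv) (by omega)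
    have := hev.unhit_lt hv (by omega) (hs.hit v hv (by omega) (by omega))
    omega

theorem Scan.base {q₂ xi : ℤ} (hΓ : Γ.Good) (hν : Γ.Val ν) (h : Γ.Scan ν q₂ xi q) :
    ∀ I ∈ Γ.base, ν (-1) < I.1 → q ≤ I.2 := fun I hI hlt =>
  h.le_nx.trans (hΓ.nx_le I hI _ (by have := hν.ge; omega) (by omega))

/-- If a scan finds a point that has to be selected, then this point may be selected. -/
theorem Scan.min {q₂ xi : ℤ} (hΓ : Γ.Good) (hν : Γ.Val ν) (h : Γ.Scan ν q₂ xi q) (hq : q ≤ q₂)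
    (hqd : q < Γ.d) : Γ.Min ν q ∧ ((∃ I ∈ Γ.base, ν (-1) < I.1 ∧ I.2 = q) ∨
      ∃ v : ℕ, v < Γ.h ∧ ν v + 1 = Γ.fin v ∧ q = Γ.R (ν v)) := by
  have h0 := hν.ge
  have h1 := hν.lt
  have hf : (∃ I ∈ Γ.base, ν (-1) < I.1 ∧ I.2 = q) ∨
      ∃ v : ℕ, v < Γ.h ∧ ν v + 1 = Γ.fin v ∧ q = Γ.R (ν v) := by
    rcases h.forced hqd with h2 | h2
    · left
      obtain ⟨I, hI, h3, h4⟩ := hΓ.nx_mem (ν (-1) + 1) (by omega) (by omega) (by omega)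
      exact ⟨I, hI, by omega, by omega⟩
    · exact .inr h2
  refine ⟨⟨?_, hqd, h.base hΓ hν, ?_⟩, hf⟩
  · rcases hf with ⟨I, hI, h2, h3⟩ | ⟨v, hv, h2, h3⟩
    · have := hΓ.base_ok I hI; omega
    · have h4 := hν.lt_L v hv (by omega)
      have h5 := hΓ.iv_ok v hv _ (hν.root_le v hv) (by omega)
      omega
  · intro v hv hu
    by_cases h2 : ν v + 2 ≤ Γ.fin v
    · exact hq.trans (h.multi v hv h2)
    · exact h.single v hv (by omega)

/-- If a scan finds no point that has to be selected, then the first interval found ends first. -/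
theorem Scan.min_of_settled {q₂ xi : ℤ} (hΓ : Γ.Good) (hν : Γ.Val ν) (h : Γ.Scan ν q₂ xi q)
    (hq : ¬ (q ≤ q₂ ∧ q < Γ.d)) {x : ℕ} (hx : x < Γ.h) (hx2 : ν x + 2 ≤ Γ.fin x)
    (hq₂ : q₂ = Γ.R (ν x)) : Γ.Min ν q₂ := by
  have h4 := hν.lt_L x hx (by omega)
  have h5 := hΓ.iv_ok x hx _ (hν.root_le x hx) (by omega)
  have h6 := h.le_d
  refine ⟨by omega, by omega, ?_, ?_⟩
  · intro I hI hlt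
    have := h.base hΓ hν I hI hlt
    omega
  · intro v hv hu
    by_cases h2 : ν v + 2 ≤ Γ.fin v
    · exact h.multi v hv h2
    · have := h.single v hv (by omega)
      omega

/-- If nothing is left to be stabbed, then only the number of points matters. -/
theorem Scan.feas_iff {q₂ xi : ℤ} (hΓ : Γ.Good) (hν : Γ.Val ν) (h : Γ.Scan ν q₂ xi q)
    (hq : ¬ (q ≤ q₂ ∧ q < Γ.d)) (hxi : xi ≤ -1) : Γ.Feas ν ↔ ν (-2) ≤ Γ.N := by
  have h6 := h.le_d
  obtain ⟨-, h1, h2⟩ | ⟨v, -, h1, -⟩ := h.first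
  · constructor
    · rintro ⟨S, hS⟩
      have := hS.card_le
      omega
    · intro hN
      refine ⟨∅, by simp, by simpa using hN, ?_, ?_⟩
      · intro I hI hlt
        have := h.base hΓ hν I hI hlt
        have := hΓ.base_ok I hI
        omega
      · intro v hv hu
        have h3 := h2 v hv
        have h4 := h.single v hv (by omega)
        have h5 := hΓ.iv_ok v hv _ (hν.root_le v hv) hu
        omega
  · omega

variable (Γ) in
-- Supplies nodes that are needed for the comparison in `feas_iff_of_tight` but that the program
-- need not compute.
theorem exists_sel (ν : ℤ → ℤ) (q : ℤ) : ∃ ν', Γ.Sel ν q ν' := by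
  refine ⟨fun i => if i = -1 then Γ.ent q else if i = -2 then ν (-2) + Γ.cnt q else
    if ν i < Γ.fin i ∧ Γ.L (ν i) ≤ q then Γ.fin i else ν i, rfl, rfl, ?_, ?_⟩
  · intro v _ h1 h2
    show (if (v : ℤ) = -1 then _ else if (v : ℤ) = -2 then _ else _) = _
    rw [if_neg (by omega), if_neg (by omega), if_pos ⟨h1, h2⟩]
  · intro v _ h
    show (if (v : ℤ) = -1 then _ else if (v : ℤ) = -2 then _ else _) = _
    rw [if_neg (by omega), if_neg (by omega), if_neg h]

theorem Drop.of_update (ν : ℤ → ℤ) (x : ℕ) :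
    Γ.Drop ν x (Function.update ν (x : ℤ) (ν x + 1)) :=
  ⟨Function.update_of_ne (by omega) _ _, Function.update_of_ne (by omega) _ _,
    fun _ _ hv => Function.update_of_ne (by omega) _ _, Function.update_self _ _ _⟩

variable (Γ) in
theorem exists_drop (ν : ℤ → ℤ) (x : ℕ) : ∃ ν', Γ.Drop ν x ν' := ⟨_, .of_update ν x⟩

theorem Sel.agree (h₁ : Γ.Sel ν q ν') (h₂ : Γ.Sel ν q ν'') : Γ.Agree ν' ν'' := by
  intro i hi hi'
  rcases lt_or_ge i 0 with h | h
  · obtain rfl | rfl : i = -1 ∨ i = -2 := by omega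
    · rw [h₁.last, h₂.last]
    · rw [h₁.count, h₂.count]
  · lift i to ℕ using h
    have hv : i < Γ.h := by omega
    by_cases h : ν i < Γ.fin i ∧ Γ.L (ν i) ≤ q
    · rw [h₁.hit i hv h.1 h.2, h₂.hit i hv h.1 h.2]
    · rw [h₁.keep i hv h, h₂.keep i hv h]

/-- When selecting the end of the first interval of the list `x` and dropping this interval both
remove one excess interval only, then the first interval of the next list `f` may be dropped, or its
end may be selected after the cheaper one of the two alternatives for `x`. -/
theorem feas_iff_of_tight (hΓ : Γ.Good) {x f : ℕ} {A₀ A B₀ B X' C : ℤ → ℤ} {qf qA q₂ xi qB : ℤ}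
    (hν : Γ.Val ν) (hm : Γ.Min ν q) (hx : x < Γ.h) (hx2 : ν x + 2 ≤ Γ.fin x) (hq : q = Γ.R (ν x))
    (hA₀ : Γ.Sel ν q A₀) (hA : Γ.Evo A₀ A) (hAf : Γ.Feas A₀ ↔ Γ.Feas A) (hAv : Γ.Val A)
    (hB₀ : Γ.Drop ν x B₀) (hB : Γ.Evo B₀ B) (hBf : Γ.Feas B₀ ↔ Γ.Feas B) (hBv : Γ.Val B)
    (hAs : Γ.Scan A qf f qA) (hAs' : ¬ (qA ≤ qf ∧ qA < Γ.d))
    (hBs : Γ.Scan B q₂ xi qB) (hBs' : ¬ (qB ≤ q₂ ∧ qB < Γ.d))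
    (hAe : Γ.excess A + 1 = Γ.excess ν) (hBe : Γ.excess B + 1 = Γ.excess ν)
    (hX' : Γ.Drop ν f X') (hC₁ : A (-2) ≤ B (-2) → Γ.Sel A qf C)
    (hC₂ : ¬ A (-2) ≤ B (-2) → Γ.Sel B qf C) :
    (Γ.Feas ν ↔ Γ.Feas X' ∨ Γ.Feas C) ∧ Γ.Val X' ∧ Γ.Val C ∧ Γ.excess X' + 1 ≤ Γ.excess ν ∧
      Γ.excess C + 2 ≤ Γ.excess ν := by
  have hiv := hΓ.iv_ok x hx _ (hν.root_le x hx) (by omega)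
  have hevA₀ := hA₀.evo hΓ hν hm
  have hevA := hevA₀.trans hA
  have hA₀x : A₀ x = Γ.fin x := hA₀.hit x hx (by omega) (by omega)
  have hAx : A x = Γ.fin x := by
    rcases hA.list x hx with h | h <;> omega
  -- `x` has two intervals left, and no other list with several intervals is stabbed
  have hx2' : ν x + 2 = Γ.fin x := by
    by_contra hne
    have := excess_add_le (ν := ν) (ν' := A) (a := 2) (b := 0) hx hx fun v hv => by
      by_cases hvx : v = x
      · subst hvx; simp only [if_true]; omega
      · simp only [if_neg hvx]; rcases hevA.list v hv with h | h <;> omega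
    omega
  have hAk : ∀ v : ℕ, v < Γ.h → v ≠ x → ν v + 2 ≤ Γ.fin v → A v = ν v := by
    intro v hv hvx h2
    by_contra hne
    have := excess_add_le (ν := ν) (ν' := A) (a := 1) (b := 1) hx hv fun w hw => by
      by_cases hwx : w = x
      · subst hwx; simp only [if_true, if_neg (Ne.symm hvx)]; omega
      · by_cases hwv : w = v
        · subst hwv; simp only [if_true, if_neg hwx]
          rcases hevA.list w hw with h | h <;> omega
        · simp only [if_neg hwx, if_neg hwv]; rcases hevA.list w hw with h | h <;> omega
    omega
  -- The drop of the interval of `x` already accounts for the single unit that is lost on the way to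
  -- `B`.
  have hBk : ∀ v : ℕ, v < Γ.h → v ≠ x → ν v + 2 ≤ Γ.fin v → B v = ν v := by
    intro v hv hvx h2
    by_contra hne
    have := excess_add_le (ν := ν) (ν' := B) (a := 1) (b := 1) hx hv fun w hw => by
      by_cases hwx : w = x
      · subst hwx; simp only [if_true, if_neg (Ne.symm hvx)]
        rcases hB.list w hw with h | h <;> rw [hB₀.drop] at h <;> omega
      · have h3 := hB.list w hw
        rw [hB₀.keep w hw hwx] at h3
        by_cases hwv : w = v
        · subst hwv; simp only [if_true, if_neg hwx]
          rcases h3 with h | h <;> omega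
        · simp only [if_neg hwx, if_neg hwv]; rcases h3 with h | h <;> omega
    omega
  -- the list `f`
  obtain ⟨hf, hf2, hqf⟩ : f < Γ.h ∧ A f + 2 ≤ Γ.fin f ∧ qf = Γ.R (A f) := by
    rcases hAs.first with ⟨h, -⟩ | ⟨v, hv, h, h'⟩
    · omega
    · rw [Nat.cast_inj] at h; subst h; exact ⟨hv, h'⟩
  have hfx : f ≠ x := by rintro rfl; omega
  have hfν : A f = ν f := by rcases hevA.list f hf with h | h <;> omega
  have hfB : B f = ν f := hBk f hf hfx (by omega)
  have hmA : Γ.Min A qf := hAs.min_of_settled hΓ hAv hAs' hf hf2 hqf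
  -- In `B` the list `x` has at most one interval left, so every list with several left has the same
  -- first interval in `A`.
  have hmultiB : ∀ v : ℕ, v < Γ.h → B v + 2 ≤ Γ.fin v → qf ≤ Γ.R (B v) := by
    intro v hv h2
    have hvx : v ≠ x := by
      rintro rfl
      rcases hB.list v hv with h | h <;> rw [hB₀.drop] at h <;> omega
    have h3 := hB.list v hv
    rw [hB₀.keep v hv hvx] at h3
    have h4 : B v = ν v := by rcases h3 with h | h <;> omega
    have h5 := hAk v hv hvx (by omega)
    rw [h4, ← h5]
    exact hAs.multi v hv (by omega)
  -- Hence both scans find the same end; that they name the same list is not required.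
  have hq₂ : q₂ = qf := by
    have h1 := hBs.multi f hf (by omega)
    rcases hBs.first with ⟨-, -, h⟩ | ⟨v, hv, -, h2, h3⟩
    · exact absurd (by omega) (h f hf)
    · have := hmultiB v hv h2
      rw [hfB, ← hfν, ← hqf] at h1
      omega
  subst hq₂
  have hmB : Γ.Min B q₂ :=
    hBs.min_of_settled hΓ hBv hBs' hf (by omega) (by rw [hfB, ← hfν]; exact hqf)
  have hX'v : Γ.Val X' := hX'.val hΓ hf (by omega) hν
  have hX'e := hX'.excess_lt hf (by omega)
  -- the four alternatives
  obtain ⟨A₁, hA₁⟩ := Γ.exists_sel A q₂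
  obtain ⟨B₁, hB₁⟩ := Γ.exists_sel B q₂
  obtain ⟨A₂, hA₂⟩ := Γ.exists_drop A f
  obtain ⟨B₂, hB₂⟩ := Γ.exists_drop B f
  have hsplitA := hA₁.feas_iff_or hΓ hAv hmA hf hf2 hqf hA₂
  have hsplitB := hB₁.feas_iff_or hΓ hBv hmB hf (by omega) (by rw [hfB, ← hfν]; exact hqf) hB₂
  have hsplit := hA₀.feas_iff_or hΓ hν hm hx hx2 hq hB₀
  have hX'ν : Γ.Feas X' → Γ.Feas ν := hX'.feas hf (by omega)
  have hA₂X' : Γ.Feas A₂ → Γ.Feas X' := hevA.feas_drop hf hfν hX' hA₂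
  have hB₂X' : Γ.Feas B₂ → Γ.Feas X' := by
    intro h
    obtain ⟨B₃, hB₃⟩ := Γ.exists_drop B₀ f
    have h1 : Γ.Feas B₃ := hB.feas_drop hf (by rw [hfB, hB₀.keep f hf hfx]) hB₃ hB₂ h
    -- The drops in `x` and in `f` commute.
    have h2 : Γ.Drop X' x B₃ := by
      refine ⟨?_, ?_, ?_, ?_⟩
      · rw [hB₃.last, hB₀.last, hX'.last]
      · rw [hB₃.count, hB₀.count, hX'.count]
      · intro v hv hvx
        by_cases hvf : v = f
        · subst hvf; rw [hB₃.drop, hB₀.keep v hv hvx, hX'.drop]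
        · rw [hB₃.keep v hv hvf, hB₀.keep v hv hvx, hX'.keep v hv hvf]
      · rw [hB₃.keep x hx hfx.symm, hB₀.drop, hX'.keep x hx hfx.symm]
    exact h2.feas hx (by rw [hX'.keep x hx hfx.symm]; omega) h1
  -- the nodes `A₁` and `B₁` differ in the number of points and in the list `x` only
  have hA₁l : ∀ v : ℕ, v < Γ.h → ν v < Γ.fin v → (A₁ v = ν v ∧ q₂ < Γ.L (ν v)) ∨
      (A₁ v = Γ.fin v ∧ Γ.L (ν v) ≤ q₂) := by
    intro v hv hu
    -- A list stabbed on the way to `A` starts by the last point of `A`, which precedes `q₂`. So its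
    -- state in `A₁` depends only on whether `L (ν v) ≤ q₂`, and the same test decides in `B₁`.
    have h5 := hmA.gt
    by_cases h : A v < Γ.fin v ∧ Γ.L (A v) ≤ q₂
    · have h1 : A v = ν v := by rcases hevA.list v hv with h' | h' <;> omega
      right; exact ⟨hA₁.hit v hv h.1 h.2, by rw [← h1]; exact h.2⟩
    · rw [hA₁.keep v hv h]
      rcases hevA.list v hv with h' | h'
      · left; rw [h'] at h; exact ⟨h', by by_contra hc; exact h ⟨hu, by omega⟩⟩
      · right; exact ⟨h'.1, by omega⟩
  have hB₁l : ∀ v : ℕ, v < Γ.h → v ≠ x → ν v < Γ.fin v → (B₁ v = ν v ∧ q₂ < Γ.L (ν v)) ∨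
      (B₁ v = Γ.fin v ∧ Γ.L (ν v) ≤ q₂) := by
    intro v hv hvx hu
    have h5 := hmB.gt
    have hl := hB.list v hv
    rw [hB₀.keep v hv hvx] at hl
    by_cases h : B v < Γ.fin v ∧ Γ.L (B v) ≤ q₂
    · have h1 : B v = ν v := by rcases hl with h' | h' <;> omega
      right; exact ⟨hB₁.hit v hv h.1 h.2, by rw [← h1]; exact h.2⟩
    · rw [hB₁.keep v hv h]
      rcases hl with h' | h'
      · left; rw [h'] at h; exact ⟨h', by by_contra hc; exact h ⟨hu, by omega⟩⟩
      · right; exact ⟨h'.1, by omega⟩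
  have hA₁v := hA₁.val hΓ hAv hmA.gt hmA.lt
  have hB₁v := hB₁.val hΓ hBv hmB.gt hmB.lt
  have hA₁x : A₁ x = Γ.fin x := by
    rw [hA₁.keep x hx (by omega), hAx]
  have hfin : ∀ v : ℕ, v < Γ.h → ¬ ν v < Γ.fin v → A₁ v = Γ.fin v := by
    intro v hv h
    have h1 := hν.le_fin v hv
    have h2 : A v = Γ.fin v := by rcases hevA.list v hv with h' | h' <;> omega
    rw [hA₁.keep v hv (by omega), h2]
  -- `A₁` demands no more than `B₁`: the list `x` is stabbed, the other lists agree, and no more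
  -- points have been used.
  have hAB : A (-2) ≤ B (-2) → Γ.Feas B₁ → Γ.Feas A₁ := by
    rintro hle ⟨S, hS⟩
    refine ⟨S, ?_, ?_, ?_, ?_⟩
    · rw [hA₁.last, ← hB₁.last]; exact hS.gt
    · have := hS.card_le
      rw [hB₁.count] at this
      rw [hA₁.count]; omega
    · rw [hA₁.last, ← hB₁.last]; exact hS.base
    · intro v hv hu
      by_cases hvx : v = x
      · subst hvx; omega
      · by_cases hu' : ν v < Γ.fin v
        · have h1 : A₁ v = B₁ v := by
            rcases hA₁l v hv hu' with h | h <;> rcases hB₁l v hv hvx hu' with h' | h' <;> omega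
          rw [h1] at hu ⊢
          exact hS.list v hv hu
        · rw [hfin v hv hu'] at hu; omega
  -- Here `B` has used at least one point less than `A`; the spare point stabs what is left of `x`,
  -- if anything.
  have hBA : ¬ A (-2) ≤ B (-2) → Γ.Feas A₁ → Γ.Feas B₁ := by
    rintro hlt ⟨S, hS⟩
    by_cases hxB : B₁ x < Γ.fin x
    · have h1 := hB₁v.lt_L x hx hxB
      have h2 := hΓ.iv_ok x hx _ (hB₁v.root_le x hx) hxB
      refine ⟨insert (Γ.R (B₁ x)) S, ?_, ?_, ?_, ?_⟩
      · intro y hy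
        rcases Finset.mem_insert.1 hy with rfl | hy
        · omega
        · rw [hB₁.last, ← hA₁.last]; exact hS.gt y hy
      · have := hS.card_le
        have h3 := Finset.card_insert_le (Γ.R (B₁ x)) S
        rw [hA₁.count] at this
        rw [hB₁.count]; omega
      · rw [hB₁.last, ← hA₁.last]; intro I hI hlt
        obtain ⟨y, hy, hy'⟩ := hS.base I hI hlt
        exact ⟨y, Finset.mem_insert_of_mem hy, hy'⟩
      · intro v hv hu
        by_cases hvx : v = x
        · subst hvx; exact ⟨_, le_rfl, hu, _, Finset.mem_insert_self _ _, h2.2.1, le_rfl⟩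
        · by_cases hu' : ν v < Γ.fin v
          · have h1 : B₁ v = A₁ v := by
              rcases hA₁l v hv hu' with h | h <;> rcases hB₁l v hv hvx hu' with h' | h' <;> omega
            rw [h1] at hu ⊢
            obtain ⟨j, hj, hj', y, hy, hy'⟩ := hS.list v hv hu
            exact ⟨j, hj, hj', y, Finset.mem_insert_of_mem hy, hy'⟩
          · have h3 := hB.list v hv
            rw [hB₀.keep v hv hvx] at h3
            have h4 := hν.le_fin v hv
            have h5 : B v = Γ.fin v := by rcases h3 with h' | h' <;> omega
            rw [hB₁.keep v hv (by omega), h5] at hu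
            omega
    · refine ⟨S, ?_, ?_, ?_, ?_⟩
      · rw [hB₁.last, ← hA₁.last]; exact hS.gt
      · have := hS.card_le
        rw [hA₁.count] at this
        rw [hB₁.count]; omega
      · rw [hB₁.last, ← hA₁.last]; exact hS.base
      · intro v hv hu
        by_cases hvx : v = x
        · subst hvx; omega
        · by_cases hu' : ν v < Γ.fin v
          · have h1 : B₁ v = A₁ v := by
              rcases hA₁l v hv hu' with h | h <;> rcases hB₁l v hv hvx hu' with h' | h' <;> omega
            rw [h1] at hu ⊢
            exact hS.list v hv hu
          · have h3 := hB.list v hv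
            rw [hB₀.keep v hv hvx] at h3
            have h4 := hν.le_fin v hv
            have h5 : B v = Γ.fin v := by rcases h3 with h' | h' <;> omega
            rw [hB₁.keep v hv (by omega), h5] at hu
            omega
  -- Selecting `q₂` also stabs `f`, which has at least two intervals left; this is the second unit
  -- lost.
  have hexC : ∀ {E : ℤ → ℤ}, Γ.Val E → Γ.Min E q₂ → Γ.Sel E q₂ C → E f = ν f →
      Γ.excess C + 1 ≤ Γ.excess E := by
    intro E hE hmE h2 hEf
    have hfi := hΓ.iv_ok f hf (E f) (hE.root_le f hf) (by omega)
    refine (h2.evo hΓ hE hmE).excess_lt hf (by omega) (h2.hit f hf (by omega) ?_)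
    rw [hqf, hfν, ← hEf]; exact hfi.2.1
  by_cases hle : A (-2) ≤ B (-2)
  · have hC := hC₁ hle
    have hag := hA₁.agree hC
    have := hexC hAv hmA hC hfν
    have hCf := hag.feas_iff
    refine ⟨⟨fun h => ?_, ?_⟩, hX'v, hag.val hA₁v, hX'e, by omega⟩
    · rcases hsplit.1 h with h | h
      · rcases hsplitA.1 (hAf.1 h) with h | h
        · exact .inr (hCf.1 h)
        · exact .inl (hA₂X' h)
      · rcases hsplitB.1 (hBf.1 h) with h | h
        · exact .inr (hCf.1 (hAB hle h))
        · exact .inl (hB₂X' h)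
    · rintro (h | h)
      · exact hX'ν h
      · exact hsplit.2 (.inl (hAf.2 (hsplitA.2 (.inl (hCf.2 h)))))
  · have hC := hC₂ hle
    have hag := hB₁.agree hC
    have := hexC hBv hmB hC hfB
    have hCf := hag.feas_iff
    refine ⟨⟨fun h => ?_, ?_⟩, hX'v, hag.val hB₁v, hX'e, by omega⟩
    · rcases hsplit.1 h with h | h
      · rcases hsplitA.1 (hAf.1 h) with h | h
        · exact .inr (hCf.1 (hBA hle h))
        · exact .inl (hA₂X' h)
      · rcases hsplitB.1 (hBf.1 h) with h | h
        · exact .inr (hCf.1 h)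
        · exact .inl (hB₂X' h)
    · rintro (h | h)
      · exact hX'ν h
      · exact hsplit.2 (.inr (hBf.2 (hsplitB.2 (.inl (hCf.2 h)))))

end StabData

/-! ### The program -/

namespace StabData

open RAM

/-- One step of `scan`. -/
def scanBody (a : ℕ) : Cmd :=
  .ite (.le (.add (.read a (.reg 11)) (.const 1)) (.read 3 (.reg 11)))
    (.ite (.le (.add (.read a (.reg 11)) (.const 2)) (.read 3 (.reg 11)))
      (.assign 15 (.add (.reg 15)
          (.sub (.sub (.read 3 (.reg 11)) (.read a (.reg 11))) (.const 1))) ;;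
        .ite (.le (.read 2 (.read a (.reg 11))) (.reg 13))
          (.assign 13 (.read 2 (.read a (.reg 11))) ;; .assign 14 (.reg 11)) .skip)
      (.ite (.le (.read 2 (.read a (.reg 11))) (.reg 12))
        (.assign 12 (.read 2 (.read a (.reg 11)))) .skip))
    .skip ;;
  .assign 11 (.add (.reg 11) (.const 1))

/-- The test of the loops over all lists. -/
def moreLists : Test := .le (.add (.reg 11) (.const 1)) (.reg 6)

/-- Scan the node in array `a`: registers `13`, `14` receive the first end and its list among the
lists with several intervals, register `15` the excess, and register `16` the first end among the
other intervals. -/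
def scan (a : ℕ) : Cmd :=
  .assign 11 (.const 0) ;; .assign 12 (.reg 2) ;; .assign 13 (.reg 2) ;; .assign 14 (.const (-1)) ;;
  .assign 15 (.const 0) ;; .while moreLists (scanBody a) ;;
  .assign 16 (.read 6 (.add (.read a (.const (-1))) (.const 1))) ;;
  .ite (.le (.reg 12) (.reg 16)) (.assign 16 (.reg 12)) .skip

/-- One step of `select`. -/
def selectBody (a : ℕ) : Cmd :=
  .ite (.and (.le (.add (.read a (.reg 11)) (.const 1)) (.read 3 (.reg 11)))
      (.le (.read 1 (.read a (.reg 11))) (.reg 17)))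
    (.store a (.reg 11) (.read 3 (.reg 11))) .skip ;;
  .assign 11 (.add (.reg 11) (.const 1))

/-- Select the point in register `17` and the greedy points in its segment. -/
def select (a : ℕ) : Cmd :=
  .assign 11 (.const 0) ;; .while moreLists (selectBody a) ;;
  .store a (.const (-2)) (.add (.read a (.const (-2))) (.read 8 (.reg 17))) ;;
  .store a (.const (-1)) (.read 7 (.reg 17))

/-- Select points as long as this is forced. -/
def settle (a : ℕ) : Cmd :=
  scan a ;;
  .while (.and (.le (.reg 16) (.reg 13)) (.le (.add (.reg 16) (.const 1)) (.reg 2)))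
    (.assign 17 (.reg 16) ;; select a ;; scan a)

/-- Copy a node from array `a` to array `b`, with the given offsets. -/
def copy (a b : ℕ) (e f : Expr) : Cmd :=
  .assign 11 (.const (-2)) ;;
  .while moreLists (.store b (.add f (.reg 11)) (.read a (.add e (.reg 11))) ;;
    .assign 11 (.add (.reg 11) (.const 1)))

/-- The tables of `Γ` stand where the program expects them. -/
structure Ctx (Γ : StabData) (s : State) : Prop where
  reg2 : s.reg 2 = Γ.d
  reg3 : s.reg 3 = Γ.N
  reg6 : s.reg 6 = Γ.h
  arr1 : s.arr 1 = Γ.L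
  arr2 : s.arr 2 = Γ.R
  arr3 : s.arr 3 = Γ.fin
  arr6 : s.arr 6 = Γ.nx
  arr7 : s.arr 7 = Γ.ent
  arr8 : s.arr 8 = Γ.cnt

theorem Ctx.of_frame {Γ : StabData} {c : Cmd} {s s' : State} (h : Γ.Ctx s)
    (hr : ∀ x, x ∉ c.regs → s'.reg x = s.reg x) (ha : ∀ a, a ∉ c.arrs → s'.arr a = s.arr a)
    (h1 : 2 ∉ c.regs ∧ 3 ∉ c.regs ∧ 6 ∉ c.regs) (h2 : 1 ∉ c.arrs ∧ 2 ∉ c.arrs ∧ 3 ∉ c.arrs ∧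
      6 ∉ c.arrs ∧ 7 ∉ c.arrs ∧ 8 ∉ c.arrs) : Γ.Ctx s' := by
  constructor
  · rw [hr _ h1.1]; exact h.reg2
  · rw [hr _ h1.2.1]; exact h.reg3
  · rw [hr _ h1.2.2]; exact h.reg6
  · rw [ha _ h2.1]; exact h.arr1
  · rw [ha _ h2.2.1]; exact h.arr2
  · rw [ha _ h2.2.2.1]; exact h.arr3
  · rw [ha _ h2.2.2.2.1]; exact h.arr6
  · rw [ha _ h2.2.2.2.2.1]; exact h.arr7
  · rw [ha _ h2.2.2.2.2.2]; exact h.arr8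

/-! ### Correctness of the subroutines -/

variable {Γ : StabData}

/-- The invariant of `scan` after `w` lists. -/
structure ScanInv (Γ : StabData) (ν : ℤ → ℤ) (w : ℕ) (q₁ q₂ xi m : ℤ) : Prop where
  le_d : q₁ ≤ Γ.d
  single : ∀ v : ℕ, v < w → ν v + 1 = Γ.fin v → q₁ ≤ Γ.R (ν v)
  multi : ∀ v : ℕ, v < w → ν v + 2 ≤ Γ.fin v → q₂ ≤ Γ.R (ν v)
  forced : q₁ < Γ.d → ∃ v : ℕ, v < w ∧ ν v + 1 = Γ.fin v ∧ q₁ = Γ.R (ν v)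
  first : (xi = -1 ∧ q₂ = Γ.d ∧ ∀ v : ℕ, v < w → ¬ ν v + 2 ≤ Γ.fin v) ∨
    ∃ v : ℕ, v < w ∧ xi = v ∧ ν v + 2 ≤ Γ.fin v ∧ q₂ = Γ.R (ν v)
  excess : m = (∑ v ∈ Finset.range w, (Γ.fin v - ν v - 1).toNat : ℕ)

/-- The three lemmas from here on match the branches of `scanBody`: the list is stabbed, has one
interval left, or has several. -/
theorem ScanInv.skip {ν : ℤ → ℤ} {w : ℕ} {q₁ q₂ xi m : ℤ} (h : Γ.ScanInv ν w q₁ q₂ xi m)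
    (hw : ¬ ν w + 1 ≤ Γ.fin w) : Γ.ScanInv ν (w + 1) q₁ q₂ xi m := by
  refine ⟨h.le_d, ?_, ?_, ?_, ?_, ?_⟩
  · intro v hv h1
    rcases Nat.lt_succ_iff_lt_or_eq.1 hv with hv | rfl
    · exact h.single v hv h1
    · omega
  · intro v hv h1
    rcases Nat.lt_succ_iff_lt_or_eq.1 hv with hv | rfl
    · exact h.multi v hv h1
    · omega
  · intro h1
    obtain ⟨v, hv, hv'⟩ := h.forced h1
    exact ⟨v, by omega, hv'⟩
  · rcases h.first with ⟨h1, h2, h3⟩ | ⟨v, hv, hv'⟩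
    · refine .inl ⟨h1, h2, fun v hv => ?_⟩
      rcases Nat.lt_succ_iff_lt_or_eq.1 hv with hv | rfl
      · exact h3 v hv
      · omega
    · exact .inr ⟨v, by omega, hv'⟩
  · rw [Finset.sum_range_succ, h.excess, Int.toNat_of_nonpos (by omega : Γ.fin w - ν w - 1 ≤ 0)]
    simp

theorem ScanInv.one {ν : ℤ → ℤ} {w : ℕ} {q₁ q₁' q₂ xi m : ℤ} (h : Γ.ScanInv ν w q₁ q₂ xi m)
    (hw : ν w + 1 = Γ.fin w) (hq : q₁' = min q₁ (Γ.R (ν w))) :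
    Γ.ScanInv ν (w + 1) q₁' q₂ xi m := by
  have hle := h.le_d
  refine ⟨by omega, ?_, ?_, ?_, ?_, ?_⟩
  · intro v hv h1
    rcases Nat.lt_succ_iff_lt_or_eq.1 hv with hv | rfl
    · have := h.single v hv h1; omega
    · omega
  · intro v hv h1
    rcases Nat.lt_succ_iff_lt_or_eq.1 hv with hv | rfl
    · exact h.multi v hv h1
    · omega
  · intro h1
    by_cases h2 : q₁ ≤ Γ.R (ν w)
    · obtain ⟨v, hv, hv'⟩ := h.forced (by omega)
      exact ⟨v, by omega, hv'.1, by omega⟩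
    · exact ⟨w, by omega, hw, by omega⟩
  · rcases h.first with ⟨h1, h2, h3⟩ | ⟨v, hv, hv'⟩
    · refine .inl ⟨h1, h2, fun v hv => ?_⟩
      rcases Nat.lt_succ_iff_lt_or_eq.1 hv with hv | rfl
      · exact h3 v hv
      · omega
    · exact .inr ⟨v, by omega, hv'⟩
  · rw [Finset.sum_range_succ, h.excess, Int.toNat_of_nonpos (by omega : Γ.fin w - ν w - 1 ≤ 0)]
    simp

theorem ScanInv.many {ν : ℤ → ℤ} {w : ℕ} {q₁ q₂ q₂' xi xi' m m' : ℤ}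
    (h : Γ.ScanInv ν w q₁ q₂ xi m) (hw : ν w + 2 ≤ Γ.fin w) (hR : Γ.R (ν w) < Γ.d)
    (hq : (Γ.R (ν w) ≤ q₂ ∧ q₂' = Γ.R (ν w) ∧ xi' = w) ∨ (¬ Γ.R (ν w) ≤ q₂ ∧ q₂' = q₂ ∧ xi' = xi))
    (hm : m' = m + (Γ.fin w - ν w - 1)) : Γ.ScanInv ν (w + 1) q₁ q₂' xi' m' := by
  refine ⟨h.le_d, ?_, ?_, ?_, ?_, ?_⟩
  · intro v hv h1
    rcases Nat.lt_succ_iff_lt_or_eq.1 hv with hv | rfl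
    · exact h.single v hv h1
    · omega
  · intro v hv h1
    rcases Nat.lt_succ_iff_lt_or_eq.1 hv with hv | rfl
    · have := h.multi v hv h1; omega
    · omega
  · intro h1
    obtain ⟨v, hv, hv'⟩ := h.forced h1
    exact ⟨v, by omega, hv'⟩
  · right
    rcases hq with ⟨h1, h2, h3⟩ | ⟨h1, h2, h3⟩
    · exact ⟨w, by omega, h3, hw, h2⟩
    -- As long as no list is found, `q₂` is the sentinel `d`, beyond every right end, and the
    -- comparison cannot fail.
    · rcases h.first with ⟨h4, h5, h6⟩ | ⟨v, hv, h4, h5, h6⟩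
      · omega
      · exact ⟨v, by omega, by omega, h5, by omega⟩
  · rw [Finset.sum_range_succ, hm, h.excess]
    push_cast
    rw [Int.toNat_of_nonneg (by omega : 0 ≤ Γ.fin w - ν w - 1)]

theorem run_scan (hΓ : Γ.Good) (a : ℕ) {s : State} (hs : Γ.Ctx s) (hν : Γ.Val (s.arr a)) :
    Run (scan a) s fun t s' => t ≤ 100 * (Γ.h + 1) ∧
      Γ.Scan (s.arr a) (s'.reg 13) (s'.reg 14) (s'.reg 16) ∧ s'.reg 15 = Γ.excess (s.arr a) := by
  have hd : s.reg 2 = Γ.d := hs.reg2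
  simp only [scan, run_seq, run_assign]
  refine (run_while (T := 60) (n := Γ.h) (fun n s' => ∃ w : ℕ, n + w = Γ.h ∧ s'.reg 11 = w ∧
    s'.arr = s.arr ∧ s'.reg 6 = Γ.h ∧
    Γ.ScanInv (s.arr a) w (s'.reg 12) (s'.reg 13) (s'.reg 14) (s'.reg 15)) ?_ ?_).mono ?_
  · rintro n s' ⟨w, hw, h11, harr, h6, hI⟩ hb
    simp only [moreLists, Test.Holds, Expr.eval, h11, h6] at hb
    have hwh : w < Γ.h := by omega
    simp only [scanBody, run_seq, run_ite, run_assign, run_skip, Test.Holds, Expr.eval, reg_setReg,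
      arr_setReg, harr, h11, hs.arr2, hs.arr3, Expr.cost, Test.cost, h6, Nat.reduceEqDiff, if_true,
      if_false, Nat.reduceAdd]
    have hrt := hν.root_le w hwh
    refine ⟨fun h1 => ⟨fun h2 => ?_, fun h2 => ?_⟩, fun h1 => ?_⟩
    · have hR := (hΓ.iv_ok w hwh _ hrt (by omega)).2.2
      refine ⟨fun h3 => ⟨by omega, n - 1, by omega, w + 1, by omega, by push_cast; rfl, trivial, trivial,
        hI.many h2 hR (.inl ⟨h3, rfl, rfl⟩) (by ring)⟩, fun h3 => ⟨by omega, n - 1, by omega, w + 1, by omega, by push_cast; rfl, trivial, trivial,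
        hI.many h2 hR (.inr ⟨h3, rfl, rfl⟩) (by ring)⟩⟩
    · refine ⟨fun h3 => ⟨by omega, n - 1, by omega, w + 1, by omega, by push_cast; rfl, trivial, trivial,
        hI.one (by omega) (by omega)⟩, fun h3 => ⟨by omega, n - 1, by omega, w + 1, by omega, by push_cast; rfl, trivial, trivial,
        hI.one (by omega) (by omega)⟩⟩
    · exact ⟨by omega, n - 1, by omega, w + 1, by omega, by push_cast; rfl, trivial, trivial,
        hI.skip h1⟩
  -- Initially both ends hold the sentinel `d` and the list is `-1`.
  · refine ⟨0, by omega, ?_⟩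
    simp [hs.reg6, hd]
    exact ⟨le_rfl, by simp, by simp, by simp, by simp, by simp⟩
  · rintro t s' ⟨ht, ⟨n, w, hw, h11, harr, h6, hI⟩, hb⟩
    simp only [moreLists, Test.Holds, Expr.eval, h11, h6, not_le] at hb
    have hwh : w = Γ.h := by omega
    subst hwh
    have hge := hν.ge
    have hlt := hν.lt
    have hnd := hΓ.nx_le_d (s.arr a (-1) + 1) (by omega) (by omega)
    have hle := hI.le_d
    have hex : (s'.reg 15) = Γ.excess (s.arr a) := hI.excess
    simp only [moreLists, Test.cost, Expr.cost] at ht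
    simp only [run_ite, run_assign, run_skip, Test.Holds, Expr.eval, reg_setReg,
      harr, hs.arr6, Expr.cost, Test.cost, Nat.reduceEqDiff, if_true, if_false]
    refine ⟨fun h1 => ⟨by omega, ⟨by omega, by omega, hI.single, hI.multi,
      fun h => .inr (hI.forced h), hI.first⟩, hex⟩, fun h1 => ⟨by omega, ⟨by omega, le_rfl,
      fun v hv h2 => by have := hI.single v hv h2; omega, hI.multi, fun _ => .inl rfl, hI.first⟩, hex⟩⟩

/-- The arrays that hold search nodes. -/
def NodeArray (a : ℕ) : Prop := 9 ≤ a

theorem Ctx.setReg {s : State} (h : Γ.Ctx s) {x : ℕ} (hx : 7 ≤ x) (v : ℤ) :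
    Γ.Ctx (s.setReg x v) := by
  constructor <;> simp only [reg_setReg, arr_setReg]
  · rw [if_neg (by omega)]; exact h.reg2
  · rw [if_neg (by omega)]; exact h.reg3
  · rw [if_neg (by omega)]; exact h.reg6
  · exact h.arr1
  · exact h.arr2
  · exact h.arr3
  · exact h.arr6
  · exact h.arr7
  · exact h.arr8

theorem Ctx.setArr {s : State} (h : Γ.Ctx s) {a : ℕ} (ha : NodeArray a) (i v : ℤ) :
    Γ.Ctx (s.setArr a i v) := by
  unfold NodeArray at ha
  constructor <;> simp only [reg_setArr, arr_setArr]
  · exact h.reg2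
  · exact h.reg3
  · exact h.reg6
  · rw [if_neg (by omega)]; exact h.arr1
  · rw [if_neg (by omega)]; exact h.arr2
  · rw [if_neg (by omega)]; exact h.arr3
  · rw [if_neg (by omega)]; exact h.arr6
  · rw [if_neg (by omega)]; exact h.arr7
  · rw [if_neg (by omega)]; exact h.arr8

/-- The invariant of `select` after `w` lists. -/
structure SelectInv (Γ : StabData) (ν : ℤ → ℤ) (q : ℤ) (w : ℕ) (ν' : ℤ → ℤ) : Prop where
  last : ν' (-1) = ν (-1)
  count : ν' (-2) = ν (-2)
  hit : ∀ v : ℕ, v < w → ν v < Γ.fin v → Γ.L (ν v) ≤ q → ν' v = Γ.fin v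
  keep : ∀ v : ℕ, ¬ (v < w ∧ ν v < Γ.fin v ∧ Γ.L (ν v) ≤ q) → ν' v = ν v

theorem SelectInv.step {ν ν' : ℤ → ℤ} {q : ℤ} {w : ℕ} (h : Γ.SelectInv ν q w ν')
    (hw : ν w < Γ.fin w) (hL : Γ.L (ν w) ≤ q) :
    Γ.SelectInv ν q (w + 1) (Function.update ν' (w : ℤ) (Γ.fin w)) := by
  refine ⟨?_, ?_, ?_, ?_⟩
  · rw [Function.update_of_ne (by omega)]; exact h.last
  · rw [Function.update_of_ne (by omega)]; exact h.count
  · intro v hv h1 h2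
    rcases Nat.lt_succ_iff_lt_or_eq.1 hv with hv | rfl
    · rw [Function.update_of_ne (by omega)]; exact h.hit v hv h1 h2
    · exact Function.update_self _ _ _
  · intro v hv
    have : v ≠ w := by rintro rfl; exact hv ⟨by omega, hw, hL⟩
    rw [Function.update_of_ne (by omega)]
    exact h.keep v fun h' => hv ⟨by omega, h'.2⟩

theorem SelectInv.skip {ν ν' : ℤ → ℤ} {q : ℤ} {w : ℕ} (h : Γ.SelectInv ν q w ν')
    (hw : ¬ (ν w < Γ.fin w ∧ Γ.L (ν w) ≤ q)) : Γ.SelectInv ν q (w + 1) ν' := by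
  refine ⟨h.last, h.count, ?_, ?_⟩
  · intro v hv h1 h2
    rcases Nat.lt_succ_iff_lt_or_eq.1 hv with hv | rfl
    · exact h.hit v hv h1 h2
    · exact absurd ⟨h1, h2⟩ hw
  · intro v hv
    exact h.keep v fun h' => hv ⟨by omega, h'.2⟩

theorem run_select {a : ℕ} (ha : NodeArray a) {s : State} (hs : Γ.Ctx s) :
    Run (select a) s fun t s' => t ≤ 60 * (Γ.h + 1) ∧ Γ.Ctx s' ∧
      Γ.Sel (s.arr a) (s.reg 17) (s'.arr a) := by
  simp only [select, run_seq, run_assign]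
  refine (run_while (T := 40) (n := Γ.h) (fun n s' => ∃ w : ℕ, n + w = Γ.h ∧ s'.reg 11 = w ∧
    s'.reg 17 = s.reg 17 ∧ Γ.Ctx s' ∧
    Γ.SelectInv (s.arr a) (s.reg 17) w (s'.arr a)) ?_ ?_).mono ?_
  · rintro n s' ⟨w, hw, h11, h17, hC, hI⟩ hb
    simp only [moreLists, Test.Holds, Expr.eval, h11, hC.reg6] at hb
    have hwh : w < Γ.h := by omega
    -- The node is updated in place, but cell `w` still has its old content when its turn comes.
    have hkw : s'.arr a w = s.arr a w := hI.keep w (by omega)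
    simp only [selectBody, run_seq, run_ite, run_assign, run_store, run_skip, Test.Holds, Expr.eval,
      reg_setReg, arr_setReg, reg_setArr, arr_setArr, h11, hC.arr1, hC.arr3, Expr.cost, Test.cost,
      Nat.reduceEqDiff, if_true, if_false, Nat.reduceAdd, hkw, h17]
    refine ⟨fun h1 => ⟨by omega, n - 1, by omega, w + 1, by omega, by push_cast; rfl, trivial,
      (hC.setArr ha _ _).setReg (by omega) _, hI.step (by omega) h1.2⟩, fun h1 => ⟨by omega, n - 1,
      by omega, w + 1, by omega, by push_cast; rfl, trivial, hC.setReg (by omega) _,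
      hI.skip fun h => h1 ⟨by omega, h.2⟩⟩⟩
  · exact ⟨0, by omega, by simp, by simp, hs.setReg (by omega) _, rfl, rfl,
      fun v hv => by omega, fun v _ => rfl⟩
  · rintro t s' ⟨ht, ⟨n, w, hw, h11, h17, hC, hI⟩, hb⟩
    simp only [moreLists, Test.Holds, Expr.eval, h11, hC.reg6, not_le] at hb
    have hwh : w = Γ.h := by omega
    subst hwh
    simp only [moreLists, Test.cost, Expr.cost] at ht
    simp only [run_store, Expr.eval, reg_setArr, arr_setArr, Expr.cost, if_true, hC.arr8, h17]
    have ha' : 7 ≠ a := by unfold NodeArray at ha; omega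
    simp only [if_neg ha', hC.arr7]
    refine ⟨by omega, (hC.setArr ha _ _).setArr ha _ _, ?_, ?_, ?_, ?_⟩
    · exact Function.update_self _ _ _
    · rw [Function.update_of_ne (by omega), Function.update_self, hI.count]
    · intro v hv h1 h2
      rw [Function.update_of_ne (by omega), Function.update_of_ne (by omega)]
      exact hI.hit v hv h1 h2
    · intro v hv h1
      rw [Function.update_of_ne (by omega), Function.update_of_ne (by omega)]
      exact hI.keep v fun h => h1 h.2

/-- Register `11` is the loop counter, so the offsets must not depend on it. The last clause
protects the rest of the stack. -/
theorem run_copy {a b : ℕ} (hab : a ≠ b) (hb : NodeArray b) {e f : Expr} {s : State}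
    (hs : Γ.Ctx s) {x y : ℤ} (he : ∀ s' : State, (∀ z, z ≠ 11 → s'.reg z = s.reg z) → e.eval s' = x)
    (hf : ∀ s' : State, (∀ z, z ≠ 11 → s'.reg z = s.reg z) → f.eval s' = y)
    (hec : e.cost ≤ 1) (hfc : f.cost ≤ 1) :
    Run (copy a b e f) s fun t s' => t ≤ 60 * (Γ.h + 1) ∧ Γ.Ctx s' ∧
      (∀ i : ℤ, -2 ≤ i → i < Γ.h → s'.arr b (y + i) = s.arr a (x + i)) ∧
      ∀ i, ¬ (y - 2 ≤ i ∧ i < y + Γ.h) → s'.arr b i = s.arr b i := by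
  simp only [copy, run_seq, run_assign]
  refine (run_while (T := 20) (n := Γ.h + 2) (fun n s' => ∃ w : ℤ, n + w = Γ.h ∧ -2 ≤ w ∧ s'.reg 11 = w ∧
    Γ.Ctx s' ∧ (∀ z, z ≠ 11 → s'.reg z = s.reg z) ∧ s'.arr a = s.arr a ∧
    (∀ i, -2 ≤ i → i < w → s'.arr b (y + i) = s.arr a (x + i)) ∧
      ∀ i, ¬ (y - 2 ≤ i ∧ i < y + Γ.h) → s'.arr b i = s.arr b i) ?_ ?_).mono ?_
  · rintro n s' ⟨w, hw, hw2, h11, hC, hr, harr, h1, h2⟩ hlt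
    simp only [moreLists, Test.Holds, Expr.eval, h11, hC.reg6] at hlt
    simp only [run_seq, run_assign, run_store, Expr.eval,
      reg_setReg, arr_setReg, reg_setArr, arr_setArr, h11, Expr.cost, hab,
      if_true, if_false, harr, he s' hr, hf s' hr]
    refine ⟨by omega, n - 1, by omega, w + 1, by omega, by omega, rfl,
      (hC.setArr hb _ _).setReg (by omega) _, ?_, trivial, ?_, ?_⟩
    · intro z hz; rw [if_neg hz, hr z hz]
    · intro i hi hi'
      by_cases hiw : i = w
      · rw [hiw]; exact Function.update_self _ _ _
      · rw [Function.update_of_ne (by omega)]; exact h1 i hi (by omega)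
    · intro i hi
      rw [Function.update_of_ne (by omega)]; exact h2 i hi
  · refine ⟨-2, by push_cast; omega, by omega, by simp, hs.setReg (by omega) _, ?_, rfl, ?_, ?_⟩
    · intro z hz; rw [reg_setReg, if_neg hz]
    · intro i _ _; omega
    · intro i _; rfl
  · rintro t s' ⟨ht, ⟨n, w, hw, hw2, h11, hC, hr, harr, h1, h2⟩, hlt⟩
    simp only [moreLists, Test.Holds, Expr.eval, h11, hC.reg6, not_le] at hlt
    simp only [moreLists, Test.cost, Expr.cost] at ht ⊢
    have : w = Γ.h := by omega
    subst this
    exact ⟨by omega, hC, h1, h2⟩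

/-- The measure of `Sel.measure_lt` starts with at most `h + K ≤ 5 * k + 1`, and every round takes
O(`h + 1`) steps for one selection and one scan. -/
theorem run_settle (hΓ : Γ.Good) {a : ℕ} (ha : NodeArray a) {K k : ℕ}
    (hK : ∀ b, -1 ≤ b → b < Γ.d → 0 ≤ Γ.seg b ∧ Γ.seg b ≤ K) (hKk : K ≤ 4 * k + 1) (hk : Γ.h ≤ k)
    {s : State} (hs : Γ.Ctx s) (hν : Γ.Val (s.arr a)) :
    Run (settle a) s fun t s' => t ≤ 2000 * (k + 1) ^ 2 ∧ Γ.Ctx s' ∧ Γ.Val (s'.arr a) ∧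
      Γ.Evo (s.arr a) (s'.arr a) ∧ (Γ.Feas (s.arr a) ↔ Γ.Feas (s'.arr a)) ∧
      Γ.Scan (s'.arr a) (s'.reg 13) (s'.reg 14) (s'.reg 16) ∧
      ¬ (s'.reg 16 ≤ s'.reg 13 ∧ s'.reg 16 < Γ.d) ∧ s'.reg 15 = Γ.excess (s'.arr a) := by
  have hscan : ∀ x, x ∉ (scan a).arrs := by simp [scan, scanBody, Cmd.arrs]
  have hscanC : ∀ {s : State} {Q}, Γ.Ctx s → Run (scan a) s Q → Run (scan a) s fun t s' =>
      Q t s' ∧ Γ.Ctx s' ∧ s'.arr = s.arr := by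
    intro s Q hC hR
    refine hR.frame fun t s' hr ha' hQ => ⟨hQ, hC.of_frame hr ha' ?_ ?_, funext fun x => ha' x (hscan x)⟩
    · simp [scan, scanBody, Cmd.regs]
    · simp [hscan]
  simp only [settle, run_seq]
  refine (hscanC hs (run_scan hΓ a hs hν)).mono ?_
  rintro t₀ s₀ ⟨⟨ht₀, hsc₀, hex₀⟩, hC₀, harr₀⟩
  refine (run_while (T := 170 * (Γ.h + 1)) (n := Γ.unhit (s.arr a) + (K - Γ.seg (s.arr a (-1))).toNat)
    (fun n s' => n = Γ.unhit (s'.arr a) + (K - Γ.seg (s'.arr a (-1))).toNat ∧ Γ.Ctx s' ∧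
      Γ.Val (s'.arr a) ∧ Γ.Evo (s.arr a) (s'.arr a) ∧ (Γ.Feas (s.arr a) ↔ Γ.Feas (s'.arr a)) ∧
      Γ.Scan (s'.arr a) (s'.reg 13) (s'.reg 14) (s'.reg 16) ∧
      s'.reg 15 = Γ.excess (s'.arr a)) ?_ ?_).mono ?_
  · rintro n s' ⟨rfl, hC, hv, hev, hf, hsc, hex⟩ hb
    simp only [Test.Holds, Expr.eval, hC.reg2] at hb
    obtain ⟨hmin, hforced⟩ := hsc.min hΓ hv hb.1 (by omega)
    simp only [run_seq, run_assign]
    refine (run_select ha (hC.setReg (by omega : 7 ≤ 17) _)).mono ?_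
    rintro t₁ s₁ ⟨ht₁, hC₁, hsel⟩
    simp only [Expr.eval, arr_setReg, reg_setReg, if_true] at hsel
    have hv₁ := hsel.val hΓ hv hmin.gt hmin.lt
    refine (hscanC hC₁ (run_scan hΓ a hC₁ hv₁)).mono ?_
    rintro t₂ s₂ ⟨⟨ht₂, hsc₂, hex₂⟩, hC₂, harr₂⟩
    rw [← harr₂] at hsc₂ hex₂ hsel hv₁
    simp only [Expr.cost]
    refine ⟨by omega, _, ?_, rfl, hC₂, hv₁, hev.trans (hsel.evo hΓ hv hmin),
      hf.trans (hsel.feas_iff hΓ hv hmin hforced), hsc₂, hex₂⟩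
    exact hsel.measure_lt hΓ hv hmin (fun b h1 h2 => (hK b h1 h2).2) (hsc.forced hmin.lt)
  · rw [harr₀]
    exact ⟨rfl, hC₀, hν, .refl _, Iff.rfl, hsc₀, hex₀⟩
  · rintro t s' ⟨ht, ⟨n, -, hC, hv, hev, hf, hsc, hex⟩, hb⟩
    simp only [Test.Holds, Expr.eval, hC.reg2] at hb
    refine ⟨?_, hC, hv, hev, hf, hsc, fun h => hb ⟨h.1, by omega⟩, hex⟩
    have h1 : Γ.unhit (s.arr a) ≤ k := by
      refine (Finset.card_filter_le _ _).trans ?_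
      rw [Finset.card_range]; exact hk
    have h2 := hK _ hν.ge hν.lt
    have h3 : Γ.unhit (s.arr a) + (K - Γ.seg (s.arr a (-1))).toNat ≤ 5 * k + 1 := by omega
    simp only [Test.cost, Expr.cost] at ht
    have h4 := Nat.mul_le_mul hk h3
    generalize Γ.unhit (s.arr a) + (K - Γ.seg (s.arr a (-1))).toNat = X at ht h3 h4
    nlinarith

end StabData

/-! ### The search -/

namespace StabData

open RAM

/-- Registers from `18` on, register `0` and all arrays other than `a` are the same. -/
def Keeps (a : ℕ) (s s' : State) : Prop :=
  (∀ x, x = 0 ∨ 18 ≤ x → s'.reg x = s.reg x) ∧ ∀ b, b ≠ a → s'.arr b = s.arr b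

/-- Move on to the next node of the stack, or stop. -/
def leaf : Cmd :=
  .ite (.le (.read 10 (.const (-2))) (.reg 3)) (.assign 0 (.const 1) ;; .assign 18 (.const 0))
    (.ite (.le (.reg 19) (.const 0)) (.assign 18 (.const 0))
      (.assign 19 (.sub (.reg 19) (.add (.reg 6) (.const 2))) ;; copy 9 10 (.reg 19) (.const 0)))

/-- Compute the two alternatives for the first list with several intervals: the end of its first
interval is selected in array `11`, its first interval is dropped in array `12`. -/
def fork : Cmd :=
  .assign 20 (.reg 14) ;; .assign 21 (.reg 15) ;; .assign 24 (.reg 13) ;;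
  copy 10 11 (.const 0) (.const 0) ;; copy 10 12 (.const 0) (.const 0) ;;
  .assign 17 (.reg 24) ;; select 11 ;; settle 11 ;;
  .assign 22 (.reg 15) ;; .assign 23 (.reg 14) ;; .assign 24 (.reg 13) ;;
  .store 12 (.reg 20) (.add (.read 12 (.reg 20)) (.const 1)) ;; settle 12

/-- Push a node on the stack. -/
def push (a : ℕ) : Cmd :=
  copy a 9 (.const 0) (.reg 19) ;; .assign 19 (.add (.reg 19) (.add (.reg 6) (.const 2)))

/-- Continue with two nodes. -/
def join : Cmd :=
  .ite (.and (.le (.const 0) (.reg 23)) (.and (.eq (.add (.reg 22) (.const 1)) (.reg 21))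
      (.eq (.add (.reg 15) (.const 1)) (.reg 21))))
    (.store 10 (.reg 23) (.add (.read 10 (.reg 23)) (.const 1)) ;; push 10 ;;
      .ite (.le (.read 11 (.const (-2))) (.read 12 (.const (-2))))
        (copy 11 10 (.const 0) (.const 0)) (copy 12 10 (.const 0) (.const 0)) ;;
      .assign 17 (.reg 24) ;; select 10)
    (push 11 ;; copy 12 10 (.const 0) (.const 0))

/-- Process the node in array `10`. -/
def process : Cmd :=
  settle 10 ;; .ite (.le (.reg 14) (.const (-1))) leaf (fork ;; join)

/-- The search for a solution; the stack is in array `9`. -/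
def search : Cmd := .while (.eq (.reg 18) (.const 1)) process

/-! ### Subroutines with their frames, and the fork -/

variable {Γ : StabData}

theorem run_select_keeps {a : ℕ} (ha : NodeArray a) {s : State} (hs : Γ.Ctx s) :
    Run (select a) s fun t s' => t ≤ 60 * (Γ.h + 1) ∧ Γ.Ctx s' ∧
      Γ.Sel (s.arr a) (s.reg 17) (s'.arr a) ∧ Keeps a s s' := by
  refine (run_select ha hs).frame fun t s' hr har h => ⟨h.1, h.2.1, h.2.2, ?_, ?_⟩
  · intro x hx; refine hr x ?_; simp [select, selectBody, Cmd.regs]; omega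
  · intro b hb; refine har b ?_; simp [select, selectBody, Cmd.arrs]; omega

theorem run_copy_keeps {a b : ℕ} (hab : a ≠ b) (hb : NodeArray b) {s : State}
    (hs : Γ.Ctx s) :
    Run (copy a b (.const 0) (.const 0)) s fun t s' => t ≤ 60 * (Γ.h + 1) ∧ Γ.Ctx s' ∧
      Γ.Agree (s.arr a) (s'.arr b) ∧ Keeps b s s' := by
  refine (run_copy (x := 0) (y := 0) hab hb hs (fun _ _ => rfl) (fun _ _ => rfl) le_rfl le_rfl).frame
    fun t s' hr har h => ⟨h.1, h.2.1, ?_, ?_, ?_⟩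
  · intro i h1 h2; simpa using h.2.2.1 i h1 h2
  · intro x hx; refine hr x ?_; simp [copy, Cmd.regs]; omega
  · intro c hc; refine har c ?_; simp [copy, Cmd.arrs]; omega

theorem run_settle_keeps (hΓ : Γ.Good) {a : ℕ} (ha : NodeArray a) {K k : ℕ}
    (hK : ∀ b, -1 ≤ b → b < Γ.d → 0 ≤ Γ.seg b ∧ Γ.seg b ≤ K) (hKk : K ≤ 4 * k + 1) (hk : Γ.h ≤ k)
    {s : State} (hs : Γ.Ctx s) (hν : Γ.Val (s.arr a)) :
    Run (settle a) s fun t s' => (t ≤ 2000 * (k + 1) ^ 2 ∧ Γ.Ctx s' ∧ Γ.Val (s'.arr a) ∧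
      Γ.Evo (s.arr a) (s'.arr a) ∧ (Γ.Feas (s.arr a) ↔ Γ.Feas (s'.arr a)) ∧
      Γ.Scan (s'.arr a) (s'.reg 13) (s'.reg 14) (s'.reg 16) ∧
      ¬ (s'.reg 16 ≤ s'.reg 13 ∧ s'.reg 16 < Γ.d) ∧ s'.reg 15 = Γ.excess (s'.arr a)) ∧
      Keeps a s s' := by
  refine (run_settle hΓ ha hK hKk hk hs hν).frame fun t s' hr har h => ⟨h, ?_, ?_⟩
  · intro x hx; refine hr x ?_
    simp [settle, select, selectBody, scan, scanBody, Cmd.regs]; omega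
  · intro b hb; refine har b ?_
    simp [settle, select, selectBody, scan, scanBody, Cmd.arrs]; omega

/-- The situation after `fork`. -/
structure Forked (Γ : StabData) (X A B : ℤ → ℤ) (x : ℕ) (q₂ qf fi qA q₂' xi' qB : ℤ) : Prop where
  left : ∃ A₀, Γ.Sel X q₂ A₀ ∧ Γ.Evo A₀ A ∧ (Γ.Feas A₀ ↔ Γ.Feas A)
  left_val : Γ.Val A
  left_scan : Γ.Scan A qf fi qA
  left_settled : ¬ (qA ≤ qf ∧ qA < Γ.d)
  right : ∃ B₀, Γ.Drop X x B₀ ∧ Γ.Evo B₀ B ∧ (Γ.Feas B₀ ↔ Γ.Feas B)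
  right_val : Γ.Val B
  right_scan : Γ.Scan B q₂' xi' qB
  right_settled : ¬ (qB ≤ q₂' ∧ qB < Γ.d)

/-- The subroutines write only registers from `11` to `17`, so what is saved in registers `20` to
`24` survives them. The node in array `10` stays intact, because `join` may have to derive a node
from it. -/
theorem run_fork (hΓ : Γ.Good) {K k : ℕ}
    (hK : ∀ b, -1 ≤ b → b < Γ.d → 0 ≤ Γ.seg b ∧ Γ.seg b ≤ K) (hKk : K ≤ 4 * k + 1) (hk : Γ.h ≤ k)
    {s : State} (hs : Γ.Ctx s) (hν : Γ.Val (s.arr 10)) (hm : Γ.Min (s.arr 10) (s.reg 13))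
    {x : ℕ} (hx : x < Γ.h) (hx14 : s.reg 14 = x) (hx2 : s.arr 10 x + 2 ≤ Γ.fin x) :
    Run fork s fun t s' => t ≤ 4500 * (k + 1) ^ 2 ∧ Γ.Ctx s' ∧
      (∃ qA, Γ.Forked (s.arr 10) (s'.arr 11) (s'.arr 12) x (s.reg 13) (s'.reg 24) (s'.reg 23) qA
        (s'.reg 13) (s'.reg 14) (s'.reg 16)) ∧
      s'.reg 21 = s.reg 15 ∧ s'.reg 22 = Γ.excess (s'.arr 11) ∧ s'.reg 15 = Γ.excess (s'.arr 12) ∧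
      s'.arr 9 = s.arr 9 ∧ s'.arr 10 = s.arr 10 ∧ s'.reg 0 = s.reg 0 ∧ s'.reg 18 = s.reg 18 ∧
      s'.reg 19 = s.reg 19 := by
  have h9 : ∀ {a}, 9 ≤ a → NodeArray a := fun h => h
  simp only [fork, run_seq, run_assign]
  refine (run_copy_keeps (by decide) (h9 (by decide)) (((hs.setReg (by decide : 7 ≤ 20) _).setReg
    (by decide : 7 ≤ 21) _).setReg (by decide : 7 ≤ 24) _)).mono ?_
  rintro t₁ s₁ ⟨ht₁, hC₁, hag₁, hr₁, ha₁⟩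
  refine (run_copy_keeps (by decide) (h9 (by decide)) hC₁).mono ?_
  rintro t₂ s₂ ⟨ht₂, hC₂, hag₂, hr₂, ha₂⟩
  refine (run_select_keeps (h9 (by decide)) (hC₂.setReg (by decide : 7 ≤ 17) _)).mono ?_
  rintro t₃ s₃ ⟨ht₃, hC₃, hsel₃, hr₃, ha₃⟩
  simp only [Expr.eval, reg_setReg, arr_setReg, Nat.reduceEqDiff, if_true, if_false] at *
  have hX₁ : s₁.arr 10 = s.arr 10 := ha₁ 10 (by decide)
  rw [ha₂ 11 (by decide), hr₂ 24 (by decide), hr₁ 24 (by decide)] at hsel₃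
  simp only [if_true] at hsel₃
  have hselX := hag₁.sel hsel₃
  have hv₃ := hselX.val hΓ hν hm.gt hm.lt
  refine (run_settle_keeps hΓ (h9 (by decide)) hK hKk hk hC₃ hv₃).mono ?_
  rintro t₄ s₄ ⟨⟨ht₄, hC₄, hv₄, hev₄, hf₄, hsc₄, hset₄, hex₄⟩, hr₄, ha₄⟩
  simp only [run_store, Expr.eval, reg_setReg, arr_setReg, Nat.reduceEqDiff, if_false]
  have h20 : s₄.reg 20 = x := by
    rw [hr₄ 20 (by decide), hr₃ 20 (by decide)]
    simp only [Nat.reduceEqDiff, if_false]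
    rw [hr₂ 20 (by decide), hr₁ 20 (by decide)]
    simpa using hx14
  have h21 : s₄.reg 21 = s.reg 15 := by
    rw [hr₄ 21 (by decide), hr₃ 21 (by decide)]
    simp only [Nat.reduceEqDiff, if_false]
    rw [hr₂ 21 (by decide), hr₁ 21 (by decide)]
    simp
  have harr : ∀ b, b ≠ 11 → b ≠ 12 → s₄.arr b = s.arr b := fun b h1 h2 => by
    rw [ha₄ b h1, ha₃ b h1, ha₂ b h2, ha₁ b h1]
  have hreg : ∀ z, z = 0 ∨ z = 18 ∨ z = 19 → s₄.reg z = s.reg z := fun z hz => by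
    have hz' : z = 0 ∨ 18 ≤ z := by omega
    rw [hr₄ z hz', hr₃ z hz', if_neg (by omega), hr₂ z hz', hr₁ z hz', if_neg (by omega),
      if_neg (by omega), if_neg (by omega)]
  rw [h20]
  have h12 : s₄.arr 12 = s₂.arr 12 := by rw [ha₄ 12 (by decide), ha₃ 12 (by decide)]
  have hagB : Γ.Agree (s.arr 10) (s₄.arr 12) := by rw [h12, ← hX₁]; exact hag₂
  have hdrop := hagB.drop hx (.of_update (Γ := Γ) (s₄.arr 12) x)
  have hC₅ := (((hC₄.setReg (by decide : 7 ≤ 22) (s₄.reg 15)).setReg (by decide : 7 ≤ 23)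
    (s₄.reg 14)).setReg (by decide : 7 ≤ 24) (s₄.reg 13)).setArr (h9 (by decide : 9 ≤ 12)) x
    (s₄.arr 12 x + 1)
  have hv₅ := hdrop.val hΓ hx hx2 hν
  refine (run_settle_keeps hΓ (h9 (by decide)) hK hKk hk hC₅ ?_).mono ?_
  · simp only [arr_setArr, arr_setReg, if_true]
    exact hv₅
  rintro t₅ s₅ ⟨⟨ht₅, hC₆, hv₆, hev₆, hf₆, hsc₆, hset₆, hex₆⟩, hr₆, ha₆⟩
  simp only [arr_setArr, arr_setReg, if_true, reg_setArr, reg_setReg] at hev₆ hf₆ hr₆ ha₆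
  have hA : s₅.arr 11 = s₄.arr 11 := by rw [ha₆ 11 (by decide), if_neg (by decide)]
  have h24 : s₅.reg 24 = s₄.reg 13 := by rw [hr₆ 24 (by decide)]; simp
  have h23 : s₅.reg 23 = s₄.reg 14 := by rw [hr₆ 23 (by decide)]; simp
  have h22 : s₅.reg 22 = s₄.reg 15 := by rw [hr₆ 22 (by decide)]; simp
  rw [hA, h24, h23, h22]
  refine ⟨?_, hC₆, ⟨s₄.reg 16, ⟨_, hselX, hev₄, hf₄⟩, hv₄, hsc₄, hset₄, ⟨_, hdrop, hev₆, hf₆⟩, hv₆,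
    hsc₆, hset₆⟩, ?_, hex₄, hex₆, ?_, ?_, ?_, ?_, ?_⟩
  · simp only [Expr.cost]
    nlinarith
  · rw [hr₆ 21 (by decide)]; simpa using h21
  · rw [ha₆ 9 (by decide), if_neg (by decide), harr 9 (by decide) (by decide)]
  · rw [ha₆ 10 (by decide), if_neg (by decide), harr 10 (by decide) (by decide)]
  · rw [hr₆ 0 (by decide)]; simpa using hreg 0 (by decide)
  · rw [hr₆ 18 (by decide)]; simpa using hreg 18 (by decide)
  · rw [hr₆ 19 (by decide)]; simpa using hreg 19 (by decide)

/-! #### The stack -/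

/-- The nodes in `ns` are stored below position `sp`, the first one on top. -/
def Stack (Γ : StabData) (stk : ℤ → ℤ) : ℤ → List (ℤ → ℤ) → Prop
  | sp, [] => sp = 0
  | sp, ν :: ns => (∀ i : ℤ, -2 ≤ i → i < Γ.h → stk (sp - (Γ.h + 2) + i) = ν i) ∧
      Stack Γ stk (sp - (Γ.h + 2)) ns

/-- Cells `-2` and `-1` of a node lie before its base address. So the top node ends at `sp - 3`, and
a push at `sp` writes from `sp - 2` on. -/
theorem Stack.congr {stk stk' : ℤ → ℤ} {ns : List (ℤ → ℤ)} : ∀ {sp : ℤ}, Γ.Stack stk sp ns →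
    (∀ i, i < sp - 2 → stk' i = stk i) → Γ.Stack stk' sp ns := by
  induction ns with
  | nil => intro sp h _; exact h
  | cons ν ns ih =>
    intro sp h hc
    refine ⟨fun i h1 h2 => ?_, ih h.2 fun i hi => hc i (by omega)⟩
    rw [hc _ (by omega)]; exact h.1 i h1 h2

/-- This justifies the test for an empty stack in `leaf`. -/
theorem Stack.nonneg {stk : ℤ → ℤ} {ns : List (ℤ → ℤ)} : ∀ {sp : ℤ}, Γ.Stack stk sp ns →
    0 ≤ sp ∧ (ns ≠ [] → 0 < sp) := by
  induction ns with
  | nil => intro sp h; exact ⟨le_of_eq (Eq.symm h), fun h => absurd rfl h⟩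
  | cons ν ns ih =>
    intro sp h
    have := (ih h.2).1
    exact ⟨by omega, fun _ => by omega⟩

theorem run_push {a : ℕ} (ha : a ≠ 9) {s : State} (hs : Γ.Ctx s) {ns : List (ℤ → ℤ)}
    (hst : Γ.Stack (s.arr 9) (s.reg 19) ns) :
    Run (push a) s fun t s' => t ≤ 70 * (Γ.h + 1) ∧ Γ.Ctx s' ∧
      Γ.Stack (s'.arr 9) (s'.reg 19) (s.arr a :: ns) ∧ (∀ b, b ≠ 9 → s'.arr b = s.arr b) ∧
      ∀ x, x ≠ 11 → x ≠ 19 → s'.reg x = s.reg x := by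
  simp only [push, run_seq, run_assign]
  refine (run_copy (e := .const 0) (f := .reg 19) (x := 0) (y := s.reg 19) ha (show 9 ≤ 9 from le_rfl) hs (fun _ _ => rfl)
    (fun s' h => h 19 (by decide)) le_rfl le_rfl).frame ?_
  rintro t s' hr har ⟨ht, hC, h1, h2⟩
  have hr' : ∀ x, x ≠ 11 → s'.reg x = s.reg x := fun x hx => hr x (by
    simp [copy, Cmd.regs]; exact hx)
  refine ⟨?_, hC.setReg (by decide) _, ⟨?_, ?_⟩, ?_, ?_⟩
  · simp only [Expr.cost]; omega
  · intro i hi hi'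
    simp only [reg_setReg, if_true, arr_setReg, Expr.eval, hC.reg6, hr' 19 (by decide)]
    have := h1 i hi hi'
    rw [zero_add] at this
    rw [← this]; congr 1; ring
  · simp only [reg_setReg, if_true, arr_setReg, Expr.eval, hC.reg6, hr' 19 (by decide)]
    rw [show s.reg 19 + (Γ.h + 2) - (Γ.h + 2) = s.reg 19 by ring]
    exact hst.congr fun i hi => h2 i (by omega)
  · intro b hb; rw [arr_setReg]; exact har b (by simp [copy, Cmd.arrs]; exact hb)
  · intro x hx hx'; rw [reg_setReg, if_neg hx']; exact hr' x hx

/-- The bound on the number of search nodes. -/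
def weight (m : ℕ) : ℕ := 2 * Nat.fib (m + 2) - 1

theorem weight_pos (m : ℕ) : 0 < weight m := by
  have : 0 < Nat.fib (m + 2) := Nat.fib_pos.2 (by omega)
  unfold weight; omega

theorem weight_mono {m n : ℕ} (h : m ≤ n) : weight m ≤ weight n := by
  have : Nat.fib (m + 2) ≤ Nat.fib (n + 2) := Nat.fib_mono (by omega)
  unfold weight; omega

/-- By the Fibonacci recurrence, `weight (n + 2)` is `weight (n + 1) + weight n + 1`; the additional
one pays for the node itself. -/
theorem weight_add_lt {a b m : ℕ} (ha : a + 1 ≤ m) (hb : b + 2 ≤ m) :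
    weight a + weight b < weight m := by
  obtain ⟨n, rfl⟩ : ∃ n, m = n + 2 := ⟨m - 2, by omega⟩
  have h1 := weight_mono (show a ≤ n + 1 by omega)
  have h2 := weight_mono (show b ≤ n by omega)
  have h3 := weight_pos n
  have h4 : Nat.fib (n + 2 + 2) = Nat.fib (n + 2) + Nat.fib (n + 1 + 2) := Nat.fib_add_two
  have h5 := weight_pos (n + 1)
  unfold weight at *
  omega

/-- The invariant of the search for the answer `P`. -/
structure SearchInv (Γ : StabData) (P : Prop) (ns : List (ℤ → ℤ)) (s : State) : Prop where
  ctx : Γ.Ctx s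
  reg0 : s.reg 0 = 0
  reg18 : s.reg 18 = 1
  val : Γ.Val (s.arr 10)
  stack : Γ.Stack (s.arr 9) (s.reg 19) ns
  vals : ∀ ν ∈ ns, Γ.Val ν
  iff : P ↔ Γ.Feas (s.arr 10) ∨ ∃ ν ∈ ns, Γ.Feas ν

/-- The number of search nodes that are left. -/
def load (Γ : StabData) (ns : List (ℤ → ℤ)) (s : State) : ℕ :=
  weight (Γ.excess (s.arr 10)) + (ns.map fun ν => weight (Γ.excess ν)).sum

/-- The search has ended with the correct answer. -/
def Answered (P : Prop) (s : State) : Prop :=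
  s.reg 18 = 0 ∧ (P → s.reg 0 = 1) ∧ (¬ P → s.reg 0 = 0)

/-- A node with nothing left to stab is decided by its number of points. If it fails, the answer
rests with the stack, and replacing the node by the top of the stack discards a positive weight. -/
theorem run_leaf {P : Prop} {ns : List (ℤ → ℤ)} {s : State} (hs : Γ.SearchInv P ns s)
    (hf : Γ.Feas (s.arr 10) ↔ s.arr 10 (-2) ≤ Γ.N) :
    Run leaf s fun t s' => t ≤ 100 * (Γ.h + 1) ∧
      ((∃ ns', Γ.SearchInv P ns' s' ∧ Γ.load ns' s' < Γ.load ns s) ∨ Answered P s') := by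
  simp only [leaf, run_ite, run_seq, run_assign, Test.Holds, Expr.eval, hs.ctx.reg3, Test.cost,
    Expr.cost]
  refine ⟨fun h => ⟨by omega, .inr ⟨by simp, fun _ => by simp, fun h' => ?_⟩⟩,
    fun h => ⟨fun h19 => ⟨by omega, .inr ⟨by simp, ?_, ?_⟩⟩, fun h19 => ?_⟩⟩
  · exact absurd (hs.iff.2 (.inl (hf.2 h))) h'
  · intro hP
    rcases hs.iff.1 hP with h' | ⟨ν, hν, -⟩
    · exact absurd (hf.1 h') h
    · have := hs.stack.nonneg.2 (List.ne_nil_of_mem hν)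
      omega
  · intro _; simpa using hs.reg0
  · obtain _ | ⟨ν, ns⟩ := ns
    · have := hs.stack
      exact absurd (le_of_eq this) h19
    · obtain ⟨h1, h2⟩ := hs.stack
      refine (run_copy (x := s.reg 19 - (Γ.h + 2)) (y := 0) (by decide) (show 9 ≤ 10 by decide)
        (hs.ctx.setReg (by decide : 7 ≤ 19) _)
        (fun s' h => by rw [Expr.eval, h 19 (by decide), reg_setReg, if_pos rfl]; simp [hs.ctx.reg6])
        (fun _ _ => rfl) le_rfl le_rfl).frame ?_
      rintro t s' hr har ⟨ht, hC, h3, -⟩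
      have hr' : ∀ x, x ≠ 11 → x ≠ 19 → s'.reg x = s.reg x := fun x hx hx' => by
        rw [hr x (by simp [copy, Cmd.regs]; exact hx), reg_setReg, if_neg hx']
      have h19' : s'.reg 19 = s.reg 19 - (Γ.h + 2) := by
        rw [hr 19 (by simp [copy, Cmd.regs]), reg_setReg, if_pos rfl]; simp [hs.ctx.reg6]
      have h9 : s'.arr 9 = s.arr 9 := har 9 (by simp [copy, Cmd.arrs])
      have hag : Γ.Agree ν (s'.arr 10) := by
        intro i hi hi'
        have := h3 i hi hi'
        rw [zero_add] at this
        rw [this, ← h1 i hi hi']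
        rfl
      refine ⟨by omega, .inl ⟨ns, ⟨hC, ?_, ?_, ?_, ?_, ?_, ?_⟩, ?_⟩⟩
      · rw [hr' 0 (by decide) (by decide), hs.reg0]
      · rw [hr' 18 (by decide) (by decide), hs.reg18]
      · exact hag.val (hs.vals ν (by simp))
      · rw [h9, h19']; exact h2
      · exact fun μ hμ => hs.vals μ (by simp [hμ])
      · rw [hs.iff, hf, ← hag.feas_iff]
        simp [h]
      · unfold load
        rw [hag.excess, List.map_cons, List.sum_cons]
        have := weight_pos (Γ.excess (s.arr 10))
        omega

/-- If the test succeeds, `feas_iff_of_tight` replaces both alternatives by nodes that lose one and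
two units of excess. If it fails, the alternatives themselves fit the weight. -/
theorem run_join (hΓ : Γ.Good) {P : Prop} {ns : List (ℤ → ℤ)} {s : State}
    (hs : Γ.SearchInv P ns s) {x : ℕ} {q₂ qA : ℤ} (hx : x < Γ.h)
    (hx2 : s.arr 10 x + 2 ≤ Γ.fin x) (hq₂ : q₂ = Γ.R (s.arr 10 x)) (hm : Γ.Min (s.arr 10) q₂)
    (hfork : Γ.Forked (s.arr 10) (s.arr 11) (s.arr 12) x q₂ (s.reg 24) (s.reg 23) qA
      (s.reg 13) (s.reg 14) (s.reg 16))
    (h21 : s.reg 21 = Γ.excess (s.arr 10)) (h22 : s.reg 22 = Γ.excess (s.arr 11))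
    (h15 : s.reg 15 = Γ.excess (s.arr 12)) :
    Run join s fun t s' => t ≤ 300 * (Γ.h + 1) ∧
      ∃ ns', Γ.SearchInv P ns' s' ∧ Γ.load ns' s' < Γ.load ns s := by
  have h9 : ∀ {a}, 9 ≤ a → NodeArray a := fun h => h
  obtain ⟨A₀, hA₀, hA, hAf⟩ := hfork.left
  obtain ⟨B₀, hB₀, hB, hBf⟩ := hfork.right
  have hiv := hΓ.iv_ok x hx _ (hs.val.root_le x hx) (by omega)
  simp only [join, run_ite, run_seq, run_assign, run_store, Test.Holds, Expr.eval, Test.cost, Expr.cost]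
  refine ⟨?_, ?_⟩
  · rintro ⟨h23, hAe, hBe⟩
    obtain ⟨f, hf⟩ := Int.eq_ofNat_of_zero_le h23
    have hscA := hfork.left_scan
    rw [hf] at hscA ⊢
    obtain ⟨hfh, hf2⟩ : f < Γ.h ∧ s.arr 11 f + 2 ≤ Γ.fin f := by
      rcases hscA.first with ⟨h, -⟩ | ⟨v, hv, h, h', -⟩
      · omega
      · rw [Nat.cast_inj] at h; subst h; exact ⟨hv, h'⟩
    have hX' := Drop.of_update (Γ := Γ) (s.arr 10) f
    refine (run_push (ns := ns) (by decide) (hs.ctx.setArr (h9 (by decide : 9 ≤ 10)) _ _) (by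
      simpa using hs.stack)).mono ?_
    rintro t₁ s₁ ⟨ht₁, hC₁, hst₁, ha₁, hr₁⟩
    simp only [arr_setArr, reg_setArr, if_true] at hst₁ ha₁ hr₁
    have h11₁ : s₁.arr 11 = s.arr 11 := by rw [ha₁ 11 (by decide), if_neg (by decide)]
    have h12₁ : s₁.arr 12 = s.arr 12 := by rw [ha₁ 12 (by decide), if_neg (by decide)]
    rw [h11₁, h12₁]
    -- the common end of the two cases
    have hfin : ∀ (E : ℤ → ℤ) (t : ℕ) (s₂ : State),
        (s.arr 11 (-2) ≤ s.arr 12 (-2) → E = s.arr 11) →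
        (¬ s.arr 11 (-2) ≤ s.arr 12 (-2) → E = s.arr 12) → t ≤ 60 * (Γ.h + 1) → Γ.Ctx s₂ →
        Γ.Agree E (s₂.arr 10) → Keeps 10 s₁ s₂ →
        Run (select 10) (s₂.setReg 17 (s₂.reg 24)) fun t' s' => t' ≤ 60 * (Γ.h + 1) ∧
          ∃ ns', Γ.SearchInv P ns' s' ∧ Γ.load ns' s' < Γ.load ns s := by
      intro E t s₂ hE₁ hE₂ _ hC₂ hag ⟨hr₂, ha₂⟩
      refine (run_select_keeps (h9 (by decide)) (hC₂.setReg (by decide : 7 ≤ 17) _)).mono ?_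
      rintro t₃ s₃ ⟨ht₃, hC₃, hsel, hr₃, ha₃⟩
      simp only [arr_setReg, reg_setReg, if_true] at hsel hr₃ ha₃
      rw [hr₂ 24 (by decide), hr₁ 24 (by decide) (by decide)] at hsel
      replace hsel := hag.sel hsel
      obtain ⟨hiff, hXv, hCv, hXe, hCe⟩ := feas_iff_of_tight hΓ hs.val hm hx hx2 hq₂ hA₀ hA hAf
        hfork.left_val hB₀ hB hBf hfork.right_val hscA hfork.left_settled hfork.right_scan
        hfork.right_settled (by omega) (by omega) hX' (C := s₃.arr 10)
        (fun h => hE₁ h ▸ hsel) (fun h => hE₂ h ▸ hsel)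
      have h9₃ : s₃.arr 9 = s₁.arr 9 := by rw [ha₃ 9 (by decide), ha₂ 9 (by decide)]
      have hr : ∀ z, z = 0 ∨ z = 18 ∨ z = 19 → s₃.reg z = s₁.reg z := fun z hz => by
        have hz' : z = 0 ∨ 18 ≤ z := by omega
        rw [hr₃ z hz', if_neg (by omega), hr₂ z hz']
      refine ⟨ht₃, Function.update (s.arr 10) (f : ℤ) (s.arr 10 f + 1) :: ns, ⟨hC₃, ?_, ?_, hCv, ?_, ?_, ?_⟩, ?_⟩
      · rw [hr 0 (by decide), hr₁ 0 (by decide) (by decide), hs.reg0]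
      · rw [hr 18 (by decide), hr₁ 18 (by decide) (by decide), hs.reg18]
      · rw [h9₃, hr 19 (by decide)]; exact hst₁
      · intro ν hν
        rcases List.mem_cons.1 hν with rfl | hν
        exacts [hXv, hs.vals ν hν]
      · rw [hs.iff, hiff, or_assoc, or_left_comm]
        simp only [List.mem_cons, exists_eq_or_imp]
      · have := weight_add_lt hXe hCe
        unfold load
        rw [List.map_cons, List.sum_cons]
        omega
    refine ⟨fun h => ?_, fun h => ?_⟩
    · refine (run_copy_keeps (by decide) (h9 (by decide)) hC₁).mono ?_
      rintro t₂ s₂ ⟨ht₂, hC₂, hag₂, hk₂⟩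
      rw [h11₁] at hag₂
      refine (hfin _ t₂ s₂ (fun _ => rfl) (fun h' => absurd h h') ht₂ hC₂ hag₂ hk₂).mono ?_
      exact fun t₃ s₃ h => ⟨by omega, h.2⟩
    · refine (run_copy_keeps (by decide) (h9 (by decide)) hC₁).mono ?_
      rintro t₂ s₂ ⟨ht₂, hC₂, hag₂, hk₂⟩
      rw [h12₁] at hag₂
      refine (hfin _ t₂ s₂ (fun h' => absurd h' h) (fun _ => rfl) ht₂ hC₂ hag₂ hk₂).mono ?_
      exact fun t₃ s₃ h => ⟨by omega, h.2⟩
  · intro htest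
    have hAe : Γ.excess (s.arr 11) + 1 ≤ Γ.excess (s.arr 10) := by
      have h1 := (hA₀.evo hΓ hs.val hm).excess_lt hx hx2 (hA₀.hit x hx (by omega) (by omega))
      have := hA.excess_le
      omega
    have hBe : Γ.excess (s.arr 12) + 1 ≤ Γ.excess (s.arr 10) := by
      have h1 := hB₀.excess_lt hx hx2
      have := hB.excess_le
      omega
    have hlt : weight (Γ.excess (s.arr 11)) + weight (Γ.excess (s.arr 12)) <
        weight (Γ.excess (s.arr 10)) := by
      by_cases h1 : Γ.excess (s.arr 11) + 2 ≤ Γ.excess (s.arr 10)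
      · rw [add_comm]; exact weight_add_lt hBe h1
      by_cases h2 : Γ.excess (s.arr 12) + 2 ≤ Γ.excess (s.arr 10)
      · exact weight_add_lt hAe h2
      -- Both alternatives lose exactly one unit, so the test failed because no list with several
      -- intervals is left in array `11`. Then the excesses are 1 before and 0 after, and the
      -- weights are 3 and 1 + 1.
      have h3 : ¬ 0 ≤ s.reg 23 := fun h => htest ⟨h, by omega, by omega⟩
      have h4 : Γ.excess (s.arr 11) = 0 := by
        refine Finset.sum_eq_zero fun v hv => ?_
        rcases hfork.left_scan.first with ⟨-, -, h⟩ | ⟨v, -, h, -⟩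
        · have := h v (Finset.mem_range.1 hv); omega
        · omega
      have h5 : Γ.excess (s.arr 12) = 0 := by omega
      have h6 : Γ.excess (s.arr 10) = 1 := by omega
      rw [h4, h5, h6]; decide
    have hsplit := hA₀.feas_iff_or hΓ hs.val hm hx hx2 hq₂ hB₀
    refine (run_push (ns := ns) (by decide) hs.ctx hs.stack).mono ?_
    rintro t₁ s₁ ⟨ht₁, hC₁, hst₁, ha₁, hr₁⟩
    refine (run_copy_keeps (by decide) (h9 (by decide)) hC₁).mono ?_
    rintro t₂ s₂ ⟨ht₂, hC₂, hag₂, hr₂, ha₂⟩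
    rw [ha₁ 12 (by decide)] at hag₂
    refine ⟨by omega, s.arr 11 :: ns, ⟨hC₂, ?_, ?_, hag₂.val hfork.right_val, ?_, ?_, ?_⟩, ?_⟩
    · rw [hr₂ 0 (by decide), hr₁ 0 (by decide) (by decide), hs.reg0]
    · rw [hr₂ 18 (by decide), hr₁ 18 (by decide) (by decide), hs.reg18]
    · rw [ha₂ 9 (by decide), hr₂ 19 (by decide)]; exact hst₁
    · intro ν hν
      rcases List.mem_cons.1 hν with rfl | hν
      exacts [hfork.left_val, hs.vals ν hν]
    · rw [hs.iff, hsplit, hAf, hBf, ← hag₂.feas_iff, or_assoc, or_left_comm]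
      simp only [List.mem_cons, exists_eq_or_imp]
    · unfold load
      rw [List.map_cons, List.sum_cons, hag₂.excess]
      omega

theorem run_process (hΓ : Γ.Good) {K k : ℕ}
    (hK : ∀ b, -1 ≤ b → b < Γ.d → 0 ≤ Γ.seg b ∧ Γ.seg b ≤ K) (hKk : K ≤ 4 * k + 1) (hk : Γ.h ≤ k)
    {P : Prop} {ns : List (ℤ → ℤ)} {s : State} (hs : Γ.SearchInv P ns s) :
    Run process s fun t s' => t ≤ 7000 * (k + 1) ^ 2 ∧
      ((∃ ns', Γ.SearchInv P ns' s' ∧ Γ.load ns' s' < Γ.load ns s) ∨ Answered P s') := by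
  simp only [process, run_seq, run_ite, Test.Holds, Expr.eval, Test.cost, Expr.cost]
  refine (run_settle_keeps hΓ (show 9 ≤ 10 by decide) hK hKk hk hs.ctx hs.val).mono ?_
  rintro t₁ s₁ ⟨⟨ht₁, hC₁, hv₁, hev₁, hf₁, hsc₁, hset₁, hex₁⟩, hr₁, ha₁⟩
  have hs₁ : Γ.SearchInv P ns s₁ := by
    refine ⟨hC₁, ?_, ?_, hv₁, ?_, hs.vals, ?_⟩
    · rw [hr₁ 0 (by decide), hs.reg0]
    · rw [hr₁ 18 (by decide), hs.reg18]
    · rw [ha₁ 9 (by decide), hr₁ 19 (by decide)]; exact hs.stack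
    · rw [hs.iff, hf₁]
  have hload : Γ.load ns s₁ ≤ Γ.load ns s := by
    have := weight_mono hev₁.excess_le
    unfold load
    omega
  refine ⟨fun h14 => ?_, fun h14 => ?_⟩
  · refine (run_leaf hs₁ (hsc₁.feas_iff hΓ hv₁ hset₁ h14)).mono ?_
    rintro t s' ⟨ht, h⟩
    refine ⟨by nlinarith, ?_⟩
    rcases h with ⟨ns', h, h'⟩ | h
    · exact .inl ⟨ns', h, by omega⟩
    · exact .inr h
  · obtain ⟨x, hx, hx14, hx2, hq₂⟩ : ∃ x : ℕ, x < Γ.h ∧ s₁.reg 14 = x ∧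
        s₁.arr 10 x + 2 ≤ Γ.fin x ∧ s₁.reg 13 = Γ.R (s₁.arr 10 x) := by
      rcases hsc₁.first with ⟨h, -⟩ | h
      · omega
      · exact h
    have hm := hsc₁.min_of_settled hΓ hv₁ hset₁ hx hx2 hq₂
    refine (run_fork hΓ hK hKk hk hC₁ hv₁ hm hx hx14 hx2).mono ?_
    rintro t₂ s₂ ⟨ht₂, hC₂, ⟨qA, hfork⟩, h21, h22, h15, h9, h10, hr0, hr18, hr19⟩
    have hs₂ : Γ.SearchInv P ns s₂ := by
      refine ⟨hC₂, ?_, ?_, ?_, ?_, hs.vals, ?_⟩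
      · rw [hr0, hs₁.reg0]
      · rw [hr18, hs₁.reg18]
      · rw [h10]; exact hv₁
      · rw [h9, hr19]; exact hs₁.stack
      · rw [h10]; exact hs₁.iff
    rw [← h10] at hfork hm hq₂ hx2 hex₁
    refine (run_join hΓ hs₂ hx hx2 hq₂ hm hfork (by rw [h21, hex₁]) h22 h15).mono ?_
    rintro t s' ⟨ht, ns', h, h'⟩
    refine ⟨by nlinarith, .inl ⟨ns', h, h'.trans_le ?_⟩⟩
    unfold load at hload ⊢
    rw [h10]; exact hload

theorem run_search (hΓ : Γ.Good) {K k : ℕ}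
    (hK : ∀ b, -1 ≤ b → b < Γ.d → 0 ≤ Γ.seg b ∧ Γ.seg b ≤ K) (hKk : K ≤ 4 * k + 1) (hk : Γ.h ≤ k)
    {P : Prop} {s : State} (hs : Γ.SearchInv P [] s) :
    Run search s fun t s' => t ≤ 7010 * (k + 1) ^ 2 * (weight (Γ.excess (s.arr 10)) + 1) ∧
      (P → s'.reg 0 = 1) ∧ (¬ P → s'.reg 0 = 0) := by
  refine (run_while (T := 7000 * (k + 1) ^ 2) (n := Γ.load [] s) (fun n s' =>
    (∃ ns, Γ.SearchInv P ns s' ∧ n = Γ.load ns s') ∨ Answered P s') ?_ (.inl ⟨[], hs, rfl⟩)).mono ?_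
  · rintro n s' (⟨ns, h, rfl⟩ | h) hb
    · refine (run_process hΓ hK hKk hk h).mono ?_
      rintro t s'' ⟨ht, h⟩
      refine ⟨ht, ?_⟩
      rcases h with ⟨ns', h, h'⟩ | h'
      · exact ⟨_, h', .inl ⟨ns', h, rfl⟩⟩
      -- An answered state needs no further iteration, and `0` is smaller than any load.
      · refine ⟨0, ?_, .inr h'⟩
        unfold load
        have := weight_pos (Γ.excess (s'.arr 10))
        omega
    · simp only [Test.Holds, Expr.eval] at hb
      have := h.1
      omega
  · rintro t s' ⟨ht, ⟨n, h⟩, hb⟩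
    simp only [Test.Holds, Expr.eval] at hb
    rcases h with ⟨ns, h, -⟩ | h
    · exact absurd h.reg18 hb
    · refine ⟨?_, h.2⟩
      have : Γ.load [] s = weight (Γ.excess (s.arr 10)) := by simp [load]
      rw [this] at ht
      simp only [Test.cost, Expr.cost] at ht
      generalize weight (Γ.excess (s.arr 10)) = W at *
      have h1 : 1 ≤ (k + 1) ^ 2 := Nat.one_le_pow _ _ (by omega)
      generalize (k + 1) ^ 2 = Y at *
      nlinarith

end StabData

/-! ### Reading the input and filling the tables -/

namespace StabData

open RAM

/-- The list `w` stands in `f`, starting with position `p`. -/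
def Reads (f : ℤ → ℤ) : ℤ → List ℤ → Prop
  | _, [] => True
  | p, x :: w => f p = x ∧ Reads f (p + 1) w

theorem Reads.append {f : ℤ → ℤ} {u w : List ℤ} : ∀ {p : ℤ}, Reads f p (u ++ w) →
    Reads f p u ∧ Reads f (p + u.length) w := by
  induction u with
  | nil => intro p h; exact ⟨trivial, by simpa using h⟩
  | cons x u ih =>
    intro p h
    obtain ⟨h1, h2⟩ := ih h.2
    refine ⟨⟨h.1, h1⟩, ?_⟩
    rw [List.length_cons]; push_cast
    rwa [show p + ((u.length : ℤ) + 1) = p + 1 + u.length by ring]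

/-- The prefix `u` only keeps track of the position, so that the induction on `w` goes through. -/
theorem reads_getD (w : List ℤ) : ∀ (u : List ℤ) (f : ℤ → ℤ),
    (∀ i : ℕ, f i = (u ++ w).getD i 0) → Reads f u.length w := by
  induction w with
  | nil => intro u f _; trivial
  | cons x w ih =>
    intro u f h
    refine ⟨by rw [h]; simp, ?_⟩
    have := ih (u ++ [x]) f (by intro i; rw [h]; simp)
    rw [List.length_append] at this
    exact_mod_cast this

theorem reads_init (w : List ℤ) : Reads ((State.init w).arr 0) 0 w := by
  refine reads_getD w [] _ fun i => ?_
  simp [State.init]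

/-- A list of intervals as part of the input. -/
def encodeIntervals (l : List (ℤ × ℤ)) : List ℤ := l.flatMap fun p => [p.1, p.2]

/-- Lists of intervals as part of the input. -/
def encodeLists (vs : List (List (ℤ × ℤ))) : List ℤ :=
  vs.flatMap fun l => (l.length : ℤ) :: encodeIntervals l

theorem length_encodeIntervals (l : List (ℤ × ℤ)) : (encodeIntervals l).length = 2 * l.length := by
  induction l with
  | nil => rfl
  | cons p l ih =>
    show (encodeIntervals l).length + 1 + 1 = _
    rw [ih, List.length_cons]; ring

theorem Reads.intervals {f : ℤ → ℤ} {l : List (ℤ × ℤ)} : ∀ {p : ℤ}, Reads f p (encodeIntervals l) →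
    ∀ (i : ℕ) (hi : i < l.length), f (p + 2 * i) = (l[i]).1 ∧ f (p + 2 * i + 1) = (l[i]).2 := by
  induction l with
  | nil => intro p _ i hi; simp at hi
  | cons q l ih =>
    intro p h i hi
    obtain ⟨h1, h2, h3⟩ : f p = q.1 ∧ f (p + 1) = q.2 ∧ Reads f (p + 1 + 1) (encodeIntervals l) := h
    obtain _ | i := i
    · simpa using ⟨h1, h2⟩
    · have := ih h3 i (by simpa using hi)
      simp only [List.getElem_cons_succ]
      push_cast
      rwa [show p + 2 * ((i : ℤ) + 1) = p + 1 + 1 + 2 * i by ring]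

/-- One interval is moved to the arrays `1` and `2`. -/
def moveBody : Cmd :=
  .store 1 (.reg 7) (.read 0 (.reg 4)) ;; .store 2 (.reg 7) (.read 0 (.add (.reg 4) (.const 1))) ;;
  .assign 7 (.add (.reg 7) (.const 1)) ;; .assign 4 (.add (.reg 4) (.const 2)) ;;
  .assign 8 (.sub (.reg 8) (.const 1))

/-- Read the intervals of a variable. -/
def parseBody : Cmd :=
  .assign 8 (.read 0 (.reg 4)) ;; .assign 4 (.add (.reg 4) (.const 1)) ;;
  .ite (.le (.reg 8) (.const 1))
    (.ite (.le (.add (.read 4 (.read 0 (.reg 4))) (.reg 2)) (.read 0 (.add (.reg 4) (.const 1)))) .skip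
        (.store 4 (.read 0 (.reg 4)) (.sub (.read 0 (.add (.reg 4) (.const 1))) (.reg 2))) ;;
      .assign 4 (.add (.reg 4) (.const 2)))
    (.store 10 (.reg 6) (.reg 7) ;; .while (.le (.const 1) (.reg 8)) moveBody ;;
      .store 3 (.reg 6) (.reg 7) ;; .assign 6 (.add (.reg 6) (.const 1))) ;;
  .assign 5 (.add (.reg 5) (.const 1))

/-- Read the intervals of all variables. -/
def parse : Cmd := .while (.le (.add (.reg 5) (.const 1)) (.reg 1)) parseBody

/-- The list `l` of intervals stands in the tables. -/
def Matches (L R root fin : ℤ → ℤ) (l : List (ℤ × ℤ)) (v : ℕ) : Prop :=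
  fin v = root v + l.length ∧ ∀ (i : ℕ) (hi : i < l.length), L (root v + i) = (l[i]).1 ∧
    R (root v + i) = (l[i]).2

/-- The number of intervals in excess of one per list. -/
def listExcess (vs : List (List (ℤ × ℤ))) : ℕ := (vs.map fun l => l.length - 1).sum

/-- Lists of intervals in the range from `0` to `d - 1`, each list sorted and not empty. -/
structure WF (d : ℤ) (vs : List (List (ℤ × ℤ))) : Prop where
  ne_nil : ∀ l ∈ vs, l ≠ []
  bounds : ∀ l ∈ vs, ∀ p ∈ l, 0 ≤ p.1 ∧ p.1 ≤ p.2 ∧ p.2 < d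
  sorted : ∀ l ∈ vs, l.Pairwise fun p q => p.2 < q.1

/-- The lists in `vs` have been read. -/
structure Parsed (d : ℤ) (vs : List (List (ℤ × ℤ))) (h J : ℕ) (L R root fin mn : ℤ → ℤ) : Prop where
  single_or : ∀ l ∈ vs, l.length = 1 ∨ ∃ v < h, Matches L R root fin l v
  exists_matches : ∀ v < h, ∃ l ∈ vs, 0 ≤ root v ∧ fin v ≤ J ∧ Matches L R root fin l v
  excess : ∑ v ∈ Finset.range h, (fin v - root v - 1).toNat = listExcess vs
  h_le : h ≤ listExcess vs
  J_le : J ≤ 2 * listExcess vs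
  bounds : ∀ j : ℕ, j < J → 0 ≤ L j ∧ L j ≤ R j ∧ R j < d
  mn_le : ∀ p, [p] ∈ vs → mn p.1 ≤ p.2 - d
  mn_mem : ∀ i, mn i < 0 → ∃ p, [p] ∈ vs ∧ p.1 = i ∧ mn i = p.2 - d
  mn_nonpos : ∀ i, mn i ≤ 0
  neg_one : root (-1) = 0
  neg_two : root (-2) = 0

variable {d : ℤ} {vs : List (List (ℤ × ℤ))} {h J : ℕ} {L R root fin mn : ℤ → ℤ}

theorem listExcess_append (us : List (List (ℤ × ℤ))) (l : List (ℤ × ℤ)) :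
    listExcess (us ++ [l]) = listExcess us + (l.length - 1) := by
  simp [listExcess]

/-- Cells are initially `0`. Ends are stored minus `d`, hence as negative numbers, so that `0` means
that no single interval starts at this position. -/
theorem Parsed.one (hp : Parsed d vs h J L R root fin mn) (p : ℤ × ℤ) {mn' : ℤ → ℤ} (hpd : p.2 < d)
    (hmn : (mn p.1 + d ≤ p.2 ∧ mn' = mn) ∨
      (¬ mn p.1 + d ≤ p.2 ∧ mn' = Function.update mn p.1 (p.2 - d))) :
    Parsed d (vs ++ [[p]]) h J L R root fin mn' := by
  have he : listExcess (vs ++ [[p]]) = listExcess vs := by simp [listExcess]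
  refine ⟨?_, ?_, by rw [he]; exact hp.excess, by rw [he]; exact hp.h_le, by rw [he]; exact hp.J_le,
    hp.bounds, ?_, ?_, ?_, hp.neg_one, hp.neg_two⟩
  · intro l hl
    rcases List.mem_append.1 hl with hl | hl
    · exact hp.single_or l hl
    · rw [List.mem_singleton.1 hl]; exact .inl rfl
  · intro v hv
    obtain ⟨l, hl, hl'⟩ := hp.exists_matches v hv
    exact ⟨l, List.mem_append_left _ hl, hl'⟩
  · intro q hq
    have hq' : [q] ∈ vs ∨ q = p := by
      rcases List.mem_append.1 hq with hq | hq
      · exact .inl hq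
      · right; simpa using hq
    rcases hmn with ⟨h1, rfl⟩ | ⟨h1, rfl⟩
    · rcases hq' with hq' | rfl
      · exact hp.mn_le q hq'
      · omega
    · by_cases h2 : q.1 = p.1
      · rw [h2, Function.update_self]
        rcases hq' with hq' | rfl
        · have := hp.mn_le q hq'; rw [h2] at this; omega
        · exact le_rfl
      · rw [Function.update_of_ne h2]
        rcases hq' with hq' | rfl
        · exact hp.mn_le q hq'
        · exact absurd rfl h2
  · intro i hi
    rcases hmn with ⟨h1, rfl⟩ | ⟨h1, rfl⟩
    · obtain ⟨q, hq, hq'⟩ := hp.mn_mem i hi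
      exact ⟨q, List.mem_append_left _ hq, hq'⟩
    · by_cases h2 : i = p.1
      · subst h2; exact ⟨p, by simp, rfl, Function.update_self _ _ _⟩
      · rw [Function.update_of_ne h2] at hi ⊢
        obtain ⟨q, hq, hq'⟩ := hp.mn_mem i hi
        exact ⟨q, List.mem_append_left _ hq, hq'⟩
  · intro i
    rcases hmn with ⟨h1, rfl⟩ | ⟨h1, rfl⟩
    · exact hp.mn_nonpos i
    · by_cases h2 : i = p.1
      · subst h2; rw [Function.update_self]; omega
      · rw [Function.update_of_ne h2]; exact hp.mn_nonpos i

/-- Since `2 ≤ l.length`, the excess grows by at least 1 and by at least half of `l.length`. This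
keeps the number of lists below the excess and the number of their intervals below twice the excess.
-/
theorem Parsed.many (hp : Parsed d vs h J L R root fin mn) (l : List (ℤ × ℤ)) (hl : 2 ≤ l.length)
    (hb : ∀ p ∈ l, 0 ≤ p.1 ∧ p.1 ≤ p.2 ∧ p.2 < d) {L' R' : ℤ → ℤ}
    (hL : ∀ j : ℤ, j < J → L' j = L j ∧ R' j = R j)
    (hL' : ∀ (i : ℕ) (hi : i < l.length), L' (J + i) = (l[i]).1 ∧ R' (J + i) = (l[i]).2) :
    Parsed d (vs ++ [l]) (h + 1) (J + l.length) L' R' (Function.update root (h : ℤ) J)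
      (Function.update fin (h : ℤ) (J + l.length)) mn := by
  have hold : ∀ v : ℕ, v < h → Function.update root (h : ℤ) (J : ℤ) v = root v ∧
      Function.update fin (h : ℤ) ((J : ℤ) + l.length) v = fin v := fun v hv => by
    rw [Function.update_of_ne (by omega), Function.update_of_ne (by omega)]
    exact ⟨rfl, rfl⟩
  have hmat : ∀ l' ∈ vs, ∀ v : ℕ, v < h → fin v ≤ J → Matches L R root fin l' v →
      Matches L' R' (Function.update root (h : ℤ) J)
      (Function.update fin (h : ℤ) (J + l.length)) l' v := by
    intro l' _ v hv hfJ ⟨h1, h2⟩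
    unfold Matches
    rw [(hold v hv).1, (hold v hv).2]
    refine ⟨h1, fun i hi => ?_⟩
    obtain ⟨h3, h4⟩ := hL (root v + i) (by omega)
    rw [h3, h4]; exact h2 i hi
  have hnew : Matches L' R' (Function.update root (h : ℤ) J)
      (Function.update fin (h : ℤ) (J + l.length)) l h := by
    unfold Matches
    rw [Function.update_self, Function.update_self]
    exact ⟨rfl, hL'⟩
  refine ⟨?_, ?_, ?_, ?_, ?_, ?_, ?_, ?_, hp.mn_nonpos, ?_, ?_⟩
  · intro l' hl'
    rcases List.mem_append.1 hl' with hl' | hl'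
    · rcases hp.single_or l' hl' with h1 | ⟨v, hv, hv'⟩
      · exact .inl h1
      · right
        refine ⟨v, by omega, ?_⟩
        obtain ⟨l'', -, -, h1, -⟩ := hp.exists_matches v hv
        exact hmat l' hl' v hv h1 hv'
    · rw [List.mem_singleton.1 hl']; exact .inr ⟨h, by omega, hnew⟩
  · intro v hv
    rcases Nat.lt_succ_iff_lt_or_eq.1 hv with hv | rfl
    · obtain ⟨l', hl', h1, h2, h3⟩ := hp.exists_matches v hv
      refine ⟨l', List.mem_append_left _ hl', ?_, ?_, hmat l' hl' v hv h2 h3⟩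
      · rw [(hold v hv).1]; exact h1
      · rw [(hold v hv).2]; push_cast; omega
    · refine ⟨l, by simp, ?_, ?_, hnew⟩
      · rw [Function.update_self]; omega
      · rw [Function.update_self]; push_cast; omega
  · rw [Finset.sum_range_succ, listExcess_append, ← hp.excess, Function.update_self,
      Function.update_self]
    congr 1
    · refine Finset.sum_congr rfl fun v hv => ?_
      rw [(hold v (Finset.mem_range.1 hv)).1, (hold v (Finset.mem_range.1 hv)).2]
    · omega
  · rw [listExcess_append]; have := hp.h_le; omega
  · rw [listExcess_append]; have := hp.J_le; omega
  · intro j hj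
    by_cases h1 : j < J
    · obtain ⟨h3, h4⟩ := hL j (by omega)
      rw [h3, h4]; exact hp.bounds j h1
    · obtain ⟨i, rfl⟩ := Nat.exists_eq_add_of_le (not_lt.1 h1)
      obtain ⟨h3, h4⟩ := hL' i (by omega)
      push_cast
      rw [h3, h4]; exact hb _ (List.getElem_mem _)
  · intro p hpm
    rcases List.mem_append.1 hpm with hpm | hpm
    · exact hp.mn_le p hpm
    · rw [← List.mem_singleton.1 hpm] at hl; simp at hl
  · intro i hi
    obtain ⟨q, hq, hq'⟩ := hp.mn_mem i hi
    exact ⟨q, List.mem_append_left _ hq, hq'⟩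
  · rw [Function.update_of_ne (by omega)]; exact hp.neg_one
  · rw [Function.update_of_ne (by omega)]; exact hp.neg_two

/-- The total number of intervals. -/
def listLength (vs : List (List (ℤ × ℤ))) : ℕ := (vs.map List.length).sum

theorem run_move {s : State} {l : List (ℤ × ℤ)} {J : ℕ} (h7 : s.reg 7 = J)
    (h8 : s.reg 8 = l.length) (hr : Reads (s.arr 0) (s.reg 4) (encodeIntervals l)) :
    Run (.while (.le (.const 1) (.reg 8)) moveBody) s fun t s' => t ≤ 40 * l.length + 10 ∧
      s'.reg 7 = J + l.length ∧ s'.reg 4 = s.reg 4 + 2 * l.length ∧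
      (∀ j : ℤ, j < J → s'.arr 1 j = s.arr 1 j ∧ s'.arr 2 j = s.arr 2 j) ∧
      (∀ (i : ℕ) (hi : i < l.length), s'.arr 1 (J + i) = (l[i]).1 ∧ s'.arr 2 (J + i) = (l[i]).2) ∧
      (∀ z, z ≠ 4 → z ≠ 7 → z ≠ 8 → s'.reg z = s.reg z) ∧
      ∀ b, b ≠ 1 → b ≠ 2 → s'.arr b = s.arr b := by
  refine (run_while (T := 30) (n := l.length) (fun n s' => ∃ w : ℕ, n + w = l.length ∧ s'.reg 7 = J + w ∧
      s'.reg 4 = s.reg 4 + 2 * w ∧ s'.reg 8 = n ∧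
      (∀ j : ℤ, j < J → s'.arr 1 j = s.arr 1 j ∧ s'.arr 2 j = s.arr 2 j) ∧
      (∀ (i : ℕ) (hi : i < l.length), i < w → s'.arr 1 (J + i) = (l[i]).1 ∧ s'.arr 2 (J + i) = (l[i]).2) ∧
      s'.arr 0 = s.arr 0) ?_ ?_).frame ?_
  · rintro n s' ⟨w, hw, h7', h4', h8', h1, h2, h0⟩ hb
    simp only [Test.Holds, Expr.eval, h8'] at hb
    obtain ⟨e1, e2⟩ := hr.intervals w (by omega)
    simp only [moveBody, run_seq, run_assign, run_store, Expr.eval, Expr.cost, reg_setReg, reg_setArr,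
      arr_setReg, arr_setArr, Nat.reduceEqDiff, if_true, if_false, OfNat.zero_ne_ofNat, zero_ne_one, h7', h4', h8',
      h0, e1, e2]
    refine ⟨by omega, n - 1, by omega, w + 1, by omega, by push_cast; ring, by push_cast; ring,
      by omega, ?_, ?_, trivial⟩
    · intro j hj
      rw [Function.update_of_ne (by omega), Function.update_of_ne (by omega)]
      exact h1 j hj
    · intro i hi hiw
      rcases Nat.lt_succ_iff_lt_or_eq.1 hiw with hiw | rfl
      · rw [Function.update_of_ne (by omega), Function.update_of_ne (by omega)]
        exact h2 i hi hiw
      · rw [Function.update_self, Function.update_self]; exact ⟨rfl, rfl⟩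
  · exact ⟨0, by omega, by simpa using h7, by simp, h8, fun _ _ => ⟨rfl, rfl⟩,
      fun _ _ h => absurd h (Nat.not_lt_zero _), rfl⟩
  · rintro t s' hr' ha' ⟨ht, ⟨n, w, hw, h7', h4', h8', h1, h2, h0⟩, hb⟩
    simp only [Test.Holds, Expr.eval, h8'] at hb
    have : w = l.length := by omega
    subst this
    simp only [Test.cost, Expr.cost] at ht
    refine ⟨by omega, h7', h4', h1, fun i hi => h2 i hi hi, ?_, ?_⟩
    · intro z h4 h7 h8
      exact hr' z (by simp [Cmd.regs, moveBody]; omega)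
    · intro b h1 h2
      exact ha' b (by simp [Cmd.arrs, moveBody]; omega)

/-- The invariant of `parse`. -/
structure ParseInv (d : ℤ) (us : List (List (ℤ × ℤ))) (rest : List (List (ℤ × ℤ))) (s : State) : Prop where
  reads : Reads (s.arr 0) (s.reg 4) (encodeLists rest)
  reg1 : s.reg 1 = us.length + rest.length
  reg2 : s.reg 2 = d
  reg5 : s.reg 5 = us.length
  parsed : ∃ h J : ℕ, s.reg 6 = h ∧ s.reg 7 = J ∧
    Parsed d us h J (s.arr 1) (s.arr 2) (s.arr 10) (s.arr 3) (s.arr 4)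

theorem run_parseBody {us rest : List (List (ℤ × ℤ))} {l : List (ℤ × ℤ)} {s : State}
    (hs : ParseInv d us (l :: rest) s) (hne : l ≠ [])
    (hb : ∀ p ∈ l, 0 ≤ p.1 ∧ p.1 ≤ p.2 ∧ p.2 < d) :
    Run parseBody s fun t s' => t ≤ 100 * l.length ∧ ParseInv d (us ++ [l]) rest s' := by
  obtain ⟨hr, h1, h2, h5, h, J, h6, h7, hp⟩ := hs
  obtain ⟨hr1, hr2⟩ : s.arr 0 (s.reg 4) = l.length ∧
      Reads (s.arr 0) (s.reg 4 + 1) (encodeIntervals l ++ encodeLists rest) := hr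
  obtain ⟨hr3, hr4⟩ := hr2.append
  rw [length_encodeIntervals] at hr4
  have hpos := List.length_pos_of_ne_nil hne
  simp only [parseBody, run_seq, run_assign, run_ite, run_skip, run_store, Test.Holds, Expr.eval, Expr.cost, Test.cost,
    reg_setReg, reg_setArr, arr_setReg, Nat.reduceEqDiff, if_true, if_false, hr1]
  refine ⟨fun h8 => ?_, fun h8 => ?_⟩
  · obtain ⟨p, rfl⟩ := List.length_eq_one_iff.1 (show l.length = 1 by omega)
    obtain ⟨e1, e2, -⟩ : s.arr 0 (s.reg 4 + 1) = p.1 ∧ s.arr 0 (s.reg 4 + 1 + 1) = p.2 ∧ True := hr3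
    have hpd := (hb p (by simp)).2.2
    rw [e1, e2, h2]
    simp only [List.length_singleton] at *
    have hr5 : Reads (s.arr 0) (s.reg 4 + 1 + 2) (encodeLists rest) := by simpa using hr4
    refine ⟨fun h9 => ⟨by omega, ⟨?_, ?_, ?_, ?_, h, J, ?_, ?_, ?_⟩⟩,
      fun h9 => ⟨by omega, ⟨?_, ?_, ?_, ?_, h, J, ?_, ?_, ?_⟩⟩⟩
    · simpa using hr5
    · simp [h1]; ring
    · simpa using h2
    · simp [h5]
    · simpa using h6
    · simpa using h7
    · simpa using hp.one p hpd (.inl ⟨h9, rfl⟩)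
    · simpa using hr5
    · simp [h1]; ring
    · simpa using h2
    · simp [h5]
    · simpa using h6
    · simpa using h7
    · simpa using hp.one p hpd (.inr ⟨h9, rfl⟩)
  · refine (run_move (l := l) (J := J) ?_ ?_ ?_).mono ?_
    · simpa using h7
    · simp
    · simpa using hr3
    rintro t s' ⟨ht, h7', h4', hL, hL', hreg, harr⟩
    simp only [reg_setReg, reg_setArr, arr_setReg, arr_setArr, Nat.reduceEqDiff, if_true, if_false, OfNat.one_ne_ofNat] at *
    have h3 : s'.arr 3 = s.arr 3 := by simpa using harr 3 (by decide) (by decide)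
    have h4 : s'.arr 4 = s.arr 4 := by simpa using harr 4 (by decide) (by decide)
    have h0 : s'.arr 0 = s.arr 0 := by simpa using harr 0 (by decide) (by decide)
    have h10 : s'.arr 10 = Function.update (s.arr 10) (h : ℤ) J := by
      simpa [h6, h7] using harr 10 (by decide) (by decide)
    have hr6 : s'.reg 6 = h := by simpa [h6] using hreg 6 (by decide) (by decide) (by decide)
    have hr1' : s'.reg 1 = s.reg 1 := by simpa using hreg 1 (by decide) (by decide) (by decide)
    have hr2' : s'.reg 2 = s.reg 2 := by simpa using hreg 2 (by decide) (by decide) (by decide)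
    have hr5' : s'.reg 5 = s.reg 5 := by simpa using hreg 5 (by decide) (by decide) (by decide)
    have hl2 : 2 ≤ l.length := by omega
    refine ⟨by omega, ⟨?_, ?_, ?_, ?_, h + 1, J + l.length, ?_, ?_, ?_⟩⟩
    · simp [h0, h4']
      simpa using hr4
    · simp [hr1', h1]; ring
    · simp [hr2', h2]
    · simp [hr5', h5]
    · simp [hr6]
    · simp [h7']
    · simp [h10, h4, h3, hr6, h7']
      exact hp.many l hl2 hb hL hL'

/-- An iteration costs time proportional to the length of its list. A linear total therefore needs a
loop rule with a time budget rather than a uniform bound per iteration. -/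
theorem run_parse {vs : List (List (ℤ × ℤ))} (hvs : WF d vs) {s : State} (hs : ParseInv d [] vs s) :
    Run parse s fun t s' => t ≤ 200 * listLength vs + 10 ∧ ParseInv d vs [] s' := by
  refine (run_while_budget (fun n s' => ∃ us rest, vs = us ++ rest ∧ n = 200 * listLength rest ∧
    ParseInv d us rest s') ?_ (200 * listLength vs) s ⟨[], vs, rfl, rfl, hs⟩).mono ?_
  · rintro n s' ⟨us, rest, rfl, rfl, hI⟩ hb
    simp only [Test.Holds, Expr.eval, hI.reg1, hI.reg5] at hb
    obtain _ | ⟨l, rest⟩ := rest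
    · simp at hb
    · have hne := hvs.ne_nil l (by simp)
      have hpos := List.length_pos_of_ne_nil hne
      refine (run_parseBody hI hne (hvs.bounds l (by simp))).mono ?_
      rintro t s'' ⟨ht, hI'⟩
      refine ⟨200 * listLength rest, ?_, us ++ [l], rest, by simp, rfl, hI'⟩
      simp only [Test.cost, Expr.cost]
      have : listLength (l :: rest) = l.length + listLength rest := by simp [listLength]
      omega
  · rintro t s' ⟨ht, ⟨n, us, rest, rfl, -, hI⟩, hb⟩
    simp only [Test.Holds, Expr.eval, hI.reg1, hI.reg5] at hb
    obtain _ | ⟨l, rest⟩ := rest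
    · simp only [Test.cost, Expr.cost] at ht
      exact ⟨by omega, by simpa using hI⟩
    · simp at hb

end StabData

/-! ### Filling the tables -/

namespace StabData

open RAM

/-- Count the left ends of the intervals in the lists. -/
def mark : Cmd :=
  .store 5 (.const 0) (.const 1) ;; .assign 11 (.const 0) ;;
  .while (.le (.add (.reg 11) (.const 1)) (.reg 7))
    (.store 5 (.read 1 (.reg 11)) (.add (.read 5 (.read 1 (.reg 11))) (.const 1)) ;;
      .assign 11 (.add (.reg 11) (.const 1)))

/-- Sum up the numbers of left ends. -/
def accumulate : Cmd :=
  .assign 11 (.const 0) ;;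
  .while (.le (.add (.reg 11) (.const 1)) (.reg 2))
    (.store 5 (.reg 11) (.add (.read 5 (.reg 11)) (.read 5 (.sub (.reg 11) (.const 1)))) ;;
      .assign 11 (.add (.reg 11) (.const 1)))

/-- Compute the first end of an interval that starts at a given position or later. -/
def fillNx : Cmd :=
  .store 6 (.reg 2) (.reg 2) ;; .assign 11 (.reg 2) ;;
  .while (.le (.const 1) (.reg 11))
    (.assign 11 (.sub (.reg 11) (.const 1)) ;;
      .ite (.le (.add (.read 4 (.reg 11)) (.reg 2)) (.read 6 (.add (.reg 11) (.const 1))))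
        (.store 6 (.reg 11) (.add (.read 4 (.reg 11)) (.reg 2)))
        (.store 6 (.reg 11) (.read 6 (.add (.reg 11) (.const 1)))))

/-- Compute the greedy sequences inside the segments. -/
def fillEnt : Cmd :=
  .assign 11 (.reg 2) ;;
  .while (.le (.const 1) (.reg 11))
    (.assign 11 (.sub (.reg 11) (.const 1)) ;; .assign 12 (.read 6 (.add (.reg 11) (.const 1))) ;;
      .ite (.and (.le (.add (.reg 12) (.const 1)) (.reg 2))
          (.eq (.read 5 (.reg 12)) (.read 5 (.reg 11))))
        (.store 7 (.reg 11) (.read 7 (.reg 12)) ;;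
          .store 8 (.reg 11) (.add (.read 8 (.reg 12)) (.const 1)))
        (.store 7 (.reg 11) (.reg 11) ;; .store 8 (.reg 11) (.const 1)))

/-- The preparations for the search. -/
def prepare : Cmd :=
  .assign 1 (.read 0 (.const 0)) ;; .assign 2 (.read 0 (.const 1)) ;; .assign 3 (.read 0 (.const 2)) ;;
  .assign 4 (.const 3) ;; parse ;; mark ;; accumulate ;; fillNx ;; fillEnt ;;
  .store 10 (.const (-1)) (.const (-1)) ;; .assign 18 (.const 1)

/-- The whole program. -/
def program : Cmd := prepare ;; search

/-- The left ends of the first `j` intervals have been counted. -/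
structure Marked (m : ℕ) (L : ℤ → ℤ) (j : ℕ) (f : ℤ → ℤ) : Prop where
  zero : 1 ≤ f 0
  nonneg : ∀ i, 0 ≤ f i
  neg_one : f (-1) = 0
  left : ∀ i : ℕ, i < j → 1 ≤ f (L i)
  sum : ∑ i ∈ Finset.range (m + 1), f i = 1 + j

theorem sum_update_range {m : ℕ} {f : ℤ → ℤ} {x : ℤ} (h0 : 0 ≤ x) (hm : x ≤ m) :
    ∑ i ∈ Finset.range (m + 1), Function.update f x (f x + 1) (i : ℤ) =
      ∑ i ∈ Finset.range (m + 1), f i + 1 := by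
  lift x to ℕ using h0
  have : ∀ i : ℕ, Function.update f (x : ℤ) (f x + 1) (i : ℤ) = f i + if i = x then 1 else 0 := by
    intro i
    by_cases h : i = x
    · subst h; simp
    · rw [Function.update_of_ne (by omega), if_neg h, add_zero]
  simp only [this]
  rw [Finset.sum_add_distrib, Finset.sum_ite_eq', if_pos (Finset.mem_range.2 (by omega))]

theorem le_update (f : ℤ → ℤ) (x i : ℤ) : f i ≤ Function.update f x (f x + 1) i := by
  by_cases h : i = x
  · subst h; simp
  · rw [Function.update_of_ne h]

theorem Marked.step {m : ℕ} {L : ℤ → ℤ} {j : ℕ} {f : ℤ → ℤ} (h : Marked m L j f)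
    (h0 : 0 ≤ L j) (h1 : L j < m) :
    Marked m L (j + 1) (Function.update f (L j) (f (L j) + 1)) := by
  have hle := le_update f (L j)
  refine ⟨h.zero.trans (hle 0), fun i => (h.nonneg i).trans (hle i), ?_, ?_, ?_⟩
  · rw [Function.update_of_ne (by omega)]; exact h.neg_one
  · intro i hi
    rcases Nat.lt_succ_iff_lt_or_eq.1 hi with hi | rfl
    · exact (h.left i hi).trans (hle _)
    · rw [Function.update_self]
      have := h.nonneg (L i)
      omega
  · rw [sum_update_range h0 (by omega), h.sum]
    push_cast; ring

/-- The extra mark in cell `0` puts all positions into later segments than the initial last point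
`-1`. -/
theorem run_mark {m J : ℕ} {s : State} (h7 : s.reg 7 = J) (h5 : s.arr 5 = fun _ => 0)
    (hb : ∀ j : ℕ, j < J → 0 ≤ s.arr 1 j ∧ s.arr 1 j < m) :
    Run mark s fun t s' => t ≤ 60 * (J + 1) ∧ Marked m (s.arr 1) J (s'.arr 5) := by
  simp only [mark, run_seq, run_assign, run_store]
  refine (run_while (T := 40) (n := J) (fun n s' => ∃ w : ℕ, n + w = J ∧ s'.reg 11 = w ∧ s'.reg 7 = J ∧
    s'.arr 1 = s.arr 1 ∧ Marked m (s.arr 1) w (s'.arr 5)) ?_ ?_).mono ?_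
  · rintro n s' ⟨w, hw, h11, h7', h1, hM⟩ hlt
    simp only [Test.Holds, Expr.eval, h11, h7'] at hlt
    obtain ⟨hb1, hb2⟩ := hb w (by omega)
    simp only [run_seq, run_assign, run_store, Expr.eval, Expr.cost, reg_setReg, reg_setArr,
      arr_setReg, arr_setArr, Nat.reduceEqDiff, if_true, if_false, OfNat.one_ne_ofNat, h11, h7', h1]
    exact ⟨by omega, n - 1, by omega, w + 1, by omega, by push_cast; rfl, trivial, trivial,
      hM.step hb1 hb2⟩
  · refine ⟨0, by omega, by simp, by simpa using h7, by simp, ?_⟩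
    simp only [Expr.eval, arr_setReg, arr_setArr, if_true, h5]
    refine ⟨by simp, ?_, by simp, by simp, ?_⟩
    · intro i
      by_cases h : i = 0
      · subst h; simp
      · rw [Function.update_of_ne h]
    -- The sum ranges up to `m` inclusively, so that cell `0` is counted even when there are no
    -- positions.
    · rw [show (1 : ℤ) = (fun _ : ℤ => (0 : ℤ)) 0 + 1 by simp, sum_update_range le_rfl (by omega)]
      simp
  · rintro t s' ⟨ht, ⟨n, w, hw, h11, h7', h1, hM⟩, hlt⟩
    simp only [Test.Holds, Expr.eval, h11, h7'] at hlt
    have : w = J := by omega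
    subst this
    simp only [Test.cost, Expr.cost] at ht ⊢
    exact ⟨by omega, hM⟩

theorem run_accumulate {m : ℕ} {s : State} (h2 : s.reg 2 = m) (h5 : s.arr 5 (-1) = 0) :
    Run accumulate s fun t s' => t ≤ 40 * (m + 1) ∧ s'.arr 5 (-1) = 0 ∧
      ∀ i : ℕ, i < m → s'.arr 5 i = ∑ j ∈ Finset.range (i + 1), s.arr 5 j := by
  simp only [accumulate, run_seq, run_assign]
  refine (run_while (T := 30) (n := m) (fun n s' => ∃ w : ℕ, n + w = m ∧ s'.reg 11 = w ∧ s'.reg 2 = m ∧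
    s'.arr 5 (-1) = 0 ∧ (∀ i : ℕ, i < w → s'.arr 5 i = ∑ j ∈ Finset.range (i + 1), s.arr 5 j) ∧
    ∀ i : ℕ, w ≤ i → s'.arr 5 i = s.arr 5 i) ?_ ?_).mono ?_
  · rintro n s' ⟨w, hw, h11, h2', hn, h3, h4⟩ hlt
    simp only [Test.Holds, Expr.eval, h11, h2'] at hlt
    simp only [run_seq, run_assign, run_store, Expr.eval, Expr.cost, reg_setReg, reg_setArr,
      arr_setReg, arr_setArr, Nat.reduceEqDiff, if_true, if_false, h11, h2']
    refine ⟨by omega, n - 1, by omega, w + 1, by omega, by push_cast; rfl, trivial, ?_, ?_, ?_⟩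
    · rw [Function.update_of_ne (by omega)]; exact hn
    · intro i hi
      rcases Nat.lt_succ_iff_lt_or_eq.1 hi with hi | rfl
      · rw [Function.update_of_ne (by omega)]; exact h3 i hi
      · rw [Function.update_self, Finset.sum_range_succ, h4 i le_rfl, add_comm]
        congr 1
        -- For the first position the preceding cell is `-1`, which holds the empty sum `0`.
        obtain _ | i := i
        · simpa using hn
        · have := h3 i (by omega)
          push_cast
          rw [show (i : ℤ) + 1 - 1 = i by ring, this]
    · intro i hi
      rw [Function.update_of_ne (by omega)]; exact h4 i (by omega)
  · exact ⟨0, by omega, by simp, by simpa using h2, h5, fun i hi => absurd hi (Nat.not_lt_zero i),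
      fun i _ => rfl⟩
  · rintro t s' ⟨ht, ⟨n, w, hw, h11, h2', hn, h3, h4⟩, hlt⟩
    simp only [Test.Holds, Expr.eval, h11, h2'] at hlt
    have : w = m := by omega
    subst this
    simp only [Test.cost, Expr.cost] at ht ⊢
    exact ⟨by omega, hn, h3⟩

theorem run_fillNx {m : ℕ} {s : State} (h2 : s.reg 2 = m) :
    Run fillNx s fun t s' => t ≤ 40 * (m + 1) ∧ s'.arr 6 m = m ∧
      ∀ i : ℤ, 0 ≤ i → i < m → s'.arr 6 i = min (s'.arr 6 (i + 1)) (s.arr 4 i + m) := by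
  simp only [fillNx, run_seq, run_assign, run_store]
  refine (run_while (T := 30) (n := m) (fun n s' => s'.reg 11 = n ∧ s'.reg 2 = m ∧ n ≤ m ∧ s'.arr 4 = s.arr 4 ∧
    s'.arr 6 m = m ∧
    ∀ i : ℤ, n ≤ i → i < m → s'.arr 6 i = min (s'.arr 6 (i + 1)) (s.arr 4 i + m)) ?_ ?_).mono ?_
  · rintro n s' ⟨h11, h2', hn, h4, h6, hI⟩ hlt
    simp only [Test.Holds, Expr.eval, h11] at hlt
    simp only [run_seq, run_assign, run_store, run_ite, Test.Holds, Expr.eval, Expr.cost, Test.cost, reg_setReg, reg_setArr,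
      arr_setReg, arr_setArr, Nat.reduceEqDiff, if_true, if_false, h11, h2', h4]
    have key : ∀ y, y = min (s'.arr 6 (n - 1 + 1)) (s.arr 4 (n - 1) + m) →
        ∃ n' < n, (n : ℤ) - 1 = n' ∧ True ∧ n' ≤ m ∧ True ∧ Function.update (s'.arr 6) (n - 1 : ℤ) y m = m ∧
          ∀ i : ℤ, n' ≤ i → i < m → Function.update (s'.arr 6) (n - 1 : ℤ) y i =
            min (Function.update (s'.arr 6) (n - 1 : ℤ) y (i + 1)) (s.arr 4 i + m) := by
      intro y hy
      refine ⟨n - 1, by omega, by omega, trivial, by omega, trivial, ?_, ?_⟩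
      · rw [Function.update_of_ne (by omega)]; exact h6
      · intro i hi hi'
        rw [Function.update_of_ne (show i + 1 ≠ n - 1 by omega)]
        by_cases h : i = n - 1
        · subst h; rw [Function.update_self]; exact hy
        · rw [Function.update_of_ne h]; exact hI i (by omega) hi'
    exact ⟨fun h => ⟨by omega, key _ (by omega)⟩, fun h => ⟨by omega, key _ (by omega)⟩⟩
  · refine ⟨by simpa using h2, by simpa using h2, le_rfl, by simp, by simp [h2], fun i _ _ => by omega⟩
  · rintro t s' ⟨ht, ⟨n, h11, h2', hn, h4, h6, hI⟩, hlt⟩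
    simp only [Test.Holds, Expr.eval, h11] at hlt
    simp only [Test.cost, Expr.cost] at ht ⊢
    exact ⟨by omega, h6, fun i hi => hI i (by omega)⟩

/-- The tables are filled from right to left. By `hnx`, the entry for `q` refers to a position
beyond `q`, which is already final. -/
theorem run_fillEnt {m : ℕ} {s : State} (h2 : s.reg 2 = m)
    (hnx : ∀ i : ℤ, 0 ≤ i → i ≤ m → i ≤ s.arr 6 i) :
    Run fillEnt s fun t s' => t ≤ 60 * (m + 1) ∧
      ∀ q : ℤ, 0 ≤ q → q < m →
    (s.arr 6 (q + 1) < m ∧ s.arr 5 (s.arr 6 (q + 1)) = s.arr 5 q ∧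
      s'.arr 7 q = s'.arr 7 (s.arr 6 (q + 1)) ∧ s'.arr 8 q = s'.arr 8 (s.arr 6 (q + 1)) + 1) ∨
    (¬ (s.arr 6 (q + 1) < m ∧ s.arr 5 (s.arr 6 (q + 1)) = s.arr 5 q) ∧ s'.arr 7 q = q ∧
      s'.arr 8 q = 1) := by
  simp only [fillEnt, run_seq, run_assign]
  refine (run_while (T := 50) (n := m) (fun n s' => s'.reg 11 = n ∧ s'.reg 2 = m ∧ n ≤ m ∧
    s'.arr 5 = s.arr 5 ∧ s'.arr 6 = s.arr 6 ∧ ∀ q : ℤ, n ≤ q → q < m →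
    (s.arr 6 (q + 1) < m ∧ s.arr 5 (s.arr 6 (q + 1)) = s.arr 5 q ∧
      s'.arr 7 q = s'.arr 7 (s.arr 6 (q + 1)) ∧ s'.arr 8 q = s'.arr 8 (s.arr 6 (q + 1)) + 1) ∨
    (¬ (s.arr 6 (q + 1) < m ∧ s.arr 5 (s.arr 6 (q + 1)) = s.arr 5 q) ∧ s'.arr 7 q = q ∧
      s'.arr 8 q = 1)) ?_ ?_).mono ?_
  · rintro n s' ⟨h11, h2', hn, h5, h6, hI⟩ hlt
    simp only [Test.Holds, Expr.eval, h11] at hlt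
    simp only [run_seq, run_assign, run_store, run_ite, Test.Holds, Expr.eval, Expr.cost, Test.cost, reg_setReg, reg_setArr,
      arr_setReg, arr_setArr, Nat.reduceEqDiff, if_true, if_false, h11, h2', h5, h6]
    have hnn := hnx (n - 1 + 1) (by omega) (by omega)
    refine ⟨fun h => ⟨by omega, n - 1, by omega, by omega, trivial, by omega, trivial, trivial, ?_⟩,
      fun h => ⟨by omega, n - 1, by omega, by omega, trivial, by omega, trivial, trivial, ?_⟩⟩
    all_goals
      intro q hq hq'
      have hnq := hnx (q + 1) (by omega) (by omega)
      rw [Function.update_of_ne (show s.arr 6 (q + 1) ≠ n - 1 by omega),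
        Function.update_of_ne (show s.arr 6 (q + 1) ≠ n - 1 by omega)]
      by_cases hqn : q = n - 1
      · subst hqn
        rw [Function.update_self, Function.update_self]
        first
          | exact .inl ⟨by omega, h.2, rfl, rfl⟩
          | exact .inr ⟨fun h' => h ⟨by omega, h'.2⟩, rfl, rfl⟩
      · rw [Function.update_of_ne hqn, Function.update_of_ne hqn]
        exact hI q (by omega) hq'
  · exact ⟨by simpa using h2, by simpa using h2, le_rfl, rfl, rfl, fun i _ _ => by omega⟩
  · rintro t s' ⟨ht, ⟨n, h11, h2', hn, h5, h6, hI⟩, hlt⟩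
    simp only [Test.Holds, Expr.eval, h11] at hlt
    simp only [Test.cost, Expr.cost] at ht ⊢
    exact ⟨by omega, fun i hi => hI i (by omega)⟩

/-! #### Correctness of the tables -/

/-- Induction on the distance to `m`: a single interval that starts at `i` or later either starts at
`i`, where `mn i` knows the least end, or starts at `i + 1` or later. -/
theorem nx_spec {m : ℕ} {vs : List (List (ℤ × ℤ))} {h J : ℕ} {L R root fin mn nx : ℤ → ℤ}
    (hvs : WF m vs) (hp : Parsed m vs h J L R root fin mn) (hm : nx m = m)
    (hnx : ∀ i : ℤ, 0 ≤ i → i < m → nx i = min (nx (i + 1)) (mn i + m)) :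
    ∀ (e : ℕ) (i : ℤ), 0 ≤ i → i + e = m → i ≤ nx i ∧ nx i ≤ m ∧
      (∀ p, [p] ∈ vs → i ≤ p.1 → nx i ≤ p.2) ∧
      (nx i < m → ∃ p, [p] ∈ vs ∧ i ≤ p.1 ∧ p.2 = nx i) := by
  intro e
  induction e with
  | zero =>
    intro i h0 hi
    obtain rfl : i = m := by push_cast at hi; omega
    refine ⟨by omega, by omega, ?_, by omega⟩
    intro p hpm hle
    have := hvs.bounds _ hpm p (by simp)
    omega
  | succ e ih =>
    intro i h0 hi
    obtain ⟨h1, h2, h3, h4⟩ := ih (i + 1) (by omega) (by push_cast at hi; omega)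
    have hi' := hnx i h0 (by push_cast at hi; omega)
    have hn := hp.mn_nonpos i
    have hmem : mn i < 0 → ∃ p, [p] ∈ vs ∧ i ≤ p.1 ∧ p.2 = mn i + m ∧ p.1 ≤ p.2 := fun hlt => by
      obtain ⟨p, hp1, hp2, hp3⟩ := hp.mn_mem i hlt
      have := hvs.bounds _ hp1 p (by simp)
      exact ⟨p, hp1, by omega, by omega, by omega⟩
    refine ⟨?_, by omega, ?_, ?_⟩
    · by_cases hlt : mn i < 0
      · obtain ⟨p, -, hp2, hp3, hp4⟩ := hmem hlt
        omega
      · push_cast at hi; omega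
    · intro p hpm hle
      by_cases hpi : p.1 = i
      · have := hp.mn_le p hpm
        rw [hpi] at this
        omega
      · have := h3 p hpm (by omega)
        omega
    · intro hlt
      by_cases hc : nx (i + 1) ≤ mn i + m
      · obtain ⟨p, hp1, hp2, hp3⟩ := h4 (by omega)
        exact ⟨p, hp1, by clear h4 hmem; omega, by clear h4 hmem; omega⟩
      · obtain ⟨p, hp1, hp2, hp3, -⟩ := hmem (by omega)
        exact ⟨p, hp1, by clear h4 hmem; omega, by clear h4 hmem; omega⟩

/-- The difference of two prefix sums is a sum of nonnegative marks in which the mark at `x` occurs.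
Monotonicity of `seg` and its growth at `0` and at left ends are all instances. -/
theorem seg_add_le {m : ℕ} {f g : ℤ → ℤ} (hf : ∀ i, 0 ≤ f i) (hg0 : g (-1) = 0)
    (hg : ∀ i : ℕ, i < m → g i = ∑ j ∈ Finset.range (i + 1), f j) {a b x : ℤ} (ha : -1 ≤ a)
    (hax : a < x) (hxb : x ≤ b) (hb : b < m) : g a + f x ≤ g b := by
  have hmono : Monotone fun e : ℕ => ∑ j ∈ Finset.range e, f j :=
    monotone_nat_of_le_succ fun e => by
      rw [Finset.sum_range_succ]; have := hf e; omega
  have hga : g a = ∑ j ∈ Finset.range (a + 1).toNat, f j := by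
    rcases eq_or_lt_of_le ha with rfl | h
    · simpa using hg0
    · obtain ⟨a, rfl⟩ := Int.eq_ofNat_of_zero_le (show 0 ≤ a by omega)
      rw [hg a (by omega)]; congr 2
  lift x to ℕ using by omega
  lift b to ℕ using by omega
  rw [hga, hg b (by omega)]
  have h1 := hmono (show (a + 1).toNat ≤ x by omega)
  have h2 := hmono (show x + 1 ≤ b + 1 by omega)
  simp only at h1 h2
  rw [Finset.sum_range_succ] at h2
  omega

/-- The stabbing problem that is described by the tables. -/
def ofTables (m : ℕ) (N : ℤ) (vs : List (List (ℤ × ℤ))) (h : ℕ)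
    (L R root fin nx seg ent cnt : ℤ → ℤ) : StabData where
  d := m
  N := N
  h := h
  base := {p | [p] ∈ vs}
  L := L
  R := R
  root := root
  fin := fin
  nx := nx
  seg := seg
  ent := ent
  cnt := cnt

/-- `root'` is to be the initial node, which carries the last point in cell `-1`; it has to agree
with `root` on the lists only. -/
theorem good_ofTables {m : ℕ} {N : ℤ} {vs : List (List (ℤ × ℤ))} {h J : ℕ}
    {L R root root' fin mn nx seg ent cnt f : ℤ → ℤ} (hvs : WF m vs)
    (hp : Parsed m vs h J L R root fin mn) (hroot : ∀ v : ℕ, root' v = root v) (hm : nx m = m)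
    (hnx : ∀ i : ℤ, 0 ≤ i → i < m → nx i = min (nx (i + 1)) (mn i + m))
    (hf : Marked m L J f) (hg0 : seg (-1) = 0)
    (hg : ∀ i : ℕ, i < m → seg i = ∑ j ∈ Finset.range (i + 1), f j)
    (hent : ∀ q : ℤ, 0 ≤ q → q < m → (nx (q + 1) < m ∧ seg (nx (q + 1)) = seg q ∧
        ent q = ent (nx (q + 1)) ∧ cnt q = cnt (nx (q + 1)) + 1) ∨
      (¬ (nx (q + 1) < m ∧ seg (nx (q + 1)) = seg q) ∧ ent q = q ∧ cnt q = 1)) :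
    (ofTables m N vs h L R root' fin nx seg ent cnt).Good := by
  have hspec := nx_spec hvs hp hm hnx
  have hiv : ∀ v : ℕ, v < h → ∀ j, root v ≤ j → j < fin v →
      ∃ j' : ℕ, j = j' ∧ j' < J := by
    intro v hv j h1 h2
    obtain ⟨l, -, h3, h4, -⟩ := hp.exists_matches v hv
    exact ⟨j.toNat, by omega, by omega⟩
  constructor
  · exact fun p hpm => hvs.bounds _ hpm p (by simp)
  · exact fun i h0 hi => (hspec (m - i).toNat i h0 (by simp only [ofTables] at hi; omega)).2.1
  · intro p hpm i h0 hi
    have := hvs.bounds _ hpm p (by simp)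
    exact (hspec (m - i).toNat i h0 (by omega)).2.2.1 p hpm hi
  · exact fun i h0 hi => (hspec (m - i).toNat i h0 (by simp only [ofTables] at hi; omega)).2.2.2
  · intro v hv j h1 h2
    simp only [ofTables, hroot] at *
    obtain ⟨j', rfl, hj⟩ := hiv v hv j h1 h2
    exact hp.bounds j' hj
  · intro v hv j j' h1 h2 h3
    simp only [ofTables, hroot] at *
    obtain ⟨l, hl, -, -, h4, h5⟩ := hp.exists_matches v hv
    obtain ⟨i, rfl⟩ : ∃ i : ℕ, j = root v + i := ⟨(j - root v).toNat, by omega⟩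
    obtain ⟨i', rfl⟩ : ∃ i : ℕ, j' = root v + i := ⟨(j' - root v).toNat, by omega⟩
    rw [(h5 i (by omega)).2, (h5 i' (by omega)).1]
    exact List.pairwise_iff_getElem.1 (hvs.sorted l hl) i i' _ _ (by omega)
  · intro a b ha hab hb
    rcases eq_or_lt_of_le hab with rfl | hlt
    · exact le_rfl
    · have := seg_add_le hf.nonneg hg0 hg ha hlt le_rfl hb
      have := hf.nonneg b
      simp only [ofTables]; omega
  · intro b h0 hb
    have := seg_add_le hf.nonneg hg0 hg le_rfl (show -1 < 0 by omega) h0 hb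
    have := hf.zero
    simp only [ofTables]; omega
  · intro v hv j h1 h2 a b ha h3 h4 hb
    simp only [ofTables, hroot] at *
    obtain ⟨j', rfl, hj⟩ := hiv v hv j h1 h2
    have := seg_add_le hf.nonneg hg0 hg ha h3 h4 hb
    have := hf.left j' hj
    omega
  · exact hent

/-! ### Correctness of the whole program -/

/-- At most `N` points stab one interval of every list. -/
def Stabbable (N : ℤ) (vs : List (List (ℤ × ℤ))) : Prop :=
  ∃ S : Finset ℤ, (S.card : ℤ) ≤ N ∧ ∀ l ∈ vs, ∃ p ∈ l, ∃ x ∈ S, p.1 ≤ x ∧ x ≤ p.2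

theorem stabbable_iff_feas {m : ℕ} {N : ℤ} {vs : List (List (ℤ × ℤ))} {h J : ℕ}
    {L R root ν fin mn nx seg ent cnt : ℤ → ℤ} (hvs : WF m vs)
    (hp : Parsed m vs h J L R root fin mn) (hν : ∀ v : ℕ, ν v = root v) (h1 : ν (-1) = -1)
    (h2 : ν (-2) = 0) :
    Stabbable N vs ↔ (ofTables m N vs h L R ν fin nx seg ent cnt).Feas ν := by
  constructor
  · rintro ⟨S, hS, hSl⟩
    -- Points may be arbitrary integers, but negative ones stab nothing.
    have hS' : ∀ l ∈ vs, ∃ p ∈ l, ∃ x ∈ S.filter (fun x => -1 < x), p.1 ≤ x ∧ x ≤ p.2 := by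
      intro l hl
      obtain ⟨p, hpl, x, hx, hx'⟩ := hSl l hl
      have := hvs.bounds l hl p hpl
      exact ⟨p, hpl, x, Finset.mem_filter.2 ⟨hx, by omega⟩, hx'⟩
    refine ⟨S.filter (fun x => -1 < x), ?_, ?_, ?_, ?_⟩
    · rw [h1]; exact fun x hx => (Finset.mem_filter.1 hx).2
    · rw [h2]
      have := Finset.card_filter_le S fun x => -1 < x
      simp only [ofTables]; omega
    · intro p hpm _
      obtain ⟨q, hq, hx⟩ := hS' _ hpm
      rw [List.mem_singleton.1 hq] at hx
      exact hx
    · intro v hv _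
      obtain ⟨l, hl, -, -, h4, h5⟩ := hp.exists_matches v hv
      obtain ⟨p, hpl, x, hx, hx'⟩ := hS' l hl
      obtain ⟨i, hi, rfl⟩ := List.getElem_of_mem hpl
      obtain ⟨h6, h7⟩ := h5 i hi
      refine ⟨root v + i, by rw [hν]; omega, by simp only [ofTables]; omega, x, hx, ?_⟩
      simp only [ofTables]
      rw [h6, h7]; exact hx'
  · rintro ⟨S, hS1, hS2, hS3, hS4⟩
    simp only [ofTables] at hS2 hS3 hS4
    refine ⟨S, by omega, ?_⟩
    intro l hl
    rcases hp.single_or l hl with h3 | ⟨v, hv, h4, h5⟩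
    · obtain ⟨p, rfl⟩ := List.length_eq_one_iff.1 h3
      have := hvs.bounds _ hl p (by simp)
      exact ⟨p, by simp, hS3 p hl (by omega)⟩
    · have hpos := List.length_pos_of_ne_nil (hvs.ne_nil l hl)
      obtain ⟨j, hj, hj', x, hx, hx'⟩ := hS4 v hv (by rw [hν]; omega)
      rw [hν] at hj
      obtain ⟨i, rfl⟩ : ∃ i : ℕ, j = root v + i := ⟨(j - root v).toNat, by omega⟩
      obtain ⟨h6, h7⟩ := h5 i (by omega)
      rw [h6, h7] at hx'
      exact ⟨_, List.getElem_mem _, x, hx, hx'⟩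

theorem run_program (m : ℕ) (N : ℤ) (vs : List (List (ℤ × ℤ))) (hvs : WF m vs) :
    Run program (State.init ((vs.length : ℤ) :: (m : ℤ) :: N :: encodeLists vs)) fun t s =>
      t ≤ 7010 * (listExcess vs + 1) ^ 2 * (weight (listExcess vs) + 1) +
        1000 * (listLength vs + m + listExcess vs + 1) ∧
      (Stabbable N vs → s.reg 0 = 1) ∧ (¬ Stabbable N vs → s.reg 0 = 0) := by
  set w := (vs.length : ℤ) :: (m : ℤ) :: N :: encodeLists vs with hw
  obtain ⟨e0, e1, e2, e3⟩ : (State.init w).arr 0 0 = vs.length ∧ (State.init w).arr 0 1 = m ∧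
    (State.init w).arr 0 2 = N ∧ Reads ((State.init w).arr 0) 3 (encodeLists vs) := reads_init w
  have hreg : ∀ x, (State.init w).reg x = 0 := fun _ => rfl
  have harr : ∀ a, a ≠ 0 → (State.init w).arr a = fun _ => 0 := fun a ha => by
    funext i; simp [State.init, ha]
  generalize State.init w = s₀ at *
  simp only [program, prepare, run_seq, run_assign, Expr.eval, Expr.cost, arr_setReg,
    e0, e1, e2]
  have hinit : ParseInv m [] vs ((((s₀.setReg 1 vs.length).setReg 2 m).setReg 3 N).setReg 4 3) := by
    refine ⟨?_, ?_, ?_, ?_, 0, 0, ?_, ?_, ?_⟩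
    · simpa using e3
    · simp
    · simp
    · simp [hreg]
    · simp [hreg]
    · simp [hreg]
    · simp only [arr_setReg, harr 4 (by decide), harr 10 (by decide)]
      refine ⟨by simp, by simp, by simp [listExcess], by simp, by simp, by simp, by simp, ?_, by simp, rfl, rfl⟩
      intro i hi; simp at hi
  refine (run_parse hvs hinit).frame ?_
  rintro t₁ s₁ hr₁ ha₁ ⟨ht₁, -, -, h2, -, h, J, h6, h7, hp⟩
  have hN : s₁.reg 3 = N := by
    rw [hr₁ 3 (by decide)]; simp
  have hz : ∀ x, x = 0 ∨ 18 ≤ x → s₁.reg x = 0 := fun x hx => by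
    rw [hr₁ x (by simp [Cmd.regs, parse, parseBody, moveBody]; omega)]
    simp only [reg_setReg]
    rw [if_neg (by omega), if_neg (by omega), if_neg (by omega), if_neg (by omega), hreg]
  have h5 : s₁.arr 5 = fun _ => 0 := by
    rw [ha₁ 5 (by decide)]; simp only [arr_setReg]; exact harr 5 (by decide)
  refine (run_mark h7 h5 fun j hj => ⟨(hp.bounds j hj).1, (hp.bounds j hj).2.1.trans_lt (hp.bounds j hj).2.2⟩).frame ?_
  rintro t₂ s₂ hr₂ ha₂ ⟨ht₂, hM⟩
  refine (run_accumulate (m := m) (by rw [hr₂ 2 (by decide), h2]) hM.neg_one).frame ?_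
  rintro t₃ s₃ hr₃ ha₃ ⟨ht₃, hg0, hg⟩
  refine (run_fillNx (m := m) (by rw [hr₃ 2 (by decide), hr₂ 2 (by decide), h2])).frame ?_
  rintro t₄ s₄ hr₄ ha₄ ⟨ht₄, hm, hnx⟩
  rw [ha₃ 4 (by decide), ha₂ 4 (by decide)] at hnx
  rw [← ha₄ 5 (by decide)] at hg0 hg
  have hspec := nx_spec hvs hp hm hnx
  refine (run_fillEnt (m := m) (by rw [hr₄ 2 (by decide), hr₃ 2 (by decide), hr₂ 2 (by decide), h2])
    (fun i h0 hi => (hspec (m - i).toNat i h0 (by omega)).1)).frame ?_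
  rintro t₅ s₅ hr₅ ha₅ ⟨ht₅, hent⟩
  simp only [run_store, Expr.eval, Expr.cost]
  have hr : ∀ x, x = 0 ∨ x = 2 ∨ x = 3 ∨ x = 6 ∨ 18 ≤ x → s₅.reg x = s₁.reg x := fun x hx => by
    rw [hr₅ x (by simp [Cmd.regs, fillEnt]; omega), hr₄ x (by simp [Cmd.regs, fillNx]; omega),
      hr₃ x (by simp [Cmd.regs, accumulate]; omega), hr₂ x (by simp [Cmd.regs, mark]; omega)]
  have ha : ∀ b, b ≠ 5 → b ≠ 6 → b ≠ 7 → b ≠ 8 → s₅.arr b = s₁.arr b := fun b h5 h6 h7 h8 => by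
    rw [ha₅ b (by simp [Cmd.arrs, fillEnt]; omega), ha₄ b (by simp [Cmd.arrs, fillNx]; omega),
      ha₃ b (by simp [Cmd.arrs, accumulate]; omega), ha₂ b (by simp [Cmd.arrs, mark]; omega)]
  -- The table of first intervals becomes the initial node: last point `-1`, and no point counted
  -- because cell `-2` is still `0`.
  set ν := Function.update (s₁.arr 10) (-1) (-1) with hν
  have hνr : ∀ v : ℕ, ν v = s₁.arr 10 v := fun v => Function.update_of_ne (by omega) _ _
  have hν1 : ν (-1) = -1 := Function.update_self _ _ _
  have hν2 : ν (-2) = 0 := by rw [hν, Function.update_of_ne (by omega)]; exact hp.neg_two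
  have hΓ := good_ofTables (N := N) (root' := ν) hvs hp hνr hm hnx hM hg0 hg hent
  set Γ := ofTables m N vs h (s₁.arr 1) (s₁.arr 2) ν (s₁.arr 3) (s₄.arr 6) (s₄.arr 5) (s₅.arr 7)
    (s₅.arr 8) with hΓdef
  have hiff := stabbable_iff_feas (N := N) (nx := s₄.arr 6) (seg := s₄.arr 5) (ent := s₅.arr 7)
    (cnt := s₅.arr 8) hvs hp hνr hν1 hν2
  rw [← hΓdef] at hiff
  have hval : Γ.Val ν := by
    refine ⟨by omega, ?_, ?_, fun v _ => le_rfl, ?_, ?_⟩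
    · rw [hν1]; simp only [hΓdef, ofTables]; omega
    · rw [hν1]
      intro hlt
      refine hΓ.seg_start _ ?_ hlt
      exact (hspec m 0 le_rfl (by simp)).1
    · intro v hv
      obtain ⟨l, -, -, -, h4, -⟩ := hp.exists_matches v hv
      rw [hνr]; simp only [hΓdef, ofTables]; omega
    · intro v hv hlt
      have := hΓ.iv_ok v hv _ le_rfl hlt
      rw [hν1]
      exact lt_of_lt_of_le (by omega) this.1
  have hex : Γ.excess ν = listExcess vs := by
    rw [← hp.excess]
    refine Finset.sum_congr rfl fun v _ => ?_
    rw [hνr]; rfl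
  have hC : Γ.Ctx s₅ := by
    constructor
    · rw [hr 2 (by decide), h2]; rfl
    · rw [hr 3 (by decide), hN]; rfl
    · rw [hr 6 (by decide), h6]; rfl
    · rw [ha 1 (by decide) (by decide) (by decide) (by decide)]; rfl
    · rw [ha 2 (by decide) (by decide) (by decide) (by decide)]; rfl
    · rw [ha 3 (by decide) (by decide) (by decide) (by decide)]; rfl
    · rw [ha₅ 6 (by decide)]; rfl
    · rfl
    · rfl
  have h10 : s₅.arr 10 = s₁.arr 10 := ha 10 (by decide) (by decide) (by decide) (by decide)
  -- `seg` never exceeds the total number `1 + J` of marks.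
  have hK : ∀ b, -1 ≤ b → b < Γ.d → 0 ≤ Γ.seg b ∧ Γ.seg b ≤ ((1 + J : ℕ) : ℤ) := by
    intro b h1 h2
    have h3 := hΓ.seg_mono (-1) b le_rfl h1 h2
    have h4 : Γ.seg (-1) = 0 := hg0
    refine ⟨by omega, ?_⟩
    push_cast
    rw [← hM.sum]
    rcases eq_or_lt_of_le h1 with rfl | h5
    · rw [h4]; exact Finset.sum_nonneg fun i _ => hM.nonneg i
    · lift b to ℕ using by omega
      have h6 : b < m := by simp only [hΓdef, ofTables] at h2; omega
      have h7 : Γ.seg b = _ := hg b h6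
      rw [h7]
      refine Finset.sum_le_sum_of_subset_of_nonneg ?_ fun i _ _ => hM.nonneg i
      exact Finset.range_mono (by omega)
  have hJ := hp.J_le
  have hh : Γ.h ≤ listExcess vs := hp.h_le
  have hinv : Γ.SearchInv (Stabbable N vs) [] ((s₅.setArr 10 (-1) (-1)).setReg 18 1) := by
    have harr10 : ((s₅.setArr 10 (-1) (-1)).setReg 18 1).arr 10 = ν := by
      simp [h10, hν]
    refine ⟨(hC.setArr (show 9 ≤ 10 by decide) _ _).setReg (by decide) _, ?_, ?_, ?_, ?_, ?_, ?_⟩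
    · simp [hr 0, hz 0]
    · simp
    · rw [harr10]; exact hval
    · show _ = (0 : ℤ)
      simp [hr 19, hz 19]
    · simp
    · rw [harr10, hiff]; simp
  refine (run_search (K := 1 + J) (k := listExcess vs) hΓ hK (by omega) hh hinv).mono ?_
  rintro t₆ s₆ ⟨ht₆, hres⟩
  have harr10 : ((s₅.setArr 10 (-1) (-1)).setReg 18 1).arr 10 = ν := by
    simp [h10, hν]
  rw [harr10, hex] at ht₆
  refine ⟨?_, hres⟩
  omega

end StabData

/-! ### Holes and intervals of domains -/

section Domains

variable {D : Type*} [LinearOrder D] [Fintype D]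

/-- A set without holes contains everything between its elements. -/
theorem Icc_subset_of_holes_eq_empty {U : Finset D} (h : holes U = ∅) {a b : D} (ha : a ∈ U)
    (hb : b ∈ U) : Set.Icc a b ⊆ U := by
  rintro v ⟨hav, hvb⟩
  by_contra hv
  have hv' : v ∉ U := hv
  have hlo : (U.filter (· < v)).Nonempty :=
    ⟨a, Finset.mem_filter.2 ⟨ha, lt_of_le_of_ne hav (by rintro rfl; exact hv' ha)⟩⟩
  have hhi : (U.filter (v < ·)).Nonempty :=
    ⟨b, Finset.mem_filter.2 ⟨hb, lt_of_le_of_ne hvb (by rintro rfl; exact hv' hb)⟩⟩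
  have h1 := Finset.mem_filter.1 (Finset.max'_mem _ hlo)
  have h2 := Finset.mem_filter.1 (Finset.min'_mem _ hhi)
  -- The neighbours of the missing value `v` in `U` on either side form a hole.
  have : ((U.filter (· < v)).max' hlo, (U.filter (v < ·)).min' hhi) ∈ holes U := by
    simp only [holes, Finset.mem_filter, Finset.mem_univ, true_and]
    refine ⟨h1.1, h2.1, ⟨v, hv', h1.2, h2.2⟩, ?_⟩
    rintro ⟨x, hx, hx1, hx2⟩
    rcases lt_trichotomy x v with h | rfl | h
    · exact absurd (Finset.le_max' _ x (Finset.mem_filter.2 ⟨hx, h⟩)) (not_le.2 hx1)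
    · exact hv' hx
    · exact absurd (Finset.min'_le _ x (Finset.mem_filter.2 ⟨hx, h⟩)) (not_le.2 hx2)
  rw [h] at this
  simp at this

theorem holes_eq_empty_of_ordConnected {U : Finset D}
    (h : ∀ a ∈ U, ∀ b ∈ U, Set.Icc a b ⊆ U) : holes U = ∅ := by
  refine Finset.eq_empty_of_forall_notMem fun p hp => ?_
  simp only [holes, Finset.mem_filter, Finset.mem_univ, true_and] at hp
  obtain ⟨h1, h2, ⟨v, hv, h3, h4⟩, -⟩ := hp
  exact hv (h _ h1 _ h2 ⟨h3.le, h4.le⟩)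

/-- The endpoints of the intervals of `S` are the endpoints of the maximal segments in `S`. -/
theorem mem_intervalEndpoints {S : Finset D} {p : D ×ₗ D} (hp : p ∈ intervalEndpoints S) :
    (ofLex p).1 ≤ (ofLex p).2 ∧ Set.Icc (ofLex p).1 (ofLex p).2 ⊆ S ∧
      ∀ a b, a ≤ (ofLex p).1 → (ofLex p).2 ≤ b → Set.Icc a b ⊆ S →
        a = (ofLex p).1 ∧ b = (ofLex p).2 := by
  simp only [intervalEndpoints, Finset.mem_filter, Finset.mem_univ, true_and] at hp
  obtain ⟨T, hT, hl, hg⟩ := hp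
  have hTS : T ⊆ S := hT.prop.1
  have hle : (ofLex p).1 ≤ (ofLex p).2 := hl.2 hg.1
  refine ⟨hle, (Icc_subset_of_holes_eq_empty hT.prop.2 hl.1 hg.1).trans (by exact_mod_cast hTS), ?_⟩
  intro a b ha hb hab
  classical
  have hU : (Finset.univ.filter fun v => a ≤ v ∧ v ≤ b) ⊆ S ∧
      holes (Finset.univ.filter fun v => a ≤ v ∧ v ≤ b) = ∅ := by
    refine ⟨fun v hv => hab (by simpa using hv), holes_eq_empty_of_ordConnected ?_⟩
    intro x hx y hy z hz
    simp only [Finset.mem_filter, Finset.mem_univ, true_and] at hx hy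
    simp only [Finset.coe_filter, Finset.mem_univ, true_and, Set.mem_ofPred_eq]
    exact ⟨hx.1.trans hz.1, hz.2.trans hy.2⟩
  have hTU : T ⊆ Finset.univ.filter fun v => a ≤ v ∧ v ≤ b := fun v hv => by
    simp only [Finset.mem_filter, Finset.mem_univ, true_and]
    exact ⟨ha.trans (hl.2 hv), (hg.2 hv).trans hb⟩
  -- The whole segment from `a` to `b` is a hole-free subset of `S` that contains `T`, so it cannot
  -- be larger than `T`.
  have hUT := hT.le_of_ge hU hTU
  have hab' : a ≤ b := ha.trans (hle.trans hb)
  have h1 : a ∈ T := hUT (by simpa using hab')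
  have h2 : b ∈ T := hUT (by simpa using hab')
  exact ⟨le_antisymm ha (hl.2 h1), le_antisymm (hg.2 h2) hb⟩

/-- Every element of `S` lies in an interval of `S`. -/
theorem exists_mem_intervalEndpoints {S : Finset D} {v : D} (hv : v ∈ S) :
    ∃ p ∈ intervalEndpoints S, (ofLex p).1 ≤ v ∧ v ≤ (ofLex p).2 := by
  classical
  have hv1 : ({v} : Finset D) ⊆ S ∧ holes ({v} : Finset D) = ∅ := by
    refine ⟨by simpa using hv, holes_eq_empty_of_ordConnected ?_⟩
    intro a ha b hb x hx
    rw [Finset.mem_singleton] at ha hb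
    subst ha; subst hb
    simpa using le_antisymm hx.2 hx.1
  obtain ⟨T, hT, hmax⟩ := (Set.toFinite {U : Finset D | U ⊆ S ∧ holes U = ∅}).exists_le_maximal hv1
  have hvT : v ∈ T := hT (by simp)
  have hne : T.Nonempty := ⟨v, hvT⟩
  refine ⟨toLex (T.min' hne, T.max' hne), ?_, T.min'_le v hvT, T.le_max' v hvT⟩
  simp only [intervalEndpoints, Finset.mem_filter, Finset.mem_univ, true_and]
  exact ⟨T, hmax, T.isLeast_min' hne, T.isGreatest_max' hne⟩

/-- Of two intervals, the one with the smaller left endpoint ends first, and a value outside of `S`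
separates them. -/
theorem intervalEndpoints_separated {S : Finset D} {p q : D ×ₗ D} (hp : p ∈ intervalEndpoints S)
    (hq : q ∈ intervalEndpoints S) (hpq : p < q) :
    ∃ v, v ∉ S ∧ (ofLex p).2 < v ∧ v < (ofLex q).1 := by
  obtain ⟨hp1, hp2, hp3⟩ := mem_intervalEndpoints hp
  obtain ⟨hq1, hq2, hq3⟩ := mem_intervalEndpoints hq
  have hle : (ofLex p).1 ≤ (ofLex q).1 := by
    rcases Prod.Lex.lt_iff.1 hpq with h | h
    exacts [h.le, h.1.le]
  by_contra hcon
  push Not at hcon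
  -- Without a separating value the two intervals would merge into one segment inside `S`, against
  -- their maximality.
  have hsub : Set.Icc (ofLex p).1 (max (ofLex p).2 (ofLex q).2) ⊆ S := by
    rintro v ⟨h1, h2⟩
    by_cases h3 : v ≤ (ofLex p).2
    · exact hp2 ⟨h1, h3⟩
    · by_cases h4 : (ofLex q).1 ≤ v
      · exact hq2 ⟨h4, by rcases le_max_iff.1 h2 with h | h; exacts [absurd h h3, h]⟩
      · by_contra hv
        exact absurd (hcon v hv (not_le.1 h3)) h4
  have h1 := hp3 _ _ le_rfl (le_max_left _ _) hsub
  have h2 := hq3 _ _ hle (le_max_right _ _) hsub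
  have : p = q := by
    apply ofLex.injective
    exact Prod.ext h2.1 (h1.2.symm.trans h2.2)
  exact absurd this hpq.ne

/-- A set has at most one interval more than it has holes. -/
theorem card_intervalEndpoints_le (S : Finset D) :
    (intervalEndpoints S).card ≤ (holes S).card + 1 := by
  classical
  rcases (intervalEndpoints S).eq_empty_or_nonempty with h | hne
  · rw [h]; simp
  have hS : ∀ p ∈ intervalEndpoints S, (ofLex p).1 ∈ S ∧ (ofLex p).2 ∈ S := fun p hp => by
    obtain ⟨h1, h2, -⟩ := mem_intervalEndpoints hp
    exact ⟨h2 ⟨le_rfl, h1⟩, h2 ⟨h1, le_rfl⟩⟩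
  set p₀ := (intervalEndpoints S).min' hne with hp₀
  have hp₀m : p₀ ∈ intervalEndpoints S := Finset.min'_mem _ hne
  -- every interval but the first one follows a hole
  have hhole : ∀ q ∈ (intervalEndpoints S).erase p₀, ∃ u, (u, (ofLex q).1) ∈ holes S := by
    intro q hq
    obtain ⟨hq0, hq⟩ := Finset.mem_erase.1 hq
    have hlt : p₀ < q := lt_of_le_of_ne (Finset.min'_le _ _ hq) (Ne.symm hq0)
    obtain ⟨v, hv, hv1, hv2⟩ := intervalEndpoints_separated hp₀m hq hlt
    have hne' : (S.filter (· < (ofLex q).1)).Nonempty :=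
      ⟨(ofLex p₀).2, Finset.mem_filter.2 ⟨(hS p₀ hp₀m).2, hv1.trans hv2⟩⟩
    have hm := Finset.mem_filter.1 (Finset.max'_mem _ hne')
    -- The hole before `q` starts at the greatest element of `S` below the left endpoint of `q`. If
    -- no value were missing in between, `q` could be prolonged to the left.
    refine ⟨(S.filter (· < (ofLex q).1)).max' hne', ?_⟩
    have hnot : ¬ ∃ x ∈ S, (S.filter (· < (ofLex q).1)).max' hne' < x ∧ x < (ofLex q).1 := by
      rintro ⟨x, hx, hx1, hx2⟩
      exact absurd (Finset.le_max' _ x (Finset.mem_filter.2 ⟨hx, hx2⟩)) (not_le.2 hx1)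
    simp only [holes, Finset.mem_filter, Finset.mem_univ, true_and]
    refine ⟨hm.1, (hS q hq).1, ?_, hnot⟩
    by_contra hcon
    push Not at hcon
    obtain ⟨hq1, hq2, hq3⟩ := mem_intervalEndpoints hq
    refine absurd (hq3 ((S.filter (· < (ofLex q).1)).max' hne') _ hm.2.le le_rfl ?_).1 hm.2.ne
    rintro x ⟨hx1, hx2⟩
    by_cases h : (ofLex q).1 ≤ x
    · exact hq2 ⟨h, hx2⟩
    · rcases eq_or_lt_of_le hx1 with rfl | hx1
      · exact hm.1
      · by_contra hxS
        exact h (hcon x hxS hx1)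
  have : Nonempty D := ⟨(ofLex p₀).1⟩
  choose! u hu using hhole
  have hcard : ((intervalEndpoints S).erase p₀).card ≤ (holes S).card := by
    -- Different intervals are separated, hence have different left endpoints and follow different
    -- holes.
    refine Finset.card_le_card_of_injOn (fun q => (u q, (ofLex q).1)) (fun q hq => hu q hq) ?_
    intro q hq q' hq' he
    have h1 : (ofLex q).1 = (ofLex q').1 := congrArg Prod.snd he
    rw [Finset.mem_coe, Finset.mem_erase] at hq hq'
    rcases lt_trichotomy q q' with h | h | h
    · obtain ⟨v, -, h2, h3⟩ := intervalEndpoints_separated hq.2 hq'.2 h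
      have := (mem_intervalEndpoints hq.2).1
      exact absurd (h2.trans h3) (not_lt.2 (h1 ▸ this))
    · exact h
    · obtain ⟨v, -, h2, h3⟩ := intervalEndpoints_separated hq'.2 hq.2 h
      have := (mem_intervalEndpoints hq'.2).1
      exact absurd (h2.trans h3) (not_lt.2 (h1 ▸ this))
  rw [Finset.card_erase_of_mem hp₀m] at hcard
  omega

theorem valueRank_lt_card (v : D) : valueRank v < Fintype.card D := by
  refine Finset.card_lt_univ_of_notMem (x := v) ?_
  simp

theorem valueRank_strictMono : StrictMono (valueRank : D → ℕ) := by
  intro a b hab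
  refine Finset.card_lt_card ⟨fun x hx => ?_, fun h => ?_⟩
  · simp only [Finset.mem_filter, Finset.mem_univ, true_and] at hx ⊢
    exact hx.trans hab
  · have := h (Finset.mem_filter.2 ⟨Finset.mem_univ a, hab⟩)
    simp at this

theorem exists_valueRank_eq {r : ℕ} (hr : r < Fintype.card D) : ∃ v : D, valueRank v = r := by
  have hinj : Function.Injective fun v : D => (⟨valueRank v, valueRank_lt_card v⟩ :
      Fin (Fintype.card D)) := fun a b h => valueRank_strictMono.injective (congrArg Fin.val h)
  obtain ⟨v, hv⟩ := ((Fintype.bijective_iff_injective_and_card _).2 ⟨hinj, by simp⟩).2 ⟨r, hr⟩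
  exact ⟨v, congrArg Fin.val hv⟩

/-- The intervals of a domain, in terms of positions. -/
noncomputable def intervalList (S : Finset D) : List (ℤ × ℤ) :=
  ((intervalEndpoints S).sort (· ≤ ·)).map fun p =>
    ((valueRank (ofLex p).1 : ℤ), (valueRank (ofLex p).2 : ℤ))

theorem length_intervalList (S : Finset D) :
    (intervalList S).length = (intervalEndpoints S).card := by
  simp [intervalList]

/-- The intervals of a domain cover exactly the domain. -/
theorem mem_iff_intervalList {S : Finset D} {v : D} :
    v ∈ S ↔ ∃ p ∈ intervalList S, p.1 ≤ valueRank v ∧ (valueRank v : ℤ) ≤ p.2 := by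
  simp only [intervalList, List.mem_map, Finset.mem_sort]
  constructor
  · intro hv
    obtain ⟨p, hp, h1, h2⟩ := exists_mem_intervalEndpoints hv
    exact ⟨_, ⟨p, hp, rfl⟩, Int.ofNat_le.2 (valueRank_strictMono.monotone h1),
      Int.ofNat_le.2 (valueRank_strictMono.monotone h2)⟩
  · rintro ⟨_, ⟨p, hp, rfl⟩, h1, h2⟩
    refine (mem_intervalEndpoints hp).2.1 ⟨?_, ?_⟩
    · exact valueRank_strictMono.le_iff_le.1 (Int.ofNat_le.1 h1)
    · exact valueRank_strictMono.le_iff_le.1 (Int.ofNat_le.1 h2)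

theorem intervalList_bounds {S : Finset D} {p : ℤ × ℤ} (hp : p ∈ intervalList S) :
    0 ≤ p.1 ∧ p.1 ≤ p.2 ∧ p.2 < Fintype.card D := by
  simp only [intervalList, List.mem_map, Finset.mem_sort] at hp
  obtain ⟨p, hp, rfl⟩ := hp
  refine ⟨by simp, ?_, ?_⟩
  · exact Int.ofNat_le.2 (valueRank_strictMono.monotone (mem_intervalEndpoints hp).1)
  · exact Int.ofNat_lt.2 (valueRank_lt_card _)

theorem intervalList_sorted (S : Finset D) :
    (intervalList S).Pairwise fun p q => p.2 < q.1 := by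
  rw [intervalList, List.pairwise_map]
  have hlt : ((intervalEndpoints S).sort (· ≤ ·)).Pairwise (· < ·) := Finset.sortedLT_sort _ |>.pairwise
  refine hlt.imp_of_mem ?_
  intro p q hp hq hpq
  rw [Finset.mem_sort] at hp hq
  obtain ⟨v, -, h1, h2⟩ := intervalEndpoints_separated hp hq hpq
  exact Int.ofNat_lt.2 (valueRank_strictMono (h1.trans h2))

end Domains

namespace AtMostNValue

variable {n : ℕ} {D : Type*} [LinearOrder D] [Fintype D]

/-- The domains of an instance as lists of intervals. -/
noncomputable def lists (I : AtMostNValue n D) : List (List (ℤ × ℤ)) :=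
  (List.finRange n).map fun x => intervalList (I.dom x)

theorem wf_lists (I : AtMostNValue n D) : StabData.WF (Fintype.card D : ℤ) I.lists := by
  refine ⟨?_, ?_, ?_⟩
  · simp only [lists, List.mem_map, List.mem_finRange, true_and]
    rintro _ ⟨x, rfl⟩ h
    obtain ⟨v, hv⟩ := I.dom_nonempty x
    obtain ⟨p, hp, -⟩ := mem_iff_intervalList.1 hv
    rw [h] at hp
    simp at hp
  · simp only [lists, List.mem_map, List.mem_finRange, true_and]
    rintro _ ⟨x, rfl⟩ p hp
    exact intervalList_bounds hp
  · simp only [lists, List.mem_map, List.mem_finRange, true_and]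
    rintro _ ⟨x, rfl⟩
    exact intervalList_sorted _

theorem encode_eq (I : AtMostNValue n D) :
    I.encode = (I.lists.length : ℤ) :: (Fintype.card D : ℤ) :: I.N ::
      StabData.encodeLists I.lists := by
  simp only [encode, lists, StabData.encodeLists, StabData.encodeIntervals, List.length_map,
    List.length_finRange, List.flatMap_map, Finset.length_sort, intervalList]

theorem consistent_iff (I : AtMostNValue n D) :
    I.Consistent ↔ StabData.Stabbable I.N I.lists := by
  classical
  constructor
  · rintro ⟨α, hα, hN⟩
    refine ⟨(Finset.univ.image α).image fun v => (valueRank v : ℤ), ?_, ?_⟩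
    · exact le_trans (by exact_mod_cast Finset.card_image_le) hN
    · simp only [lists, List.mem_map, List.mem_finRange, true_and]
      rintro _ ⟨x, rfl⟩
      obtain ⟨p, hp, h⟩ := mem_iff_intervalList.1 (hα x)
      exact ⟨p, hp, _, Finset.mem_image_of_mem _ (Finset.mem_image_of_mem _ (Finset.mem_univ x)), h⟩
  · rintro ⟨S, hS, hl⟩
    have : ∀ x : Fin n, ∃ v ∈ I.dom x, (valueRank v : ℤ) ∈ S := by
      intro x
      obtain ⟨p, hp, y, hy, h1, h2⟩ := hl (intervalList (I.dom x))
        (List.mem_map.2 ⟨x, List.mem_finRange x, rfl⟩)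
      have hb := intervalList_bounds hp
      lift y to ℕ using by omega
      obtain ⟨v, hv⟩ := exists_valueRank_eq (D := D) (r := y) (by omega)
      exact ⟨v, mem_iff_intervalList.2 ⟨p, hp, by omega, by omega⟩, by rw [hv]; exact hy⟩
    choose α hα hαS using this
    refine ⟨α, hα, le_trans ?_ hS⟩
    norm_cast
    refine Finset.card_le_card_of_injOn (fun v => (valueRank v : ℤ)) ?_ ?_
    · intro v hv
      simp only [Finset.coe_image, Finset.coe_univ, Set.image_univ, Set.mem_range] at hv
      obtain ⟨x, rfl⟩ := hv
      exact hαS x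
    · intro a _ b _ h
      exact valueRank_strictMono.injective (Int.ofNat_inj.1 h)

theorem listExcess_le (I : AtMostNValue n D) : StabData.listExcess I.lists ≤ I.numHoles := by
  rw [StabData.listExcess, lists, List.map_map, numHoles, ← Fin.sum_univ_def]
  refine Finset.sum_le_sum fun x _ => ?_
  have := card_intervalEndpoints_le (I.dom x)
  simp only [Function.comp_apply, length_intervalList]
  omega

theorem listLength_le (I : AtMostNValue n D) : StabData.listLength I.lists ≤ n + I.numHoles := by
  rw [StabData.listLength, lists, List.map_map, numHoles, ← Fin.sum_univ_def]
  calc _ ≤ ∑ x, (1 + (holes (I.dom x)).card) := ?_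
    _ = n + ∑ x, (holes (I.dom x)).card := by simp [Finset.sum_add_distrib]
  refine Finset.sum_le_sum fun x _ => ?_
  have := card_intervalEndpoints_le (I.dom x)
  simp only [Function.comp_apply, length_intervalList]
  omega

end AtMostNValue

/-! ### The time bound -/

/-- Two consecutive bounds are carried along because the recurrence has order two; the step uses ρ²
= ρ + 1. -/
theorem fib_le_pow (m : ℕ) : (Nat.fib (m + 1) : ℝ) ≤ ((1 + Real.sqrt 5) / 2) ^ m ∧
    (Nat.fib (m + 2) : ℝ) ≤ ((1 + Real.sqrt 5) / 2) ^ (m + 1) := by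
  have hsq : Real.sqrt 5 ^ 2 = 5 := Real.sq_sqrt (by norm_num)
  have h1 : 1 ≤ Real.sqrt 5 := Real.one_le_sqrt.2 (by norm_num)
  induction m with
  | zero => constructor <;> norm_num; linarith
  | succ m ih =>
    refine ⟨ih.2, ?_⟩
    have : Nat.fib (m + 1 + 2) = Nat.fib (m + 1) + Nat.fib (m + 2) := Nat.fib_add_two
    rw [this]
    push_cast
    calc (Nat.fib (m + 1) : ℝ) + Nat.fib (m + 2)
        ≤ ((1 + Real.sqrt 5) / 2) ^ m + ((1 + Real.sqrt 5) / 2) ^ (m + 1) := add_le_add ih.1 ih.2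
      _ = ((1 + Real.sqrt 5) / 2) ^ (m + 1 + 1) := by
        have : ((1 + Real.sqrt 5) / 2) * ((1 + Real.sqrt 5) / 2) = 1 + (1 + Real.sqrt 5) / 2 := by
          nlinarith
        rw [pow_succ _ (m + 1), pow_succ _ m, mul_assoc, this]; ring

theorem goldenRatio_lt : (1 + Real.sqrt 5) / 2 < (1.6181 : ℝ) := by
  have : Real.sqrt 5 < 2.2362 := by
    rw [Real.sqrt_lt' (by norm_num)]; norm_num
  linarith

/-- The left side is 2 F(k+2) ≤ 2 ρ^(k+1), and ρ ≤ 2. -/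
theorem weight_le (k : ℕ) : ((StabData.weight k : ℕ) : ℝ) + 1 ≤ 4 * ((1 + Real.sqrt 5) / 2) ^ k := by
  have h0 := StabData.weight_pos k
  have h1 : ((StabData.weight k : ℕ) : ℝ) + 1 = 2 * Nat.fib (k + 2) := by
    have : StabData.weight k + 1 = 2 * Nat.fib (k + 2) := by
      unfold StabData.weight at *; omega
    exact_mod_cast this
  have h2 := (fib_le_pow k).2
  have h3 := goldenRatio_lt
  have h4 : (0 : ℝ) ≤ ((1 + Real.sqrt 5) / 2) ^ k := by positivity
  rw [pow_succ] at h2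
  rw [h1]
  nlinarith

theorem mainTheorem2 :
    (1 + Real.sqrt 5) / 2 < (1.6181 : ℝ) ∧
    ∃ (P : RAM.Cmd) (C : ℝ),
      ∀ (n : ℕ) (D : Type*) [LinearOrder D] [Fintype D] (I : AtMostNValue n D),
        ∃ (t : ℕ) (s : RAM.State),
          RAM.Exec P (RAM.State.init I.encode) t s ∧
          (t : ℝ) ≤
            C * (((1 + Real.sqrt 5) / 2) ^ I.numHoles * (I.numHoles : ℝ) ^ 2 + (I.size : ℝ)) ∧
          (I.Consistent → s.reg 0 = 1) ∧
          (¬ I.Consistent → s.reg 0 = 0) := by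
  refine ⟨goldenRatio_lt, StabData.program, 200000, ?_⟩
  intro n D _ _ I
  obtain ⟨t, s, hE, ht, h1, h2⟩ :=
    StabData.run_program (Fintype.card D) I.N I.lists I.wf_lists
  rw [← I.encode_eq] at hE
  refine ⟨t, s, hE, ?_, fun h => h1 (I.consistent_iff.1 h), fun h => h2 fun h' =>
    h (I.consistent_iff.2 h')⟩
  have hex := I.listExcess_le
  have hlen := I.listLength_le
  set k := I.numHoles with hk
  have hsize : (I.size : ℝ) = n + Fintype.card D + k + 1 := by
    rw [AtMostNValue.size]; push_cast; rfl
  have ht' : t ≤ 7010 * (k + 1) ^ 2 * (StabData.weight k + 1) +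
      2000 * (n + Fintype.card D + k + 1) := by
    refine ht.trans (Nat.add_le_add ?_ (by omega))
    have := StabData.weight_mono hex
    gcongr
  have ht'' : (t : ℝ) ≤ 7010 * ((k : ℝ) + 1) ^ 2 * ((StabData.weight k : ℕ) + 1) +
      2000 * (n + Fintype.card D + k + 1) := by exact_mod_cast ht'
  refine ht''.trans ?_
  rw [hsize]
  have hn : (0 : ℝ) ≤ n + Fintype.card D := by positivity
  -- For `k = 0` the term ρ^k k² vanishes, and the bounded cost of the search is charged to the
  -- size, which is at least 1.
  rcases Nat.eq_zero_or_pos k with h0 | hpos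
  · have : StabData.weight 0 = 1 := by decide
    rw [h0, this]
    push_cast
    linarith
  · have hk1 : (1 : ℝ) ≤ k := by exact_mod_cast hpos
    have hw := weight_le k
    -- For `k ≥ 1` the search costs at most 7010 · 4 · 4 · ρ^k k² steps, which is below 200000 ρ^k
    -- k².
    have hsq : ((k : ℝ) + 1) ^ 2 ≤ 4 * (k : ℝ) ^ 2 := by nlinarith
    have hmul : ((k : ℝ) + 1) ^ 2 * ((StabData.weight k : ℕ) + 1) ≤
        (4 * (k : ℝ) ^ 2) * (4 * ((1 + Real.sqrt 5) / 2) ^ k) := by gcongr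
    have hnn : 0 ≤ ((1 + Real.sqrt 5) / 2) ^ k * (k : ℝ) ^ 2 := by positivity
    nlinarith
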